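/- \textbf{Setting.} Let $\Omega=(a,b)$ be a bounded interval, $1<\alpha<2$, $0<\gamma<1$, $K=K_{\gamma,\alpha}>0$, and let $pU\ge 0$ be a real constant. $(\cdot,\cdot)$ and $\|\cdot\|$ are the inner product and norm of the real space $L^2(\Omega)$; $H_0^{\alpha/2}(\Omega)$ is the closure of $C_0^\infty(\Omega)$ in the norm of $H^{\alpha/2}$. For $u,v\in H_0^{\alpha/2}(\Omega)$ put $$B(u,v)=\frac{\big({}_aD_x^{\alpha/2}u,\,{}_xD_b^{\alpha/2}v\big)+\big({}_xD_b^{\alpha/2}u,\,{}_aD_x^{\alpha/2}v\big)}{2\cos(\alpha\pi/2)},\qquad |||u|||=B(u,u)^{1/2},$$ where ${}_aD_x^{s}u(x)=\frac{1}{\Gamma(1-s)}\frac{d}{dx}\int_a^x\frac{u(\xi)\,d\xi}{(x-\xi)^{s}}$ and ${}_xD_b^{s}u(x)=\frac{-1}{\Gamma(1-s)}\frac{d}{dx}\int_x^b\frac{u(\xi)\,d\xi}{(\xi-x)^{s}}$ (weak derivatives). The fractional substantial derivative of order $1-\gamma$ is $${}^SD_t^{1-\gamma}G(t)=\Big(\frac{d}{dt}+pU\Big)\Big[\frac{e^{-pUt}}{\Gamma(\gamma)}\int_0^t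 (t-s)^{\gamma-1}e^{pUs}G(s)\,ds\Big].$$ \textbf{(a) Space semi-discrete scheme.} Let $d\ge2$, $J\ge 0$, and let $S_J\subset H_0^{\alpha/2}(\Omega)$ be the span of the B-splines of order $d$ $$\phi_{J,k}(x)=2^{J/2}(t_{k+d+1}-t_{k+1})\,[t_{k+1},\dots,t_{k+d+1}]_t\,(t-x)_+^{d-1},\qquad 1\le k\le 2^J+d-3,$$ transported from $(0,1)$ to $\Omega$ by the affine map, where $[\dots]_t$ is the divided difference in $t$ and the knots $t_1\le t_2\le\cdots$ are $0$ ($d$ times), $2^{-J},2\cdot2^{-J},\dots,1-2^{-J}$, $1$ ($d$ times). Let $T>0$, $f\in L^1(0,T;L^2(\Omega))$, and let $G_J:[0,T]\to S_J$ be absolutely continuous with, for almost every $t\in(0,T)$, $$\Big(\frac{dG_J}{dt}+pU\,G_J,\,v\Big)+K\,B\big({}^SD_t^{1-\gamma}G_J,\,v\big)=(f,v)\qquad\forall v\in S_J .$$ Then for all $t\in[0,T]$ $$\|G_J(t)\|\le\|G_J(0)\|+2\int_0^t\|f(s)\|\,ds .$$ \textbf{(b) Time semi-discrete schemes.} Let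 $\tau>0$, $t_n=n\tau$, $N\in\mathbb N$, $f^1,\dots,f^N\in L^2(\Omega)$, and let $G^0=g,G^1,\dots,G^N\in H_0^{\alpha/2}(\Omega)$ satisfy, for $1\le n\le N$, $$(\mathcal L_1G^n,v)+K\,B(\mathcal L_2G^n,v)=(f^n,v)\qquad\forall v\in H_0^{\alpha/2}(\Omega).$$ \emph{FBDF.} If $$\mathcal L_1G^n=\frac{G^n-e^{-pU\tau}G^{n-1}}{\tau},\qquad \mathcal L_2G^n=e^{-pUn\tau}\sum_{j=0}^n w_{n-j}\big(e^{pUj\tau}G^j-G^0\big)+\frac{e^{-pUn\tau}G^0}{t_n^{1-\gamma}\Gamma(\gamma)},$$ with $\sum_{j\ge0}w_j\xi^j=\big(\frac{1-\xi}{\tau}\big)^{1-\gamma}$, then for $1\le n\le N$ $$\|G^n\|\le\|g\|+2K^{1/2}\tau^{\gamma/2}|||g|||+2\tau\sum_{j=1}^n\|f^j\| .$$ \emph{PI.} If $\mathcal L_1G^1=\frac{G^1-e^{-pU\tau}G^0}{\tau}$, $\mathcal L_1G^n=\frac{\frac32G^n-2e^{-pU\tau}G^{n-1}+\frac12e^{-2pU\tau}G^{n-2}}{\tau}$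 for $n\ge2$, and $$\mathcal L_2G^n=\frac1{\Gamma(\gamma)}\sum_{j=0}^n e^{pU(j-n)\tau}k_{n-j}G^j+\frac{e^{-pUn\tau}G^0}{t_n^{1-\gamma}\Gamma(\gamma)},$$ with $k_0=\frac1\tau\int_{t_{n-1}}^{t_n}(t_n-s)^{\gamma-1}ds$, $k_n=-\frac1\tau\int_{t_0}^{t_1}(t_n-s)^{\gamma-1}ds$ and $k_j=\frac1\tau\int_{t_{n-j-1}}^{t_{n-j}}(t_n-s)^{\gamma-1}ds-\frac1\tau\int_{t_{n-j}}^{t_{n-j+1}}(t_n-s)^{\gamma-1}ds$ for $1\le j\le n-1$, then for $1\le n\le N$ $$\|G^n\|\le4\|g\|+\frac{5K^{1/2}\tau^{\gamma/2}}{\sqrt{\Gamma(\gamma+1)}}\,|||g|||+18\,\tau\sum_{j=1}^n\|f^j\| .$$ -/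

import Mathlib

open MeasureTheory Set
open scoped ENNReal ContDiff FourierTransform

noncomputable section

namespace FeynmanKac

/-! ## Function spaces on the interval `(a, b)` -/

/-- The real Hilbert space `L²(a, b)`. -/
abbrev L2 (a b : ℝ) : Type := Lp ℝ 2 (volume.restrict (Ioo a b))

/-- `φ ∈ C₀^∞(a, b)`. -/
structure IsTestFunction (a b : ℝ) (φ : ℝ → ℝ) : Prop where
  smooth : ContDiff ℝ ∞ φ
  compact : HasCompactSupport φ
  supp : tsupport φ ⊆ Ioo a b

/-- Extension by zero to the real line (complex valued, in order to take the Fourier transform). -/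
def zeroExt {a b : ℝ} (u : L2 a b) : ℝ → ℂ := (Ioo a b).indicator fun x => ((u x : ℝ) : ℂ)

/-- The square of the norm of `H^s(ℝ)`, `∫ (1 + |ω|²)^s |û(ω)|² dω` with the frequency
`ω = 2πξ`, up to the constant factor coming from the Fourier convention. -/
def sobolevNormSq (s : ℝ) (u : ℝ → ℂ) : ℝ≥0∞ :=
  ∫⁻ ξ : ℝ, ENNReal.ofReal ((1 + (2 * Real.pi * ξ) ^ 2) ^ s) * ‖𝓕 u ξ‖ₑ ^ 2

theorem integrable_zeroExt {a b : ℝ} (u : L2 a b) : Integrable (zeroExt u) := by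
  have h : Integrable (fun x => u x) (volume.restrict (Ioo a b)) :=
    (Lp.memLp u).integrable (by norm_num)
  exact (integrable_indicator_iff measurableSet_Ioo).2 h.ofReal

theorem zeroExt_congr {a b : ℝ} {u : L2 a b} {f : ℝ → ℝ}
    (h : u =ᵐ[volume.restrict (Ioo a b)] f) :
    zeroExt u =ᵐ[volume] (Ioo a b).indicator fun x => ((f x : ℝ) : ℂ) := by
  rw [Filter.EventuallyEq, ae_restrict_iff' measurableSet_Ioo] at h
  filter_upwards [h] with x hx
  by_cases hm : x ∈ Ioo a b
  · simp [zeroExt, hm, hx hm]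
  · simp [zeroExt, hm]

theorem zeroExt_add {a b : ℝ} (u v : L2 a b) :
    zeroExt (u + v) =ᵐ[volume] zeroExt u + zeroExt v := by
  refine (zeroExt_congr (Lp.coeFn_add u v)).trans (Filter.Eventually.of_forall fun x => ?_)
  by_cases hm : x ∈ Ioo a b <;> simp [zeroExt, hm]

theorem zeroExt_smul {a b : ℝ} (c : ℝ) (u : L2 a b) :
    zeroExt (c • u) =ᵐ[volume] fun x => (c : ℂ) * zeroExt u x := by
  refine (zeroExt_congr (Lp.coeFn_smul c u)).trans (Filter.Eventually.of_forall fun x => ?_)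
  by_cases hm : x ∈ Ioo a b <;> simp [zeroExt, hm]

theorem zeroExt_zero {a b : ℝ} : zeroExt (0 : L2 a b) =ᵐ[volume] 0 := by
  refine (zeroExt_congr (Lp.coeFn_zero ℝ 2 _)).trans (Filter.Eventually.of_forall fun x => ?_)
  by_cases hm : x ∈ Ioo a b <;> simp [hm]

theorem IsTestFunction.integrable_ofReal {a b : ℝ} {φ : ℝ → ℝ} (h : IsTestFunction a b φ) :
    Integrable (fun x => ((φ x : ℝ) : ℂ)) :=
  (h.smooth.continuous.integrable_of_hasCompactSupport h.compact).ofReal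

theorem sobolevNormSq_congr_ae {s : ℝ} {f g : ℝ → ℂ} (h : f =ᵐ[volume] g) :
    sobolevNormSq s f = sobolevNormSq s g := by
  simp only [sobolevNormSq, Real.fourier_congr_ae h]

theorem sobolevNormSq_add_le {s : ℝ} {f g : ℝ → ℂ} (hf : Integrable f) (hg : Integrable g) :
    sobolevNormSq s (f + g) ≤ 2 * sobolevNormSq s f + 2 * sobolevNormSq s g := by
  have hadd : ∀ ξ, 𝓕 (f + g) ξ = 𝓕 f ξ + 𝓕 g ξ := fun ξ => by
    have h := VectorFourier.fourierIntegral_add (μ := volume) Real.continuous_fourierChar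
      (L := innerₗ ℝ) continuous_inner hf hg
    exact congrFun h ξ
  have hcont : ∀ {h : ℝ → ℂ}, Integrable h → Continuous (𝓕 h) := fun {h} hh =>
    VectorFourier.fourierIntegral_continuous (μ := volume) Real.continuous_fourierChar
      (L := innerₗ ℝ) continuous_inner hh
  have hw : Measurable fun ξ : ℝ => ENNReal.ofReal ((1 + (2 * Real.pi * ξ) ^ 2) ^ s) := by
    fun_prop
  have hmf : Measurable fun ξ : ℝ =>
      ENNReal.ofReal ((1 + (2 * Real.pi * ξ) ^ 2) ^ s) * ‖𝓕 f ξ‖ₑ ^ 2 :=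
    hw.mul ((hcont hf).measurable.enorm.pow_const 2)
  have hmg : Measurable fun ξ : ℝ =>
      ENNReal.ofReal ((1 + (2 * Real.pi * ξ) ^ 2) ^ s) * ‖𝓕 g ξ‖ₑ ^ 2 :=
    hw.mul ((hcont hg).measurable.enorm.pow_const 2)
  unfold sobolevNormSq
  rw [← lintegral_const_mul _ hmf, ← lintegral_const_mul _ hmg,
    ← lintegral_add_left (hmf.const_mul 2)]
  refine lintegral_mono fun ξ => ?_
  have key : ‖𝓕 (f + g) ξ‖ₑ ^ 2 ≤ 2 * ‖𝓕 f ξ‖ₑ ^ 2 + 2 * ‖𝓕 g ξ‖ₑ ^ 2 := by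
    have h1 : ‖𝓕 (f + g) ξ‖ ^ 2 ≤ 2 * ‖𝓕 f ξ‖ ^ 2 + 2 * ‖𝓕 g ξ‖ ^ 2 := by
      rw [hadd]
      have := norm_add_le (𝓕 f ξ) (𝓕 g ξ)
      nlinarith [norm_nonneg (𝓕 f ξ + 𝓕 g ξ), sq_nonneg (‖𝓕 f ξ‖ - ‖𝓕 g ξ‖)]
    have h2 := ENNReal.ofReal_le_ofReal h1
    rw [ENNReal.ofReal_add (by positivity) (by positivity), ENNReal.ofReal_mul (by norm_num),
      ENNReal.ofReal_mul (by norm_num)] at h2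
    simpa [ENNReal.ofReal_pow] using h2
  calc _ ≤ ENNReal.ofReal ((1 + (2 * Real.pi * ξ) ^ 2) ^ s)
        * (2 * ‖𝓕 f ξ‖ₑ ^ 2 + 2 * ‖𝓕 g ξ‖ₑ ^ 2) := by gcongr
    _ = _ := by ring

theorem sobolevNormSq_mul {s : ℝ} (c : ℝ) (f : ℝ → ℂ) :
    sobolevNormSq s (fun x => (c : ℂ) * f x) = ‖c‖ₑ ^ 2 * sobolevNormSq s f := by
  have hmul : ∀ ξ, 𝓕 (fun x => (c : ℂ) * f x) ξ = (c : ℂ) * 𝓕 f ξ := fun ξ => by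
    simp only [Real.fourier_eq, ← integral_const_mul]
    congr 1
    ext x
    simp only [Circle.smul_def, smul_eq_mul]
    ring
  unfold sobolevNormSq
  rw [← lintegral_const_mul' _ _ (by finiteness)]
  refine lintegral_congr fun ξ => ?_
  rw [hmul, enorm_mul, mul_pow]
  have : ‖(c : ℂ)‖ₑ = ‖c‖ₑ := by simp [← ofReal_norm]
  rw [this]
  ring

theorem sobolevNormSq_zero {s : ℝ} : sobolevNormSq s 0 = 0 := by
  simpa [Pi.zero_def] using sobolevNormSq_mul (s := s) 0 0

/-- `H₀^s(a, b)`: the closure of `C₀^∞(a, b)` with respect to the norm of `H^s`. -/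
def sobolevZero (a b s : ℝ) : Submodule ℝ (L2 a b) where
  carrier := {u | ∀ ε : ℝ≥0∞, 0 < ε → ∃ φ : ℝ → ℝ, IsTestFunction a b φ ∧
    sobolevNormSq s (fun x => zeroExt u x - ((φ x : ℝ) : ℂ)) < ε}
  zero_mem' := by
    intro ε hε
    refine ⟨fun _ => 0, ⟨contDiff_const, HasCompactSupport.zero, by simp [tsupport]⟩, ?_⟩
    have h : (fun x => zeroExt (0 : L2 a b) x - (((fun _ => 0 : ℝ → ℝ) x : ℝ) : ℂ)) =ᵐ[volume] 0 := by
      filter_upwards [zeroExt_zero (a := a) (b := b)] with x hx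
      simp [hx]
    rw [sobolevNormSq_congr_ae h, sobolevNormSq_zero]
    exact hε
  add_mem' := by
    intro u v hu hv ε hε
    have hε' : 0 < ε / 4 := ENNReal.div_pos hε.ne' (by norm_num)
    obtain ⟨φ, hφ, hφu⟩ := hu (ε / 4) hε'
    obtain ⟨ψ, hψ, hψv⟩ := hv (ε / 4) hε'
    refine ⟨fun x => φ x + ψ x, ⟨hφ.smooth.add hψ.smooth, hφ.compact.add hψ.compact,
      (tsupport_add φ ψ).trans (union_subset hφ.supp hψ.supp)⟩, ?_⟩
    have h : (fun x => zeroExt (u + v) x - (((φ x + ψ x : ℝ)) : ℂ)) =ᵐ[volume]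
        (fun x => zeroExt u x - ((φ x : ℝ) : ℂ)) + fun x => zeroExt v x - ((ψ x : ℝ) : ℂ) := by
      filter_upwards [zeroExt_add u v] with x hx
      simp only [hx, Pi.add_apply]
      push_cast
      ring
    rw [sobolevNormSq_congr_ae h]
    refine (sobolevNormSq_add_le ((integrable_zeroExt u).sub hφ.integrable_ofReal)
      ((integrable_zeroExt v).sub hψ.integrable_ofReal)).trans_lt ?_
    have hfin : 2 * sobolevNormSq s (fun x => zeroExt v x - ((ψ x : ℝ) : ℂ)) ≤ 2 * (ε / 4) := by
      gcongr
    have h2 : 2 * sobolevNormSq s (fun x => zeroExt u x - ((φ x : ℝ) : ℂ)) < 2 * (ε / 4) :=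
      ENNReal.mul_lt_mul_right (by norm_num) (by norm_num) hφu
    have h3 : 2 * (ε / 4) + 2 * (ε / 4) = ε := by
      rw [← two_mul, ← mul_assoc]
      norm_num
      exact ENNReal.mul_div_cancel (by norm_num) (by norm_num)
    refine (ENNReal.add_lt_add_of_lt_of_le ?_ h2 hfin).trans_eq h3
    exact ((ENNReal.mul_lt_mul_right (by norm_num) (by norm_num) hψv).trans_le le_top).ne
  smul_mem' := by
    intro c u hu ε hε
    have hδ : 0 < ε / (‖c‖ₑ ^ 2 + 1) := ENNReal.div_pos hε.ne' (by finiteness)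
    obtain ⟨φ, hφ, hφu⟩ := hu _ hδ
    refine ⟨fun x => c * φ x, ⟨contDiff_const.mul hφ.smooth, hφ.compact.mul_left,
      (closure_mono fun x hx => ?_).trans hφ.supp⟩, ?_⟩
    · simp only [Function.mem_support] at hx ⊢
      exact right_ne_zero_of_mul hx
    have h : (fun x => zeroExt (c • u) x - ((c * φ x : ℝ) : ℂ)) =ᵐ[volume]
        fun x => (c : ℂ) * (zeroExt u x - ((φ x : ℝ) : ℂ)) := by
      filter_upwards [zeroExt_smul c u] with x hx
      simp only [hx]
      push_cast
      ring
    rw [sobolevNormSq_congr_ae h, sobolevNormSq_mul]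
    have h1 : (‖c‖ₑ ^ 2 + 1) * sobolevNormSq s (fun x => zeroExt u x - ((φ x : ℝ) : ℂ)) < ε := by
      rw [mul_comm]
      exact ENNReal.mul_lt_of_lt_div hφu
    exact lt_of_le_of_lt (by gcongr; exact le_self_add) h1

/-! ## Riemann-Liouville derivatives and the bilinear form -/

/-- Left Riemann-Liouville integral `(1/Γ(σ)) ∫_a^x (x - ξ)^(σ-1) u(ξ) dξ`. -/
def leftIntegral {a b : ℝ} (σ : ℝ) (u : L2 a b) (x : ℝ) : ℝ :=
  (Real.Gamma σ)⁻¹ * ∫ ξ in a..x, (x - ξ) ^ (σ - 1) * u ξ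

/-- Right Riemann-Liouville integral `(1/Γ(σ)) ∫_x^b (ξ - x)^(σ-1) u(ξ) dξ`. -/
def rightIntegral {a b : ℝ} (σ : ℝ) (u : L2 a b) (x : ℝ) : ℝ :=
  (Real.Gamma σ)⁻¹ * ∫ ξ in x..b, (ξ - x) ^ (σ - 1) * u ξ

/-- `w ∈ L²(a, b)` is the weak derivative of `F` on `(a, b)`. -/
def IsWeakDeriv {a b : ℝ} (F : ℝ → ℝ) (w : L2 a b) : Prop :=
  ∀ φ : ℝ → ℝ, IsTestFunction a b φ →
    ∫ x in Ioo a b, F x * deriv φ x = -∫ x in Ioo a b, w x * φ x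

open Classical in
/-- The weak derivative in `L²(a, b)` (unique if it exists), and `0` if there is none. -/
def weakDeriv (a b : ℝ) (F : ℝ → ℝ) : L2 a b :=
  if h : ∃ w : L2 a b, IsWeakDeriv F w then h.choose else 0

/-- Left Riemann-Liouville derivative of order `s ∈ (0, 1)`. -/
def leftRL {a b : ℝ} (s : ℝ) (u : L2 a b) : L2 a b :=
  weakDeriv a b (leftIntegral (1 - s) u)

/-- Right Riemann-Liouville derivative of order `s ∈ (0, 1)`. -/
def rightRL {a b : ℝ} (s : ℝ) (u : L2 a b) : L2 a b :=
  -weakDeriv a b (rightIntegral (1 - s) u)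

/-- The bilinear form `B(u, v)` on `H₀^{α/2}(a, b)` belonging to the Riesz derivative. -/
def rieszForm {a b : ℝ} (α : ℝ) (u v : L2 a b) : ℝ :=
  (inner ℝ (leftRL (α / 2) u) (rightRL (α / 2) v)
    + inner ℝ (rightRL (α / 2) u) (leftRL (α / 2) v)) / (2 * Real.cos (α * Real.pi / 2))

/-- The energy norm `|||u||| = B(u, u)^{1/2}`. -/
def energyNorm {a b : ℝ} (α : ℝ) (u : L2 a b) : ℝ := √(rieszForm α u u)

/-! ## The spline space -/

/-- The Schoenberg knots `t_1 ≤ t_2 ≤ ...` of order `d` and level `J`: `d` times `0`, then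
`2^{-J}, ..., 1 - 2^{-J}`, then `d` times `1`. -/
def knot (d J i : ℕ) : ℝ := max 0 (min 1 (((i : ℝ) - d) / 2 ^ J))

/-- The divided difference `[t_i, ..., t_{i+m}] f` at nondecreasing, possibly repeated knots. -/
def dividedDiff (t : ℕ → ℝ) (f : ℝ → ℝ) : ℕ → ℕ → ℝ
  | 0, i => f (t i)
  | m + 1, i =>
    if t i = t (i + m + 1) then iteratedDeriv (m + 1) f (t i) / (m + 1).factorial
    else (dividedDiff t f m (i + 1) - dividedDiff t f m i) / (t (i + m + 1) - t i)

/-- The scaling function `φ_{J,k}` on `[0, 1]`. -/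
def scalingFunction (d J k : ℕ) (x : ℝ) : ℝ :=
  (2 : ℝ) ^ ((J : ℝ) / 2) * (knot d J (k + d + 1) - knot d J (k + 1))
    * dividedDiff (knot d J) (fun t => (max 0 (t - x)) ^ (d - 1)) d (k + 1)

/-- The span of the scaling functions `φ_{J,k}`, `1 ≤ k ≤ 2^J + d - 3`, transported to `(a, b)`
by the affine map. -/
def splineSpan (a b : ℝ) (d J : ℕ) : Submodule ℝ (L2 a b) :=
  Submodule.span ℝ {u | ∃ k ∈ Finset.Icc 1 (2 ^ J + d - 3),
    u =ᵐ[volume.restrict (Ioo a b)] fun x => scalingFunction d J k ((x - a) / (b - a))}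

/-- The Galerkin space `S_J ⊆ H₀^{α/2}(a, b)` of splines of order `d` and level `J`. (For `d ≥ 2`
the splines in the span are Lipschitz and vanish at `a` and `b`, so that intersecting with
`H₀^{α/2}(a, b)` removes nothing.) -/
def galerkinSpace (a b α : ℝ) (d J : ℕ) : Submodule ℝ (L2 a b) :=
  splineSpan a b d J ⊓ sobolevZero a b (α / 2)

/-! ## The space semi-discrete scheme -/

/-- `e^{-ρt} ₀D_t^{-σ}(e^{ρ·} G)(t)`, with the Riemann-Liouville integral of order `σ` in time. -/
def temperedIntegral {a b : ℝ} (ρ σ : ℝ) (G : ℝ → L2 a b) (t : ℝ) : L2 a b :=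
  Real.exp (-(ρ * t)) • (Real.Gamma σ)⁻¹ •
    ∫ s in (0 : ℝ)..t, (t - s) ^ (σ - 1) • Real.exp (ρ * s) • G s

/-- The fractional substantial derivative of order `β ∈ (0, 1)`, with `ρ = pU`:
`(d/dt + ρ) [e^{-ρt} ₀D_t^{-(1-β)}(e^{ρt} G(t))]`. -/
def substantialDeriv {a b : ℝ} (ρ β : ℝ) (G : ℝ → L2 a b) (t : ℝ) : L2 a b :=
  deriv (temperedIntegral ρ (1 - β) G) t + ρ • temperedIntegral ρ (1 - β) G t

/-- `G : [0, T] → S` solves the space semi-discrete scheme with force term `f`: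
`((d/dt + ρ) G, v) + K B(ˢD_t^{1-γ} G, v) = (f, v)` for all `v ∈ S`. -/
structure IsSpaceSemidiscrete {a b : ℝ} (ρ γ α K T : ℝ) (S : Submodule ℝ (L2 a b))
    (f G : ℝ → L2 a b) : Prop where
  mem : ∀ t ∈ Icc 0 T, G t ∈ S
  absCont : AbsolutelyContinuousOnInterval G 0 T
  eqn : ∀ᵐ t : ℝ, t ∈ Ioo 0 T →
    DifferentiableAt ℝ G t ∧ DifferentiableAt ℝ (temperedIntegral ρ γ G) t ∧
    ∀ v ∈ S, inner ℝ (deriv G t + ρ • G t) v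
      + K * rieszForm α (substantialDeriv ρ (1 - γ) G t) v = inner ℝ (f t) v

/-! ## The time semi-discrete schemes (uniform step `τ`, `t_n = nτ`) -/

/-- The FBDF weights `w_j^β`: the coefficients of `((1 - ξ)/τ)^β = ∑ w_j^β ξ^j`. -/
def fbdfWeight (τ β : ℝ) (j : ℕ) : ℝ := τ ^ (-β) * ((-1) ^ j * Ring.choose β j)

/-- The FBDF discretization of `(d/dt + ρ)` at `t_n`. -/
def fbdfL1 {a b : ℝ} (ρ τ : ℝ) (G : ℕ → L2 a b) (n : ℕ) : L2 a b :=
  τ⁻¹ • (G n - Real.exp (-(ρ * τ)) • G (n - 1))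

/-- The FBDF discretization of the substantial derivative of order `1 - γ` at `t_n`. -/
def fbdfL2 {a b : ℝ} (ρ γ τ : ℝ) (G : ℕ → L2 a b) (n : ℕ) : L2 a b :=
  Real.exp (-(ρ * n * τ)) • ∑ j ∈ Finset.range (n + 1),
      fbdfWeight τ (1 - γ) (n - j) • (Real.exp (ρ * j * τ) • G j - G 0)
    + (Real.exp (-(ρ * n * τ)) / ((n * τ) ^ (1 - γ) * Real.Gamma γ)) • G 0

/-- The PI weights `k_j^β`, `0 ≤ j ≤ n`, at `t_n`. -/
def piWeight (τ β : ℝ) (n j : ℕ) : ℝ :=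
  if j = 0 then
    ∫ s in ((n : ℝ) - 1) * τ..n * τ, (n * τ - s) ^ (-β) * τ⁻¹
  else if j = n then
    -∫ s in (0 : ℝ)..τ, (n * τ - s) ^ (-β) * τ⁻¹
  else
    (∫ s in ((n : ℝ) - j - 1) * τ..((n : ℝ) - j) * τ, (n * τ - s) ^ (-β) * τ⁻¹)
      - ∫ s in ((n : ℝ) - j) * τ..((n : ℝ) - j + 1) * τ, (n * τ - s) ^ (-β) * τ⁻¹

/-- The PI discretization of `(d/dt + ρ)` at `t_n`. -/
def piL1 {a b : ℝ} (ρ τ : ℝ) (G : ℕ → L2 a b) (n : ℕ) : L2 a b :=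
  if n = 1 then τ⁻¹ • (G n - Real.exp (-(ρ * τ)) • G (n - 1))
  else τ⁻¹ • ((3 / 2 : ℝ) • G n - (2 * Real.exp (-(ρ * τ))) • G (n - 1)
    + (1 / 2 * Real.exp (-(2 * ρ * τ))) • G (n - 2))

/-- The PI discretization of the substantial derivative of order `1 - γ` at `t_n`. -/
def piL2 {a b : ℝ} (ρ γ τ : ℝ) (G : ℕ → L2 a b) (n : ℕ) : L2 a b :=
  (Real.Gamma γ)⁻¹ • ∑ j ∈ Finset.range (n + 1),
      (Real.exp (ρ * ((j : ℝ) - n) * τ) * piWeight τ (1 - γ) n (n - j)) • G j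
    + (Real.exp (-(ρ * n * τ)) / ((n * τ) ^ (1 - γ) * Real.Gamma γ)) • G 0

/-- `G⁰ = g, G¹, ..., G^N ∈ H₀^{α/2}(a, b)` solves the time semi-discrete scheme
`(𝓛₁Gⁿ, v) + K B(𝓛₂Gⁿ, v) = (fⁿ, v)` for all `v ∈ H₀^{α/2}(a, b)`, `1 ≤ n ≤ N`. -/
structure IsTimeSemidiscrete {a b : ℝ} (L1 L2' : (ℕ → L2 a b) → ℕ → L2 a b) (α K : ℝ) (N : ℕ)
    (g : L2 a b) (f G : ℕ → L2 a b) : Prop where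
  mem : ∀ n ≤ N, G n ∈ sobolevZero a b (α / 2)
  init : G 0 = g
  eqn : ∀ n, 1 ≤ n → n ≤ N → ∀ v ∈ sobolevZero a b (α / 2),
    inner ℝ (L1 G n) v + K * rieszForm α (L2' G n) v = inner ℝ (f n) v

end FeynmanKac

end

open FeynmanKac

/-! ### Discrete energy estimates for an abstract nonnegative symmetric form. -/

section Discrete

variable {X : Type*} [NormedAddCommGroup X] [InnerProductSpace ℝ X]

/-! Substituting `H = e^{ρt} G` (in discrete time `H n = e^{ρnτ} G n`) removes `ρ = pU`: the
substantial derivative turns into a Riemann-Liouville derivative `d/dt I^γ H`, and its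
discretizations turn into plain convolutions. Each scheme is then tested with its own solution. Two
facts have to be supplied: the form `B` is symmetric and nonnegative on `H₀^{α/2}`, and the memory
term has a sign up to a contribution of the initial value.

Form. Put `s = α/2`, so `1/2 < s < 1`. On a test function `φ` the one-sided derivatives are, up to a
factor and a sign, convolutions of `φ'` with `z_+^{-s}` and `(-z)_+^{-s}`. By homogeneity the
integral of their product is a nonnegative multiple of the form of `φ'` with kernel `|x - y|^{1-2s}`
(`integral_kernel_mul_kernel`), and this kernel is a superposition of Gaussians, hence positive
definite (`powForm_nonneg`). The minus sign of the right derivative cancels against `cos(απ/2) < 0`.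
The same computation with two equal kernels bounds the `L²` norms of the derivatives by the norm of
`H^s`, so everything passes to the closure `H₀^s` (`exists_isWeakDeriv_of_mem_sobolevZero`,
`exists_bilinear_eq_rieszForm`).

Memory term, discrete time. The weights satisfy `p k ≤ 0` for `k ≥ 1` and have nonnegative partial
sums, and the weight of the initial value lies between `p n` and `0`. Then the sum of
`B(convolution, H n)` is at least `-p 0 B(H 0, H 0)/2` (`neg_le_sum_form_conv`). With the
telescoping inequality for backward Euler or the G-stability identity for BDF2, this bounds `‖H
m‖²`. For FBDF the condition on the initial weight is a Gautschi inequality for the Gamma function;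
for PI it says that the mean of a decreasing function over a cell lies between its end values.

Memory term, continuous time. Pointwise `d/dt I^γ B(H, H) ≤ 2 B(d/dt I^γ H, H)`
(`deriv_fractionalIntegral_form_le`), so `‖H‖² + κ I^γ B(H, H)` has derivative at most `2 F ‖H‖`,
and its second term is nonnegative and vanishes at `0`.

In all cases, evaluating the quadratic inequality where `‖H‖` is largest makes it linear, and `ρ ≥
0` allows the exponential factor to be divided out. -/

theorem two_mul_form_le {B : X →ₗ[ℝ] X →ₗ[ℝ] ℝ} (hs : ∀ u v, B u v = B v u)
    (hp : ∀ u, 0 ≤ B u u) (u v : X) : 2 * B u v ≤ B u u + B v v := by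
  have h := hp (u - v)
  simp only [map_sub, LinearMap.sub_apply, hs v u] at h
  linarith

/-- Lower bound for a discrete convolution form with nonpositive off-diagonal weights and
nonnegative partial sums. -/
theorem neg_le_sum_form_conv {B : X →ₗ[ℝ] X →ₗ[ℝ] ℝ} (hs : ∀ u v, B u v = B v u)
    (hp : ∀ u, 0 ≤ B u u) {p : ℕ → ℝ} (hneg : ∀ k, p (k + 1) ≤ 0)
    (hsum : ∀ n, 0 ≤ ∑ k ∈ Finset.range (n + 1), p k) {c : ℕ → ℕ → ℝ}
    (hc : ∀ n j, 1 ≤ j → j ≤ n → c n j = p (n - j))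
    (hc0 : ∀ n, 1 ≤ n → p n ≤ c n 0 ∧ c n 0 ≤ 0) (H : ℕ → X) (m : ℕ) :
    -(1 / 2 * p 0 * B (H 0) (H 0)) ≤
      ∑ n ∈ Finset.range m, B (∑ j ∈ Finset.range (n + 1 + 1), c (n + 1) j • H j) (H (n + 1)) := by
  set q : ℕ → ℝ := fun n => B (H n) (H n) with hq
  have hq0 : ∀ n, 0 ≤ q n := fun n => hp _
  -- Nonpositive weights reverse `2 B(u, v) ≤ B(u, u) + B(v, v)` into a lower bound.
  have key : ∀ c' x y, c' ≤ 0 → c' / 2 * (q x + q y) ≤ c' * B (H x) (H y) := by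
    intro c' x y hc'
    have := two_mul_form_le hs hp (H x) (H y)
    simp only [hq]
    nlinarith
  -- Half of the diagonal term `p 0 * q (n + 1)` and the halves of the off-diagonal weights falling
  -- on `q (n + 1)` combine to a partial sum of `p`, which is nonnegative and dropped. What remains
  -- is half of the scalar convolution of `p` with `q`.
  have term : ∀ n, 1 / 2 * ∑ j ∈ Finset.range (n + 1 + 1), p (n + 1 - j) * q j ≤
      B (∑ j ∈ Finset.range (n + 1 + 1), c (n + 1) j • H j) (H (n + 1)) := by
    intro n
    have hB : B (∑ j ∈ Finset.range (n + 1 + 1), c (n + 1) j • H j) (H (n + 1)) =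
        ∑ j ∈ Finset.range (n + 1), c (n + 1) j * B (H j) (H (n + 1)) + p 0 * q (n + 1) := by
      simp only [map_sum, LinearMap.sum_apply, map_smul, LinearMap.smul_apply, smul_eq_mul]
      rw [Finset.sum_range_succ, hc (n + 1) (n + 1) (by omega) le_rfl, Nat.sub_self]
    have h1 : ∑ j ∈ Finset.range (n + 1), p (n + 1 - j) / 2 * (q j + q (n + 1)) ≤
        ∑ j ∈ Finset.range (n + 1), c (n + 1) j * B (H j) (H (n + 1)) := by
      refine Finset.sum_le_sum fun j hj => ?_
      have hj' : j < n + 1 := Finset.mem_range.1 hj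
      have hpn : p (n + 1 - j) ≤ 0 := by
        have := hneg (n - j)
        rwa [show n - j + 1 = n + 1 - j by omega] at this
      rcases Nat.eq_zero_or_pos j with rfl | hj0
      · have h0 := hc0 (n + 1) (by omega)
        refine le_trans ?_ (key _ 0 (n + 1) h0.2)
        have : p (n + 1 - 0) ≤ c (n + 1) 0 := h0.1
        have := add_nonneg (hq0 0) (hq0 (n + 1))
        gcongr
      · rw [hc (n + 1) j hj0 hj'.le]
        exact key _ j (n + 1) hpn
    have h2 : ∑ j ∈ Finset.range (n + 1), p (n + 1 - j) + p 0 =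
        ∑ k ∈ Finset.range (n + 1 + 1), p k := by
      rw [← Finset.sum_range_reflect p (n + 1 + 1), Finset.sum_range_succ _ (n + 1)]
      congr 1
      simp
    have h3 := mul_nonneg (hsum (n + 1)) (hq0 (n + 1))
    rw [hB]
    refine le_trans ?_ (add_le_add_left h1 _)
    rw [Finset.sum_range_succ, Nat.sub_self]
    have h4 : ∑ j ∈ Finset.range (n + 1), p (n + 1 - j) / 2 * (q j + q (n + 1)) =
        1 / 2 * ∑ j ∈ Finset.range (n + 1), p (n + 1 - j) * q j +
        1 / 2 * (∑ j ∈ Finset.range (n + 1), p (n + 1 - j)) * q (n + 1) := by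
      rw [Finset.mul_sum, Finset.mul_sum, Finset.sum_mul, ← Finset.sum_add_distrib]
      exact Finset.sum_congr rfl fun j _ => by ring
    rw [h4]
    rw [← h2] at h3
    linarith
  refine le_trans ?_ (Finset.sum_le_sum fun n _ => term n)
  rw [← Finset.mul_sum]
  -- Summed over `n`, each `q j` is multiplied by a partial sum of `p`. The full double sum contains
  -- the term `n = 0`, namely `p 0 * q 0`, which the energy sum lacks; this is the loss on the
  -- left-hand side.
  have hflip : ∑ n ∈ Finset.range (m + 1), ∑ j ∈ Finset.range (n + 1), p (n - j) * q j =
      ∑ j ∈ Finset.range (m + 1), ∑ k ∈ Finset.range (m + 1 - j), p k * q j :=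
    Finset.sum_range_diag_flip (m + 1) fun j k => p k * q j
  rw [Finset.sum_range_succ'] at hflip
  have h0 : 0 ≤ ∑ j ∈ Finset.range (m + 1), ∑ k ∈ Finset.range (m + 1 - j), p k * q j := by
    refine Finset.sum_nonneg fun j hj => ?_
    rw [← Finset.sum_mul]
    have := hsum (m - j)
    rw [show m - j + 1 = m + 1 - j by have := Finset.mem_range.1 hj; omega] at this
    exact mul_nonneg this (hq0 j)
  rw [← hflip] at h0
  simp only [zero_add, Finset.range_one, Finset.sum_singleton, Nat.sub_self] at h0
  change -(1 / 2 * p 0 * q 0) ≤ _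
  linarith

/-- A maximum argument: a quadratic inequality bounds all members of a finite sequence. -/
theorem le_of_sq_le_add_sum_mul {h F : ℕ → ℝ} {A θ : ℝ} {N : ℕ} (hA : 0 ≤ A) (hθ : 0 ≤ θ)
    (hF : ∀ n, 0 ≤ F n) (hh : ∀ n, 0 ≤ h n) (h0 : h 0 ≤ A)
    (hsq : ∀ m, 1 ≤ m → m ≤ N →
      h m ^ 2 ≤ A ^ 2 + θ * ∑ n ∈ Finset.range m, F (n + 1) * h (n + 1)) :
    ∀ n, n ≤ N → h n ≤ A + θ * ∑ n ∈ Finset.range n, F (n + 1) := by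
  intro n hn
  obtain ⟨m, hm, hmax⟩ := Finset.exists_max_image (Finset.range (n + 1)) h ⟨0, by simp⟩
  have hm' : m ≤ n := by have := Finset.mem_range.1 hm; omega
  have hS : 0 ≤ θ * ∑ n ∈ Finset.range n, F (n + 1) :=
    mul_nonneg hθ (Finset.sum_nonneg fun i _ => hF _)
  have hle : h n ≤ h m := hmax n (by simp)
  rcases Nat.eq_zero_or_pos m with rfl | hm0
  · linarith
  · have h1 := hsq m hm0 (hm'.trans hn)
    have h2 : ∑ i ∈ Finset.range m, F (i + 1) * h (i + 1) ≤
        (∑ i ∈ Finset.range n, F (i + 1)) * h m := by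
      rw [Finset.sum_mul]
      refine (Finset.sum_le_sum fun i hi => ?_).trans
        (Finset.sum_le_sum_of_subset_of_nonneg (Finset.range_mono hm')
          fun i _ _ => mul_nonneg (hF _) (hh m))
      exact mul_le_mul_of_nonneg_left
        (hmax (i + 1) (by have := Finset.mem_range.1 hi; simp; omega)) (hF _)
    have h3 : h m ^ 2 ≤ A ^ 2 + (θ * ∑ i ∈ Finset.range n, F (i + 1)) * h m := by
      have := mul_le_mul_of_nonneg_left h2 hθ
      linarith
    refine hle.trans ?_
    -- If `h m > A + S`, with `S` the forcing term, then `h m * (h m - S) > A ^ 2`, against `h3`.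
    by_contra! hlt
    nlinarith [hh m]

theorem inner_sub_self_ge (u v : X) :
    1 / 2 * (‖u‖ ^ 2 - ‖v‖ ^ 2) ≤ inner ℝ (u - v) u := by
  have h := sq_nonneg ‖u - v‖
  rw [norm_sub_sq_real] at h
  rw [inner_sub_left, real_inner_self_eq_norm_sq, real_inner_comm]
  linarith

theorem bdf_one_stability {B : X →ₗ[ℝ] X →ₗ[ℝ] ℝ} (hs : ∀ u v, B u v = B v u)
    (hp : ∀ u, 0 ≤ B u u) {p : ℕ → ℝ} (hneg : ∀ k, p (k + 1) ≤ 0)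
    (hsum : ∀ n, 0 ≤ ∑ k ∈ Finset.range (n + 1), p k) {c : ℕ → ℕ → ℝ}
    (hc : ∀ n j, 1 ≤ j → j ≤ n → c n j = p (n - j))
    (hc0 : ∀ n, 1 ≤ n → p n ≤ c n 0 ∧ c n 0 ≤ 0) {H : ℕ → X} {F : ℕ → ℝ} {κ : ℝ} {N : ℕ}
    (hκ : 0 ≤ κ)
    (heq : ∀ n < N, inner ℝ (H (n + 1) - H n) (H (n + 1)) +
      κ * B (∑ j ∈ Finset.range (n + 1 + 1), c (n + 1) j • H j) (H (n + 1)) ≤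
      F (n + 1) * ‖H (n + 1)‖) {m : ℕ} (hm : m ≤ N) :
    ‖H m‖ ^ 2 ≤ ‖H 0‖ ^ 2 + κ * p 0 * B (H 0) (H 0) +
      2 * ∑ n ∈ Finset.range m, F (n + 1) * ‖H (n + 1)‖ := by
  have h1 := Finset.sum_le_sum fun n (hn : n ∈ Finset.range m) =>
    heq n ((Finset.mem_range.1 hn).trans_le hm)
  rw [Finset.sum_add_distrib, ← Finset.mul_sum] at h1
  have h2 := mul_le_mul_of_nonneg_left (neg_le_sum_form_conv hs hp hneg hsum hc hc0 H m) hκ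
  have h3 := Finset.sum_le_sum fun n (_ : n ∈ Finset.range m) =>
    inner_sub_self_ge (H (n + 1)) (H n)
  rw [← Finset.mul_sum, Finset.sum_range_sub fun n => ‖H n‖ ^ 2] at h3
  linarith

/-- G-stability of BDF2: the right side minus the left side is exactly `‖x - 2y + z‖² / 4`. -/
theorem bdf_two_identity (x y z : X) :
    1 / 4 * (‖x‖ ^ 2 + ‖(2 : ℝ) • x - y‖ ^ 2 - (‖y‖ ^ 2 + ‖(2 : ℝ) • y - z‖ ^ 2)) ≤
      inner ℝ ((3 / 2 : ℝ) • x - (2 : ℝ) • y + (1 / 2 : ℝ) • z) x := by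
  have h := sq_nonneg ‖x - (2 : ℝ) • y + z‖
  simp only [← real_inner_self_eq_norm_sq, inner_add_left, inner_add_right, inner_sub_left,
    inner_sub_right, real_inner_smul_left, real_inner_smul_right, real_inner_comm x y,
    real_inner_comm x z, real_inner_comm y z] at h ⊢
  linarith

theorem bdf_two_stability {B : X →ₗ[ℝ] X →ₗ[ℝ] ℝ} (hs : ∀ u v, B u v = B v u)
    (hp : ∀ u, 0 ≤ B u u) {p : ℕ → ℝ} (hp0 : 0 ≤ p 0) (hneg : ∀ k, p (k + 1) ≤ 0)
    (hsum : ∀ n, 0 ≤ ∑ k ∈ Finset.range (n + 1), p k) {c : ℕ → ℕ → ℝ}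
    (hc : ∀ n j, 1 ≤ j → j ≤ n → c n j = p (n - j))
    (hc0 : ∀ n, 1 ≤ n → p n ≤ c n 0 ∧ c n 0 ≤ 0) {H : ℕ → X} {F : ℕ → ℝ} {κ : ℝ} {N : ℕ}
    (hκ : 0 ≤ κ) (hF : ∀ n, 0 ≤ F n)
    (heq : ∀ n < N, inner ℝ (if n = 0 then H (n + 1) - H n else
        (3 / 2 : ℝ) • H (n + 1) - (2 : ℝ) • H n + (1 / 2 : ℝ) • H (n - 1)) (H (n + 1)) +
      κ * B (∑ j ∈ Finset.range (n + 1 + 1), c (n + 1) j • H j) (H (n + 1)) ≤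
      F (n + 1) * ‖H (n + 1)‖) {m : ℕ} (hm : m ≤ N) :
    ‖H m‖ ^ 2 ≤ 2 * ‖H 0‖ ^ 2 + 3 * (κ * p 0 * B (H 0) (H 0)) +
      6 * ∑ n ∈ Finset.range m, F (n + 1) * ‖H (n + 1)‖ := by
  have hg : 0 ≤ κ * p 0 * B (H 0) (H 0) := mul_nonneg (mul_nonneg hκ hp0) (hp _)
  have hFn : ∀ m, 0 ≤ ∑ n ∈ Finset.range m, F (n + 1) * ‖H (n + 1)‖ := fun m =>
    Finset.sum_nonneg fun n _ => mul_nonneg (hF _) (norm_nonneg _)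
  rcases m with _ | m
  · simp only [Finset.range_zero, Finset.sum_empty]
    nlinarith [sq_nonneg ‖H 0‖]
  have h1 := Finset.sum_le_sum fun n (hn : n ∈ Finset.range (m + 1)) =>
    heq n ((Finset.mem_range.1 hn).trans_le hm)
  rw [Finset.sum_add_distrib, ← Finset.mul_sum, Finset.sum_range_succ'] at h1
  simp only [Nat.add_eq_zero_iff, one_ne_zero, and_false, ↓reduceIte, add_tsub_cancel_right] at h1
  have h2 := mul_le_mul_of_nonneg_left (neg_le_sum_form_conv hs hp hneg hsum hc hc0 H (m + 1)) hκ
  have h3 := Finset.sum_le_sum fun n (_ : n ∈ Finset.range m) =>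
    bdf_two_identity (H (n + 1 + 1)) (H (n + 1)) (H n)
  rw [← Finset.mul_sum, Finset.sum_range_sub
    fun n => ‖H (n + 1)‖ ^ 2 + ‖(2 : ℝ) • H (n + 1) - H n‖ ^ 2] at h3
  -- The first step is backward Euler and is also estimated alone. In the total sum it serves as the
  -- start of the BDF2 telescope: the inner products `⟨H 1, H 0⟩` cancel and leave `‖H (m+1)‖² ≤ ‖H
  -- 1‖² + ‖H 0‖² + 2g + 4Σ`, with `g = κ p₀ B(H 0, H 0)`. Inserting this bound for `‖H 1‖²` gives
  -- the factors 2, 3, 6.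
  have h4 : ‖H 1‖ ^ 2 ≤ ‖H 0‖ ^ 2 + κ * p 0 * B (H 0) (H 0) + 2 * (F 1 * ‖H 1‖) := by
    have := bdf_one_stability hs hp hneg hsum hc hc0 (N := 1) hκ (H := H) (F := F)
      (fun n hn => by
        obtain rfl : n = 0 := by omega
        simpa using heq 0 (by omega)) le_rfl
    simpa using this
  have h5 : F 1 * ‖H 1‖ ≤ ∑ n ∈ Finset.range (m + 1), F (n + 1) * ‖H (n + 1)‖ := by
    rw [Finset.sum_range_succ']
    have := hFn m
    have h6 : ∑ n ∈ Finset.range m, F (n + 1 + 1) * ‖H (n + 1 + 1)‖ ≥ 0 :=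
      Finset.sum_nonneg fun n _ => mul_nonneg (hF _) (norm_nonneg _)
    linarith
  have h7 : inner ℝ (H 1 - H 0) (H 1) = ‖H 1‖ ^ 2 - inner ℝ (H 1) (H 0) := by
    rw [inner_sub_left, real_inner_self_eq_norm_sq, real_inner_comm]
  have h8 : ‖(2 : ℝ) • H 1 - H 0‖ ^ 2 = 4 * ‖H 1‖ ^ 2 - 4 * inner ℝ (H 1) (H 0) + ‖H 0‖ ^ 2 := by
    rw [norm_sub_sq_real, norm_smul, real_inner_smul_left]
    norm_num
    ring
  have h9 := sq_nonneg ‖(2 : ℝ) • H (m + 1) - H m‖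
  simp only [zero_add] at h1 h3
  rw [h7] at h1
  rw [h8] at h3
  linarith

end Discrete

/-! ### Positivity of the kernel `|x - y|^{-β}` and its control by the Sobolev norm. -/

section Gaussian

/-- The quadratic form of a Gaussian kernel on the Fourier side. -/
theorem integral_gaussian_mul_prod {ψ : ℝ → ℝ} (hψ : Integrable ψ) {t : ℝ} (ht : 0 < t) :
    ∫ p : ℝ × ℝ, Real.exp (-(Real.pi * (p.1 - p.2) ^ 2 * t)) * (ψ p.1 * ψ p.2)
        ∂(volume.prod volume) =
      ∫ ξ : ℝ, t ^ (-(1 / 2) : ℝ) * Real.exp (-(Real.pi * ξ ^ 2 / t)) *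
        ‖𝓕 (fun x => (ψ x : ℂ)) ξ‖ ^ 2 := by
  -- This Gaussian has Fourier transform `t^{1/2} exp(-π z² t)`, so the kernel is a Fourier integral
  -- and Fubini turns the double integral into `‖𝓕 ψ‖²`.
  set g : ℝ → ℂ := fun ξ => Complex.exp (-Real.pi * ((t⁻¹ : ℝ) : ℂ) * (ξ : ℂ) ^ 2) with hg
  have htr : 0 < (((t⁻¹ : ℝ) : ℂ)).re := by simpa using ht
  have hgint : Integrable g := by
    have := integrable_cexp_neg_mul_sq (b := Real.pi * ((t⁻¹ : ℝ) : ℂ))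
      (by
        rw [← Complex.ofReal_mul, Complex.ofReal_re]
        positivity)
    simpa [hg, neg_mul] using this
  have hFg : ∀ z : ℝ, 𝓕 g z = ((t ^ (1 / 2 : ℝ) * Real.exp (-(Real.pi * z ^ 2 * t)) : ℝ) : ℂ) := by
    intro z
    rw [hg, fourier_gaussian_pi htr]
    simp only
    have h1 : (((t⁻¹ : ℝ) : ℂ)) ^ (1 / 2 : ℂ) = (((t⁻¹) ^ (1 / 2 : ℝ) : ℝ) : ℂ) := by
      rw [Complex.ofReal_cpow (by positivity)]
      norm_num
    rw [h1, Real.inv_rpow ht.le, Complex.ofReal_inv, one_div, inv_inv, Complex.ofReal_mul,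
      Complex.ofReal_exp]
    congr 2
    push_cast
    field_simp
  have hgn : ∀ ξ : ℝ, g ξ = ((Real.exp (-(Real.pi * ξ ^ 2 / t)) : ℝ) : ℂ) := by
    intro ξ
    simp only [hg]
    push_cast
    congr 1
    field_simp
  have hψc : Integrable (fun x => (ψ x : ℂ)) := hψ.ofReal
  have hint : Integrable (fun q : (ℝ × ℝ) × ℝ =>
      (ψ q.1.1 * ψ q.1.2 : ℂ) * (Real.fourierChar (-(q.2 * (q.1.1 - q.1.2))) * g q.2))
      ((volume.prod volume).prod volume) := by
    have h1 := (hψc.mul_prod hψc).mul_prod hgint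
    have h2 : Integrable (fun q : (ℝ × ℝ) × ℝ =>
        (Real.fourierChar (-(q.2 * (q.1.1 - q.1.2))) : ℂ) *
          ((ψ q.1.1 * ψ q.1.2 : ℂ) * g q.2)) ((volume.prod volume).prod volume) := by
      refine h1.bdd_mul (c := 1) ?_ (Filter.Eventually.of_forall fun p => ?_)
      · refine Continuous.aestronglyMeasurable ?_
        have := Real.continuous_fourierChar
        fun_prop
      · exact (Circle.norm_coe _).le
    refine h2.congr (Filter.Eventually.of_forall fun q => ?_)
    ring
  have hswap := integral_integral_swap (f := fun (p : ℝ × ℝ) (ξ : ℝ) =>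
    (ψ p.1 * ψ p.2 : ℂ) * (Real.fourierChar (-(ξ * (p.1 - p.2))) * g ξ)) hint
  have hL : ∀ p : ℝ × ℝ, ∫ ξ : ℝ, (ψ p.1 * ψ p.2 : ℂ) *
      (Real.fourierChar (-(ξ * (p.1 - p.2))) * g ξ) =
      ((t ^ (1 / 2 : ℝ) * (Real.exp (-(Real.pi * (p.1 - p.2) ^ 2 * t)) * (ψ p.1 * ψ p.2)) : ℝ) : ℂ) := by
    intro p
    rw [integral_const_mul]
    have : ∫ ξ : ℝ, (Real.fourierChar (-(ξ * (p.1 - p.2))) : ℂ) * g ξ = 𝓕 g (p.1 - p.2) := by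
      rw [Real.fourier_eq]
      refine integral_congr_ae (Filter.Eventually.of_forall fun ξ => ?_)
      simp [Circle.smul_def, mul_comm]
    rw [this, hFg]
    push_cast
    ring
  have hR : ∀ ξ : ℝ, ∫ p : ℝ × ℝ, (ψ p.1 * ψ p.2 : ℂ) *
      (Real.fourierChar (-(ξ * (p.1 - p.2))) * g ξ) ∂(volume.prod volume) =
      ((Real.exp (-(Real.pi * ξ ^ 2 / t)) * ‖𝓕 (fun x => (ψ x : ℂ)) ξ‖ ^ 2 : ℝ) : ℂ) := by
    intro ξ
    have h1 : ∀ p : ℝ × ℝ, (ψ p.1 * ψ p.2 : ℂ) * (Real.fourierChar (-(ξ * (p.1 - p.2))) * g ξ) =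
        g ξ * ((Real.fourierChar (-(p.1 * ξ)) * (ψ p.1 : ℂ)) *
          ((starRingEnd ℂ) (Real.fourierChar (-(p.2 * ξ)) * (ψ p.2 : ℂ)))) := by
      intro p
      have h2 : (Real.fourierChar (-(ξ * (p.1 - p.2))) : ℂ) =
          Real.fourierChar (-(p.1 * ξ)) * (starRingEnd ℂ) (Real.fourierChar (-(p.2 * ξ)) : ℂ) := by
        rw [← Circle.coe_inv_eq_conj, ← AddChar.map_neg_eq_inv, ← Circle.coe_mul,
          ← AddChar.map_add_eq_mul]
        congr 2
        ring
      rw [h2, map_mul, Complex.conj_ofReal]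
      ring
    simp_rw [h1]
    rw [integral_const_mul, integral_prod_mul (μ := volume) (ν := volume)
      (fun x : ℝ => (Real.fourierChar (-(x * ξ)) : ℂ) * (ψ x : ℂ))
      (fun y : ℝ => (starRingEnd ℂ) ((Real.fourierChar (-(y * ξ)) : ℂ) * (ψ y : ℂ))),
      integral_conj, hgn]
    have h3 : ∫ x : ℝ, (Real.fourierChar (-(x * ξ)) : ℂ) * (ψ x : ℂ) =
        𝓕 (fun x => (ψ x : ℂ)) ξ := by
      rw [Real.fourier_eq]
      refine integral_congr_ae (Filter.Eventually.of_forall fun x => ?_)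
      simp [Circle.smul_def, mul_comm]
    rw [h3, Complex.mul_conj, Complex.normSq_eq_norm_sq]
    push_cast
    ring
  simp_rw [hL, hR] at hswap
  rw [integral_complex_ofReal, integral_complex_ofReal, integral_const_mul] at hswap
  have hreal := Complex.ofReal_injective hswap
  have hpos : 0 < t ^ (1 / 2 : ℝ) := Real.rpow_pos_of_pos ht _
  simp_rw [mul_assoc (t ^ (-(1 / 2) : ℝ))]
  rw [integral_const_mul, ← hreal, ← mul_assoc, ← Real.rpow_add ht]
  norm_num

/-- The substitution `t ↦ 1/t` produces a Gamma integral. -/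
theorem lintegral_rpow_mul_exp_neg_div {β : ℝ} (hβ1 : β < 1) {ξ : ℝ} (hξ : ξ ≠ 0) :
    ∫⁻ t in Ioi (0 : ℝ), ENNReal.ofReal (t ^ (β / 2 - 3 / 2) * Real.exp (-(Real.pi * ξ ^ 2 / t))) =
      ENNReal.ofReal ((1 / (Real.pi * ξ ^ 2)) ^ ((1 - β) / 2) * Real.Gamma ((1 - β) / 2)) := by
  have hr : 0 < Real.pi * ξ ^ 2 := by have := Real.pi_pos; positivity
  have ha : 0 < (1 - β) / 2 := by linarith
  have h1 : ∫ t in Ioi (0 : ℝ), t ^ (β / 2 - 3 / 2) * Real.exp (-(Real.pi * ξ ^ 2 / t)) =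
      (1 / (Real.pi * ξ ^ 2)) ^ ((1 - β) / 2) * Real.Gamma ((1 - β) / 2) := by
    rw [← Real.integral_rpow_mul_exp_neg_mul_Ioi ha hr, ← integral_comp_rpow_Ioi _
      (show (-1 : ℝ) ≠ 0 by norm_num)]
    refine setIntegral_congr_fun measurableSet_Ioi fun t ht => ?_
    have ht : (0 : ℝ) < t := ht
    simp only [smul_eq_mul]
    rw [← Real.rpow_mul ht.le, abs_neg, abs_one, one_mul, ← mul_assoc, ← Real.rpow_add ht,
      Real.rpow_neg_one]
    congr 1
    · congr 1
      ring
    · rw [div_inv_eq_mul]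
  rw [← h1, ofReal_integral_eq_lintegral_ofReal]
  -- Integrability is read off the value: a nonintegrable function has Bochner integral `0`, but the
  -- value found is positive.
  · by_contra hne
    rw [integral_undef hne] at h1
    have : 0 < (1 / (Real.pi * ξ ^ 2)) ^ ((1 - β) / 2) * Real.Gamma ((1 - β) / 2) :=
      mul_pos (Real.rpow_pos_of_pos (by positivity) _) (Real.Gamma_pos_of_pos ha)
    linarith
  · filter_upwards [ae_restrict_mem measurableSet_Ioi] with t ht
    have ht : (0 : ℝ) < t := ht
    positivity

/-- The quadratic form with kernel `|x - y|^{-β}`. -/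
noncomputable def powForm (β : ℝ) (ψ : ℝ → ℝ) : ℝ :=
  ∫ p : ℝ × ℝ, |p.1 - p.2| ^ (-β) * (ψ p.1 * ψ p.2) ∂(volume.prod volume)

theorem locallyIntegrable_abs_rpow {β : ℝ} (hβ1 : β < 1) :
    LocallyIntegrable fun x : ℝ => |x| ^ (-β) :=
  locallyIntegrable_of_norm_le_rpow (C := 1) (α := β) (by simp) (by simpa using hβ1)
    (Filter.Eventually.of_forall fun x => by
      rw [Real.norm_of_nonneg (by positivity), one_mul, Real.norm_eq_abs])
    (by exact Measurable.aestronglyMeasurable (by fun_prop))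

theorem integrable_kernel_mul_prod {k : ℝ → ℝ} (hk : LocallyIntegrable k) {ψ φ : ℝ → ℝ}
    (hψ : Continuous ψ) (hψc : HasCompactSupport ψ) (hφ : Continuous φ)
    (hφc : HasCompactSupport φ) :
    Integrable (fun p : ℝ × ℝ => k (p.1 - p.2) * (ψ p.1 * φ p.2)) (volume.prod volume) := by
  obtain ⟨K, hK, hsub⟩ : ∃ K : Set ℝ, IsCompact K ∧ ∀ x y, ψ x ≠ 0 → φ y ≠ 0 → x - y ∈ K := by
    refine ⟨(fun p : ℝ × ℝ => p.1 - p.2) '' (tsupport ψ ×ˢ tsupport φ),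
      (hψc.isCompact.prod hφc.isCompact).image (by fun_prop), fun x y hx hy => ?_⟩
    exact ⟨(x, y), ⟨subset_tsupport _ hx, subset_tsupport _ hy⟩, rfl⟩
  -- Only differences in the compact set `K` matter, so `k` may be cut off to a globally integrable
  -- kernel.
  have hKint : Integrable (K.indicator k) :=
    (integrable_indicator_iff hK.isClosed.measurableSet).2 (hk.integrableOn_isCompact hK)
  have h1 := (hφ.integrable_of_hasCompactSupport hφc (μ := volume)).convolution_integrand
    (ContinuousLinearMap.mul ℝ ℝ) hKint
  obtain ⟨C, hC⟩ := hψc.exists_bound_of_continuous hψ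
  have h2 := h1.bdd_mul (c := C) (f := fun p : ℝ × ℝ => ψ p.1)
    (by fun_prop) (Filter.Eventually.of_forall fun p => hC p.1)
  refine h2.congr (Filter.Eventually.of_forall fun p => ?_)
  simp only [ContinuousLinearMap.mul_apply']
  by_cases hp : p.1 - p.2 ∈ K
  · rw [indicator_of_mem hp]
    ring
  · rw [indicator_of_notMem hp]
    by_cases h : ψ p.1 = 0
    · simp [h]
    · have : φ p.2 = 0 := by
        by_contra h'
        exact hp (hsub _ _ h h')
      simp [this]

theorem ae_fst_ne_snd : ∀ᵐ p : ℝ × ℝ ∂(volume.prod volume), p.1 ≠ p.2 := by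
  have hm : MeasurableSet {p : ℝ × ℝ | p.1 ≠ p.2} :=
    (measurableSet_eq_fun measurable_fst measurable_snd).compl
  rw [Measure.ae_prod_iff_ae_ae hm]
  refine Filter.Eventually.of_forall fun x => ?_
  have : ∀ᵐ y : ℝ, y ≠ x := by simp [ae_iff]
  filter_upwards [this] with y hy using hy.symm

theorem integral_rpow_mul_exp_abs {β : ℝ} (hβ : 0 < β) {z : ℝ} (hz : z ≠ 0) :
    ∫ t in Ioi (0 : ℝ), t ^ (β / 2 - 1) * Real.exp (-(Real.pi * z ^ 2 * t)) =
      (Real.pi ^ (-(β / 2)) * Real.Gamma (β / 2)) * |z| ^ (-β) := by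
  rw [Real.integral_rpow_mul_exp_neg_mul_Ioi (by positivity) (by have := Real.pi_pos; positivity),
    one_div, Real.inv_rpow (by have := Real.pi_pos; positivity),
    Real.mul_rpow Real.pi_pos.le (by positivity), mul_inv, ← Real.rpow_neg Real.pi_pos.le,
    ← sq_abs, ← Real.rpow_natCast, ← Real.rpow_mul (abs_nonneg z),
    ← Real.rpow_neg (abs_nonneg z)]
  have : -(((2 : ℕ) : ℝ) * (β / 2)) = -β := by push_cast; ring
  rw [this]
  ring

theorem integrableOn_rpow_mul_exp_abs {β : ℝ} (hβ : 0 < β) {z : ℝ} (hz : z ≠ 0) :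
    IntegrableOn (fun t : ℝ => t ^ (β / 2 - 1) * Real.exp (-(Real.pi * z ^ 2 * t))) (Ioi 0) := by
  by_contra hne
  have h1 := integral_rpow_mul_exp_abs hβ hz
  rw [integral_undef hne] at h1
  have : 0 < Real.pi ^ (-(β / 2)) * Real.Gamma (β / 2) * |z| ^ (-β) :=
    mul_pos (mul_pos (Real.rpow_pos_of_pos Real.pi_pos _) (Real.Gamma_pos_of_pos (by positivity)))
      (Real.rpow_pos_of_pos (abs_pos.2 hz) _)
  linarith

/-- The quadratic form with kernel `|x - y|^{-β}` as a superposition of Gaussian forms. -/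
theorem powForm_eq_integral {β : ℝ} (hβ : 0 < β) (hβ1 : β < 1) {ψ : ℝ → ℝ}
    (hψ : Continuous ψ) (hψc : HasCompactSupport ψ) :
    (Real.pi ^ (-(β / 2)) * Real.Gamma (β / 2)) * powForm β ψ =
      ∫ t in Ioi (0 : ℝ), t ^ (β / 2 - 1) * ∫ ξ : ℝ, t ^ (-(1 / 2) : ℝ) *
        Real.exp (-(Real.pi * ξ ^ 2 / t)) * ‖𝓕 (fun x => (ψ x : ℂ)) ξ‖ ^ 2 := by
  have hψi : Integrable ψ := hψ.integrable_of_hasCompactSupport hψc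
  have hmeas : AEStronglyMeasurable (fun q : (ℝ × ℝ) × ℝ => q.2 ^ (β / 2 - 1) *
      Real.exp (-(Real.pi * (q.1.1 - q.1.2) ^ 2 * q.2)) * (ψ q.1.1 * ψ q.1.2))
      ((volume.prod volume).prod (volume.restrict (Ioi 0))) := by
    have := hψ.measurable
    exact Measurable.aestronglyMeasurable (by fun_prop)
  have hint : Integrable (fun q : (ℝ × ℝ) × ℝ => q.2 ^ (β / 2 - 1) *
      Real.exp (-(Real.pi * (q.1.1 - q.1.2) ^ 2 * q.2)) * (ψ q.1.1 * ψ q.1.2))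
      ((volume.prod volume).prod (volume.restrict (Ioi 0))) := by
    rw [integrable_prod_iff hmeas]
    constructor
    · filter_upwards [ae_fst_ne_snd] with p hp
      exact (integrableOn_rpow_mul_exp_abs hβ (sub_ne_zero.2 hp)).mul_const _
    · refine ((integrable_kernel_mul_prod (locallyIntegrable_abs_rpow hβ1) hψ hψc hψ
        hψc).norm.const_mul (Real.pi ^ (-(β / 2)) * Real.Gamma (β / 2))).congr ?_
      filter_upwards [ae_fst_ne_snd] with p hp
      simp_rw [norm_mul _ (ψ p.1 * ψ p.2)]
      rw [integral_mul_const, Real.norm_of_nonneg (r := |p.1 - p.2| ^ (-β)) (by positivity),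
        ← mul_assoc, ← integral_rpow_mul_exp_abs hβ (sub_ne_zero.2 hp)]
      congr 1
      refine setIntegral_congr_fun measurableSet_Ioi fun t ht => ?_
      have ht : (0 : ℝ) < t := ht
      exact (Real.norm_of_nonneg (by positivity)).symm
  have hswap := integral_integral_swap (f := fun (p : ℝ × ℝ) (t : ℝ) => t ^ (β / 2 - 1) *
      Real.exp (-(Real.pi * (p.1 - p.2) ^ 2 * t)) * (ψ p.1 * ψ p.2)) hint
  rw [powForm, ← integral_const_mul]
  have hleft : ∫ p : ℝ × ℝ, Real.pi ^ (-(β / 2)) * Real.Gamma (β / 2) *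
      (|p.1 - p.2| ^ (-β) * (ψ p.1 * ψ p.2)) ∂(volume.prod volume) =
      ∫ p : ℝ × ℝ, (∫ t in Ioi (0 : ℝ), t ^ (β / 2 - 1) *
      Real.exp (-(Real.pi * (p.1 - p.2) ^ 2 * t)) * (ψ p.1 * ψ p.2)) ∂(volume.prod volume) := by
    refine integral_congr_ae ?_
    filter_upwards [ae_fst_ne_snd] with p hp
    rw [integral_mul_const, integral_rpow_mul_exp_abs hβ (sub_ne_zero.2 hp)]
    ring
  rw [hleft, hswap]
  refine setIntegral_congr_fun measurableSet_Ioi fun t ht => ?_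
  simp_rw [mul_assoc (t ^ (β / 2 - 1))]
  rw [integral_const_mul, integral_gaussian_mul_prod hψi ht]

theorem powForm_nonneg {β : ℝ} (hβ : 0 < β) (hβ1 : β < 1) {ψ : ℝ → ℝ}
    (hψ : Continuous ψ) (hψc : HasCompactSupport ψ) : 0 ≤ powForm β ψ := by
  have hc : 0 < Real.pi ^ (-(β / 2)) * Real.Gamma (β / 2) :=
    mul_pos (Real.rpow_pos_of_pos Real.pi_pos _) (Real.Gamma_pos_of_pos (by positivity))
  refine nonneg_of_mul_nonneg_right ?_ hc
  rw [powForm_eq_integral hβ hβ1 hψ hψc]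
  refine setIntegral_nonneg measurableSet_Ioi fun t ht => ?_
  have ht : (0 : ℝ) < t := ht
  exact mul_nonneg (by positivity) (integral_nonneg fun ξ => by positivity)

/-- On the Fourier side the kernel `|x - y|^{-β}` is a multiple of `|ξ|^{β-1}`. Only the upper bound
is needed, so Tonelli for nonnegative integrals suffices and no integrability in frequency has to be
known. -/
theorem ofReal_powForm_le {β : ℝ} (hβ : 0 < β) (hβ1 : β < 1) {ψ : ℝ → ℝ}
    (hψ : Continuous ψ) (hψc : HasCompactSupport ψ) :
    ENNReal.ofReal ((Real.pi ^ (-(β / 2)) * Real.Gamma (β / 2)) * powForm β ψ) ≤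
      ENNReal.ofReal (Real.pi ^ (-((1 - β) / 2)) * Real.Gamma ((1 - β) / 2)) *
        ∫⁻ ξ : ℝ, ENNReal.ofReal (|ξ| ^ (β - 1)) * ‖𝓕 (fun x => (ψ x : ℂ)) ξ‖ₑ ^ 2 := by
  have hFc : Continuous (𝓕 (fun x => (ψ x : ℂ))) :=
    VectorFourier.fourierIntegral_continuous (μ := volume) Real.continuous_fourierChar
      (L := innerₗ ℝ) continuous_inner (hψ.integrable_of_hasCompactSupport hψc).ofReal
  have hFm := hFc.measurable
  rw [powForm_eq_integral hβ hβ1 hψ hψc]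
  set D : ℝ → ℝ≥0∞ := fun ξ => ‖𝓕 (fun x => (ψ x : ℂ)) ξ‖ₑ ^ 2 with hD
  have hDm : Measurable D := hFm.enorm.pow_const 2
  set E : ℝ → ℝ → ℝ≥0∞ := fun t ξ =>
    ENNReal.ofReal (t ^ (β / 2 - 3 / 2) * Real.exp (-(Real.pi * ξ ^ 2 / t))) with hE
  have hEm : Measurable (Function.uncurry E) := by
    simp only [hE, Function.uncurry_def]
    fun_prop
  have h1 : ∀ t ∈ Ioi (0 : ℝ), ‖t ^ (β / 2 - 1) * ∫ ξ : ℝ, t ^ (-(1 / 2) : ℝ) *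
        Real.exp (-(Real.pi * ξ ^ 2 / t)) * ‖𝓕 (fun x => (ψ x : ℂ)) ξ‖ ^ 2‖ₑ ≤
      ∫⁻ ξ : ℝ, E t ξ * D ξ := by
    intro t ht
    have ht : (0 : ℝ) < t := ht
    rw [← integral_const_mul]
    refine (enorm_integral_le_lintegral_enorm _).trans (lintegral_mono fun ξ => le_of_eq ?_)
    have h2 : t ^ (β / 2 - 1) * (t ^ (-(1 / 2) : ℝ) * Real.exp (-(Real.pi * ξ ^ 2 / t)) *
        ‖𝓕 (fun x => (ψ x : ℂ)) ξ‖ ^ 2) = (t ^ (β / 2 - 3 / 2) *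
        Real.exp (-(Real.pi * ξ ^ 2 / t))) * ‖𝓕 (fun x => (ψ x : ℂ)) ξ‖ ^ 2 := by
      rw [show β / 2 - 3 / 2 = (β / 2 - 1) + (-(1 / 2)) by ring, Real.rpow_add ht]
      ring
    simp only [hE, hD]
    rw [h2, Real.enorm_of_nonneg (by positivity), ENNReal.ofReal_mul (by positivity),
      ENNReal.ofReal_pow (norm_nonneg _), ofReal_norm]
  calc _ ≤ ‖∫ t in Ioi (0 : ℝ), t ^ (β / 2 - 1) * ∫ ξ : ℝ, t ^ (-(1 / 2) : ℝ) *
        Real.exp (-(Real.pi * ξ ^ 2 / t)) * ‖𝓕 (fun x => (ψ x : ℂ)) ξ‖ ^ 2‖ₑ :=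
        Real.ofReal_le_enorm _
    _ ≤ ∫⁻ t in Ioi (0 : ℝ), ∫⁻ ξ : ℝ, E t ξ * D ξ :=
        (enorm_integral_le_lintegral_enorm _).trans (setLIntegral_mono' measurableSet_Ioi h1)
    _ = ∫⁻ ξ : ℝ, ∫⁻ t in Ioi (0 : ℝ), E t ξ * D ξ :=
        lintegral_lintegral_swap (hEm.mul (hDm.comp measurable_snd)).aemeasurable
    _ = ∫⁻ ξ : ℝ, ENNReal.ofReal (Real.pi ^ (-((1 - β) / 2)) * Real.Gamma ((1 - β) / 2)) *
          (ENNReal.ofReal (|ξ| ^ (β - 1)) * D ξ) := by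
        refine lintegral_congr_ae ?_
        have : ∀ᵐ ξ : ℝ, ξ ≠ 0 := by simp [ae_iff]
        filter_upwards [this] with ξ hξ
        rw [lintegral_mul_const _ (by fun_prop), lintegral_rpow_mul_exp_neg_div hβ1 hξ, ← mul_assoc,
          ← ENNReal.ofReal_mul (by
            have := Real.Gamma_pos_of_pos (show 0 < (1 - β) / 2 by linarith)
            have := Real.pi_pos
            positivity)]
        congr 2
        rw [one_div, Real.inv_rpow (by have := Real.pi_pos; positivity),
          Real.mul_rpow Real.pi_pos.le (by positivity), mul_inv, ← Real.rpow_neg Real.pi_pos.le,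
          ← sq_abs, ← Real.rpow_natCast, ← Real.rpow_mul (abs_nonneg ξ),
          ← Real.rpow_neg (abs_nonneg ξ)]
        have : -(((2 : ℕ) : ℝ) * ((1 - β) / 2)) = β - 1 := by push_cast; ring
        rw [this]
        ring
    _ = _ := lintegral_const_mul _ (by fun_prop)

/-- The form of kernel `|x - y|^{1-2s}` at `φ'` is controlled by the norm of `H^s`. -/
theorem exists_ofReal_powForm_deriv_le {s : ℝ} (hs : 1 / 2 < s) (hs1 : s < 1) :
    ∃ C : ℝ≥0∞, C ≠ ⊤ ∧ ∀ φ : ℝ → ℝ, ContDiff ℝ ∞ φ → HasCompactSupport φ →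
      ENNReal.ofReal (powForm (2 * s - 1) (deriv φ)) ≤
        C * sobolevNormSq s (fun x => (φ x : ℂ)) := by
  have hβ : 0 < 2 * s - 1 := by linarith
  set c := Real.pi ^ (-((2 * s - 1) / 2)) * Real.Gamma ((2 * s - 1) / 2) with hc_def
  have hc : 0 < c :=
    mul_pos (Real.rpow_pos_of_pos Real.pi_pos _) (Real.Gamma_pos_of_pos (by positivity))
  set A := ENNReal.ofReal (Real.pi ^ (-((1 - (2 * s - 1)) / 2)) *
    Real.Gamma ((1 - (2 * s - 1)) / 2)) with hA
  refine ⟨ENNReal.ofReal c⁻¹ * (A * ENNReal.ofReal ((2 * Real.pi) ^ (2 - 2 * s))), by finiteness,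
    fun φ hφ hφc => ?_⟩
  have hd : Continuous (deriv φ) := hφ.continuous_deriv (by simp)
  have hdc : HasCompactSupport (deriv φ) := hφc.deriv
  have h1 := ofReal_powForm_le hβ (by linarith) hd hdc
  have hF : 𝓕 (fun x => ((deriv φ x : ℝ) : ℂ)) =
      fun ξ : ℝ => (2 * Real.pi * Complex.I * ξ) • 𝓕 (fun x => (φ x : ℂ)) ξ := by
    have hder : deriv (fun x => (φ x : ℂ)) = fun x => ((deriv φ x : ℝ) : ℂ) := by
      ext x
      exact ((hφ.differentiable (by simp)).differentiableAt.hasDerivAt.ofReal_comp).deriv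
    rw [← hder]
    refine Real.fourier_deriv (hφ.continuous.integrable_of_hasCompactSupport hφc).ofReal
      (fun x => (hφ.differentiable (by simp)).differentiableAt.hasDerivAt.ofReal_comp.differentiableAt)
      ?_
    rw [hder]
    exact (hd.integrable_of_hasCompactSupport hdc).ofReal
  -- The derivative contributes `|2πξ|²`; with `|ξ|^{2s-2}` this makes a multiple of `|2πξ|^{2s} ≤
  -- (1 + |2πξ|²)^s`.
  have h2 : ∫⁻ ξ : ℝ, ENNReal.ofReal (|ξ| ^ (2 * s - 1 - 1)) *
      ‖𝓕 (fun x => ((deriv φ x : ℝ) : ℂ)) ξ‖ₑ ^ 2 ≤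
      ENNReal.ofReal ((2 * Real.pi) ^ (2 - 2 * s)) * sobolevNormSq s (fun x => (φ x : ℂ)) := by
    rw [sobolevNormSq, ← lintegral_const_mul' _ _ (by finiteness)]
    refine lintegral_mono_ae ?_
    have : ∀ᵐ ξ : ℝ, ξ ≠ 0 := by simp [ae_iff]
    filter_upwards [this] with ξ hξ
    have hpi := Real.pi_pos
    have hω : 0 < |2 * Real.pi * ξ| := by positivity
    rw [hF]
    simp only [enorm_smul]
    rw [mul_pow, ← mul_assoc, ← mul_assoc]
    refine mul_le_mul' ?_ le_rfl
    rw [← ofReal_norm, ← ENNReal.ofReal_pow (norm_nonneg _), ← ENNReal.ofReal_mul (by positivity),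
      ← ENNReal.ofReal_mul (by positivity)]
    refine ENNReal.ofReal_le_ofReal ?_
    have hn : ‖(2 * Real.pi * Complex.I * ξ : ℂ)‖ = |2 * Real.pi * ξ| := by
      simp [abs_mul, abs_of_pos hpi]
    have hx : |ξ| = |2 * Real.pi * ξ| * (2 * Real.pi)⁻¹ := by
      rw [abs_mul, abs_of_pos (show 0 < 2 * Real.pi by positivity)]
      field_simp
    rw [hn, hx, Real.mul_rpow hω.le (by positivity), Real.inv_rpow (by positivity),
      ← Real.rpow_neg (by positivity), show -(2 * s - 1 - 1) = 2 - 2 * s by ring,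
      ← Real.rpow_natCast _ 2, mul_comm (|2 * Real.pi * ξ| ^ _), mul_assoc, ← Real.rpow_add hω]
    gcongr
    calc |2 * Real.pi * ξ| ^ (2 * s - 1 - 1 + ((2 : ℕ) : ℝ))
        = ((2 * Real.pi * ξ) ^ 2) ^ s := by
          rw [← sq_abs, ← Real.rpow_natCast _ 2, ← Real.rpow_mul hω.le]
          congr 1
          push_cast
          ring
      _ ≤ _ := by
          gcongr
          linarith
  calc ENNReal.ofReal (powForm (2 * s - 1) (deriv φ))
      = ENNReal.ofReal c⁻¹ * ENNReal.ofReal (c * powForm (2 * s - 1) (deriv φ)) := by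
        rw [← ENNReal.ofReal_mul (by positivity), inv_mul_cancel_left₀ hc.ne']
    _ ≤ ENNReal.ofReal c⁻¹ * (A * (ENNReal.ofReal ((2 * Real.pi) ^ (2 - 2 * s)) *
          sobolevNormSq s (fun x => (φ x : ℂ)))) := by
        gcongr
        exact h1.trans (by gcongr)
    _ = _ := by ring

end Gaussian

/-! ### Products of one-sided power kernels. -/

section Kernel

/-- Scaling `x = |h| z` reduces every shift to `1` or `-1`: the two kernels contribute `|h|^{-2s}`
and the measure one factor `|h|`. -/
theorem integrable_mul_shift {a b : ℝ → ℝ} {s : ℝ}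
    (ha : ∀ r > 0, ∀ z, a (r * z) = r ^ (-s) * a z) (hb : ∀ r > 0, ∀ z, b (r * z) = r ^ (-s) * b z)
    (h1 : Integrable fun x => a x * b (x + 1)) (hm1 : Integrable fun x => a x * b (x + -1))
    {h : ℝ} (hh : h ≠ 0) :
    Integrable (fun x => a x * b (x + h)) ∧ ∫ x, a x * b (x + h) =
      |h| ^ (1 - 2 * s) * if 0 < h then ∫ x, a x * b (x + 1) else ∫ x, a x * b (x + -1) := by
  have hr : 0 < |h| := abs_pos.2 hh
  obtain ⟨e, he, hint, hval⟩ : ∃ e : ℝ, |h| * e = h ∧ Integrable (fun x => a x * b (x + e)) ∧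
      (if 0 < h then ∫ x, a x * b (x + 1) else ∫ x, a x * b (x + -1)) =
        ∫ x, a x * b (x + e) := by
    rcases lt_or_gt_of_ne hh with h0 | h0
    · exact ⟨-1, by rw [abs_of_neg h0]; ring, hm1, if_neg (by linarith)⟩
    · exact ⟨1, by rw [abs_of_pos h0]; ring, h1, if_pos h0⟩
  have hcomp : (fun z => a (|h| * z) * b (|h| * z + h)) =
      fun z => |h| ^ (-(2 * s)) * (a z * b (z + e)) := by
    ext z
    have : |h| * z + h = |h| * (z + e) := by rw [mul_add, he]
    rw [this, ha _ hr, hb _ hr, show -(2 * s) = -s + -s by ring, Real.rpow_add hr]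
    ring
  have hI : Integrable (fun x => a x * b (x + h)) := by
    rw [← integrable_comp_mul_left_iff (fun x => a x * b (x + h)) hr.ne', hcomp]
    exact hint.const_mul _
  refine ⟨hI, ?_⟩
  have h2 := Measure.integral_comp_mul_left (fun x => a x * b (x + h)) |h|
  rw [hcomp, integral_const_mul, abs_inv, abs_abs, smul_eq_mul, eq_inv_mul_iff_mul_eq₀ hr.ne'] at h2
  rw [hval, ← h2, ← mul_assoc, sub_eq_add_neg, Real.rpow_add hr, Real.rpow_one]

/-- Two homogeneous kernels compose to a multiple of the quadratic form of `|x - y|^{1-2s}`. -/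
theorem integral_kernel_mul_kernel {a b : ℝ → ℝ} {s : ℝ} (hs1 : s < 1)
    (ham : Measurable a) (hbm : Measurable b) (ha0 : ∀ z, 0 ≤ a z) (hb0 : ∀ z, 0 ≤ b z)
    (ha : ∀ r > 0, ∀ z, a (r * z) = r ^ (-s) * a z) (hb : ∀ r > 0, ∀ z, b (r * z) = r ^ (-s) * b z)
    (h1 : Integrable fun x => a x * b (x + 1)) (hm1 : Integrable fun x => a x * b (x + -1))
    {ψ : ℝ → ℝ} (hψ : Continuous ψ) (hψc : HasCompactSupport ψ) :
    Integrable (fun x => (∫ y, a (x - y) * ψ y) * ∫ y, b (x - y) * ψ y) ∧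
    ∫ x, (∫ y, a (x - y) * ψ y) * ∫ y, b (x - y) * ψ y =
      1 / 2 * ((∫ x, a x * b (x + 1)) + ∫ x, a x * b (x + -1)) * powForm (2 * s - 1) ψ := by
  set κ : ℝ → ℝ := fun h => if 0 < h then ∫ x, a x * b (x + 1) else ∫ x, a x * b (x + -1) with hκ
  have hκm : Measurable κ := Measurable.ite measurableSet_Ioi measurable_const measurable_const
  have hβ1 : 2 * s - 1 < 1 := by linarith
  have hQ := integrable_kernel_mul_prod (locallyIntegrable_abs_rpow hβ1) hψ hψc hψ hψc
  have hψm := hψ.measurable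
  set F : (ℝ × ℝ) × ℝ → ℝ := fun q => (ψ q.1.1 * ψ q.1.2) * (a (q.2 - q.1.1) * b (q.2 - q.1.2))
    with hF
  have hFm : AEStronglyMeasurable F ((volume.prod volume).prod volume) :=
    Measurable.aestronglyMeasurable (by fun_prop)
  have hshift : ∀ p : ℝ × ℝ, p.1 ≠ p.2 → Integrable (fun x => a (x - p.1) * b (x - p.2)) ∧
      ∫ x, a (x - p.1) * b (x - p.2) = |p.1 - p.2| ^ (-(2 * s - 1)) * κ (p.1 - p.2) := by
    intro p hp
    have h := integrable_mul_shift ha hb h1 hm1 (sub_ne_zero.2 hp)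
    have he : (fun x => a (x - p.1) * b (x - p.2)) =
        fun x => (fun z => a z * b (z + (p.1 - p.2))) (x - p.1) := by
      ext x
      simp only
      congr 2
      ring
    rw [he]
    refine ⟨h.1.comp_sub_right p.1, ?_⟩
    rw [integral_sub_right_eq_self (fun z => a z * b (z + (p.1 - p.2))), h.2]
    congr 2
    ring
  have hκb : ∀ h, ‖κ h‖ ≤ |∫ x, a x * b (x + 1)| + |∫ x, a x * b (x + -1)| := by
    intro h
    simp only [hκ, Real.norm_eq_abs]
    split_ifs
    · exact le_add_of_nonneg_right (abs_nonneg _)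
    · exact le_add_of_nonneg_left (abs_nonneg _)
  have hQκ : Integrable (fun p : ℝ × ℝ => κ (p.1 - p.2) *
      (|p.1 - p.2| ^ (-(2 * s - 1)) * (ψ p.1 * ψ p.2))) (volume.prod volume) :=
    hQ.bdd_mul (by exact Measurable.aestronglyMeasurable (by fun_prop))
      (Filter.Eventually.of_forall fun p => hκb _)
  have hint : Integrable F ((volume.prod volume).prod volume) := by
    rw [integrable_prod_iff hFm]
    constructor
    · filter_upwards [ae_fst_ne_snd] with p hp
      exact (hshift p hp).1.const_mul (ψ p.1 * ψ p.2)
    · refine hQκ.norm.congr ?_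
      filter_upwards [ae_fst_ne_snd] with p hp
      simp only [hF, norm_mul _ (a _ * b _)]
      rw [integral_const_mul]
      have : ∫ x, ‖a (x - p.1) * b (x - p.2)‖ = ∫ x, a (x - p.1) * b (x - p.2) :=
        integral_congr_ae (Filter.Eventually.of_forall fun x =>
          Real.norm_of_nonneg (mul_nonneg (ha0 _) (hb0 _)))
      rw [this, (hshift p hp).2]
      have hκ0 : 0 ≤ κ (p.1 - p.2) := by
        simp only [hκ]
        split_ifs <;> exact integral_nonneg fun x => mul_nonneg (ha0 _) (hb0 _)
      rw [norm_mul, norm_mul, Real.norm_of_nonneg hκ0,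
        Real.norm_of_nonneg (r := |p.1 - p.2| ^ _) (by positivity)]
      ring
  have hprod : ∀ x, ∫ p : ℝ × ℝ, F (p, x) ∂(volume.prod volume) =
      (∫ y, a (x - y) * ψ y) * ∫ y, b (x - y) * ψ y := by
    intro x
    rw [← integral_prod_mul]
    refine integral_congr_ae (Filter.Eventually.of_forall fun p => ?_)
    simp only [hF]
    ring
  have hint' := hint.integral_prod_right
  simp_rw [hprod] at hint'
  refine ⟨hint', ?_⟩
  have hswap := integral_integral_swap (f := fun (p : ℝ × ℝ) (x : ℝ) => F (p, x)) hint
  simp_rw [hprod] at hswap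
  rw [← hswap]
  set G : ℝ × ℝ → ℝ := fun p => κ (p.1 - p.2) *
      (|p.1 - p.2| ^ (-(2 * s - 1)) * (ψ p.1 * ψ p.2)) with hG
  have hFG : ∫ p : ℝ × ℝ, (∫ x, F (p, x)) ∂(volume.prod volume) =
      ∫ p, G p ∂(volume.prod volume) := by
    refine integral_congr_ae ?_
    filter_upwards [ae_fst_ne_snd] with p hp
    simp only [hF, hG]
    rw [integral_const_mul, (hshift p hp).2]
    ring
  rw [hFG]
  -- The correlation constant `κ` depends only on the sign of `p.1 - p.2`. Exchanging the variables
  -- averages its two values, which is legitimate because the rest of `G` is symmetric.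
  have hsym : ∫ p, G p.swap ∂(volume.prod volume) = ∫ p, G p ∂(volume.prod volume) :=
    integral_prod_swap G
  have hadd : (∫ p, G p ∂(volume.prod volume)) + ∫ p, G p.swap ∂(volume.prod volume) =
      ((∫ x, a x * b (x + 1)) + ∫ x, a x * b (x + -1)) * powForm (2 * s - 1) ψ := by
    have hswapG : Integrable (fun p : ℝ × ℝ => G p.swap) (volume.prod volume) := hQκ.swap
    rw [powForm, ← integral_const_mul, ← integral_add hQκ hswapG]
    refine integral_congr_ae ?_
    filter_upwards [ae_fst_ne_snd] with p hp
    simp only [hG, Prod.fst_swap, Prod.snd_swap, hκ]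
    rw [abs_sub_comm p.2 p.1]
    rcases lt_or_gt_of_ne hp with h | h
    · rw [if_neg (by linarith), if_pos (by linarith)]
      ring
    · rw [if_pos (by linarith), if_neg (by linarith)]
      ring
  rw [hsym] at hadd
  linarith

/-- The one-sided kernel `z_+^{-s}`. -/
noncomputable def powKernel (s z : ℝ) : ℝ := if 0 < z then z ^ (-s) else 0

theorem powKernel_nonneg (s z : ℝ) : 0 ≤ powKernel s z := by
  unfold powKernel
  split_ifs with h
  · positivity
  · rfl

@[fun_prop]
theorem measurable_powKernel (s : ℝ) : Measurable (powKernel s) :=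
  Measurable.ite measurableSet_Ioi (by fun_prop) measurable_const

theorem powKernel_mul (s : ℝ) {r : ℝ} (hr : 0 < r) (z : ℝ) :
    powKernel s (r * z) = r ^ (-s) * powKernel s z := by
  unfold powKernel
  by_cases hz : 0 < z
  · rw [if_pos (mul_pos hr hz), if_pos hz, Real.mul_rpow hr.le hz.le]
  · rw [if_neg (by rw [mul_pos_iff_of_pos_left hr]; exact hz), if_neg hz, mul_zero]

theorem powKernel_le_abs_rpow (s z : ℝ) : powKernel s z ≤ |z| ^ (-s) := by
  unfold powKernel
  split_ifs with h
  · rw [abs_of_pos h]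
  · positivity

theorem locallyIntegrable_powKernel {s : ℝ} (hs1 : s < 1) : LocallyIntegrable (powKernel s) :=
  locallyIntegrable_of_norm_le_rpow (C := 1) (α := s) (by simp) (by simpa using hs1)
    (Filter.Eventually.of_forall fun x => by
      rw [Real.norm_of_nonneg (powKernel_nonneg s x), one_mul, Real.norm_eq_abs]
      exact powKernel_le_abs_rpow s x)
    (measurable_powKernel s).aestronglyMeasurable

theorem locallyIntegrable_powKernel_neg {s : ℝ} (hs1 : s < 1) :
    LocallyIntegrable fun z => powKernel s (-z) :=
  locallyIntegrable_of_norm_le_rpow (C := 1) (α := s) (by simp) (by simpa using hs1)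
    (Filter.Eventually.of_forall fun x => by
      rw [Real.norm_of_nonneg (powKernel_nonneg s _), one_mul, Real.norm_eq_abs, ← abs_neg]
      exact powKernel_le_abs_rpow s _)
    ((measurable_powKernel s).comp measurable_neg).aestronglyMeasurable

/-- The singularity `x^{-s}` at `0` needs `s < 1`, the tail `x^{-2s}` needs `s > 1/2`. -/
theorem integrable_powKernel_mul_add_one {s : ℝ} (hs : 1 / 2 < s) (hs1 : s < 1) :
    Integrable fun x => powKernel s x * powKernel s (x + 1) := by
  have h1 : IntegrableOn (fun x => powKernel s x) (Icc 0 1) :=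
    (locallyIntegrable_powKernel hs1).integrableOn_isCompact isCompact_Icc
  have h2 : IntegrableOn (fun x : ℝ => x ^ (-(2 * s))) (Ioi 1) :=
    integrableOn_Ioi_rpow_of_lt (by linarith) one_pos
  have h3 : Integrable ((Icc (0 : ℝ) 1).indicator (fun x => powKernel s x) +
      (Ioi (1 : ℝ)).indicator fun x : ℝ => x ^ (-(2 * s))) :=
    ((integrable_indicator_iff measurableSet_Icc).2 h1).add
      ((integrable_indicator_iff measurableSet_Ioi).2 h2)
  refine h3.mono' (by exact Measurable.aestronglyMeasurable (by fun_prop))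
    (Filter.Eventually.of_forall fun x => ?_)
  rw [Real.norm_of_nonneg (mul_nonneg (powKernel_nonneg _ _) (powKernel_nonneg _ _))]
  simp only [Pi.add_apply]
  rcases le_or_gt x 0 with hx | hx
  · have : powKernel s x = 0 := if_neg (by linarith)
    rw [this, zero_mul]
    exact add_nonneg (indicator_nonneg (fun x _ => powKernel_nonneg _ _) _)
      (indicator_nonneg (fun x hx => by have : (1 : ℝ) < x := hx; positivity) _)
  · have hk1 : powKernel s (x + 1) = (x + 1) ^ (-s) := if_pos (by linarith)
    rcases le_or_gt x 1 with hx1 | hx1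
    · rw [indicator_of_mem (mem_Icc.2 ⟨hx.le, hx1⟩), indicator_of_notMem (by simp; linarith),
        add_zero, hk1]
      refine mul_le_of_le_one_right (powKernel_nonneg _ _) ?_
      exact Real.rpow_le_one_of_one_le_of_nonpos (by linarith) (by linarith)
    · rw [indicator_of_notMem (by simp; intro; linarith), indicator_of_mem (mem_Ioi.2 hx1), zero_add, hk1]
      have hk : powKernel s x = x ^ (-s) := if_pos hx
      rw [hk, show -(2 * s) = -s + -s by ring, Real.rpow_add hx]
      exact mul_le_mul_of_nonneg_left
        (Real.rpow_le_rpow_of_nonpos hx (by linarith) (by linarith)) (by positivity)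

theorem integrable_powKernel_mul_sub_one {s : ℝ} (hs : 1 / 2 < s) (hs1 : s < 1) :
    Integrable fun x => powKernel s x * powKernel s (x + -1) := by
  refine ((integrable_powKernel_mul_add_one hs hs1).comp_sub_right 1).congr
    (Filter.Eventually.of_forall fun x => ?_)
  simp only [sub_add_cancel]
  rw [mul_comm, sub_eq_add_neg]

/-- A Beta integral on `(0, 1)`: at each point one of the two factors has argument at least `1/2`
and is bounded by `(1/2)^{-s}`. -/
theorem integrable_powKernel_mul_one_sub {s : ℝ} (hs : 0 < s) (hs1 : s < 1) :
    Integrable fun x => powKernel s x * powKernel s (-(x + -1)) := by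
  have h1 : IntegrableOn (fun x => powKernel s x) (Icc 0 1) :=
    (locallyIntegrable_powKernel hs1).integrableOn_isCompact isCompact_Icc
  have h2 : IntegrableOn (fun x => powKernel s (-(x + -1))) (Icc 0 1) := by
    have h := ((integrable_indicator_iff measurableSet_Icc).2 h1).comp_sub_left 1
    refine ((integrable_indicator_iff measurableSet_Icc).1 (h.congr
      (Filter.Eventually.of_forall fun x => ?_)))
    have hiff : 1 - x ∈ Icc (0 : ℝ) 1 ↔ x ∈ Icc (0 : ℝ) 1 := by
      simp only [mem_Icc]
      constructor <;> rintro ⟨h1, h2⟩ <;> constructor <;> linarith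
    by_cases hx : x ∈ Icc (0 : ℝ) 1
    · simp only [indicator_of_mem hx, indicator_of_mem (hiff.2 hx)]
      ring_nf
    · simp only [indicator_of_notMem hx, indicator_of_notMem (hiff.not.2 hx)]
  have h3 : Integrable ((Icc (0 : ℝ) 1).indicator
      (fun x => (1 / 2) ^ (-s) * (powKernel s x + powKernel s (-(x + -1))))) :=
    (integrable_indicator_iff measurableSet_Icc).2 ((h1.add h2).const_mul _)
  refine h3.mono' (by exact Measurable.aestronglyMeasurable (by fun_prop))
    (Filter.Eventually.of_forall fun x => ?_)
  rw [Real.norm_of_nonneg (mul_nonneg (powKernel_nonneg _ _) (powKernel_nonneg _ _))]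
  by_cases hx : 0 < x ∧ x < 1
  · rw [indicator_of_mem (mem_Icc.2 ⟨hx.1.le, hx.2.le⟩)]
    have hbound : ∀ z, 1 / 2 ≤ z → powKernel s z ≤ (1 / 2) ^ (-s) := fun z hz => by
      rw [powKernel, if_pos (by linarith)]
      exact Real.rpow_le_rpow_of_nonpos (by norm_num) hz (by linarith)
    have n1 := powKernel_nonneg s x
    have n2 := powKernel_nonneg s (-(x + -1))
    have n3 : (0 : ℝ) ≤ (1 / 2) ^ (-s) := by positivity
    rcases le_total (1 / 2) x with h | h
    · nlinarith [hbound x h]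
    · nlinarith [hbound (-(x + -1)) (by linarith)]
  · have : powKernel s x * powKernel s (-(x + -1)) = 0 := by
      rw [not_and_or] at hx
      rcases hx with hx | hx
      · rw [powKernel, if_neg hx, zero_mul]
      · rw [powKernel.eq_def s (-(x + -1)), if_neg (by linarith), mul_zero]
    rw [this]
    exact indicator_nonneg (fun x _ => mul_nonneg (by positivity)
      (add_nonneg (powKernel_nonneg _ _) (powKernel_nonneg _ _))) _

/-- Two equal kernels: with `ψ = φ'` this gives the `L²` norm of a one-sided derivative in terms of
the quantity that the `H^s` norm controls. -/
theorem exists_integral_powKernel_sq {s : ℝ} (hs : 1 / 2 < s) (hs1 : s < 1) :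
    ∃ c : ℝ, 0 ≤ c ∧ ∀ ψ : ℝ → ℝ, Continuous ψ → HasCompactSupport ψ →
      Integrable (fun x => (∫ y, powKernel s (x - y) * ψ y) * ∫ y, powKernel s (x - y) * ψ y) ∧
      ∫ x, (∫ y, powKernel s (x - y) * ψ y) * ∫ y, powKernel s (x - y) * ψ y =
        c * powForm (2 * s - 1) ψ := by
  refine ⟨_, ?_, fun ψ hψ hψc => integral_kernel_mul_kernel hs1 (measurable_powKernel s)
    (measurable_powKernel s) (powKernel_nonneg s) (powKernel_nonneg s)
    (fun r hr => powKernel_mul s hr) (fun r hr => powKernel_mul s hr)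
    (integrable_powKernel_mul_add_one hs hs1) (integrable_powKernel_mul_sub_one hs hs1) hψ hψc⟩
  exact mul_nonneg (by norm_num) (add_nonneg
    (integral_nonneg fun x => mul_nonneg (powKernel_nonneg _ _) (powKernel_nonneg _ _))
    (integral_nonneg fun x => mul_nonneg (powKernel_nonneg _ _) (powKernel_nonneg _ _)))

theorem powKernel_neg_mul (s : ℝ) {r : ℝ} (hr : 0 < r) (z : ℝ) :
    powKernel s (-(r * z)) = r ^ (-s) * powKernel s (-z) := by
  rw [← mul_neg, powKernel_mul s hr]

theorem exists_integral_powKernel_neg_sq {s : ℝ} (hs : 1 / 2 < s) (hs1 : s < 1) :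
    ∃ c : ℝ, 0 ≤ c ∧ ∀ ψ : ℝ → ℝ, Continuous ψ → HasCompactSupport ψ →
      Integrable (fun x => (∫ y, powKernel s (-(x - y)) * ψ y) *
        ∫ y, powKernel s (-(x - y)) * ψ y) ∧
      ∫ x, (∫ y, powKernel s (-(x - y)) * ψ y) * ∫ y, powKernel s (-(x - y)) * ψ y =
        c * powForm (2 * s - 1) ψ := by
  have i1 := (integrable_powKernel_mul_add_one hs hs1).comp_neg
  have i2 := (integrable_powKernel_mul_sub_one hs hs1).comp_neg
  refine ⟨_, ?_, fun ψ hψ hψc => integral_kernel_mul_kernel (a := fun z => powKernel s (-z))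
    (b := fun z => powKernel s (-z)) hs1 (by fun_prop)
    (by fun_prop) (fun z => powKernel_nonneg s _) (fun z => powKernel_nonneg s _)
    (fun r hr => powKernel_neg_mul s hr) (fun r hr => powKernel_neg_mul s hr)
    (by simpa only [neg_add] using i2) (by simpa only [neg_add, neg_neg] using i1) hψ hψc⟩
  exact mul_nonneg (by norm_num) (add_nonneg
    (integral_nonneg fun x => mul_nonneg (powKernel_nonneg _ _) (powKernel_nonneg _ _))
    (integral_nonneg fun x => mul_nonneg (powKernel_nonneg _ _) (powKernel_nonneg _ _)))

/-- The source of the nonnegativity of the energy. Of the two correlation constants one vanishes,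
because the supports of the kernels are disjoint after the shift by `1`; the other is the Beta
integral. -/
theorem integral_powKernel_mul_powKernel_neg_nonneg {s : ℝ} (hs : 1 / 2 < s) (hs1 : s < 1)
    {ψ : ℝ → ℝ} (hψ : Continuous ψ) (hψc : HasCompactSupport ψ) :
    0 ≤ ∫ x, (∫ y, powKernel s (x - y) * ψ y) * ∫ y, powKernel s (-(x - y)) * ψ y := by
  have h0 : (fun x => powKernel s x * powKernel s (-(x + 1))) = 0 := by
    ext x
    simp only [Pi.zero_apply, mul_eq_zero]
    by_cases hx : 0 < x
    · exact Or.inr (if_neg (by linarith))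
    · exact Or.inl (if_neg hx)
  rw [(integral_kernel_mul_kernel (b := fun z => powKernel s (-z)) hs1 (measurable_powKernel s)
    (by fun_prop) (powKernel_nonneg s) (fun z => powKernel_nonneg s _)
    (fun r hr => powKernel_mul s hr) (fun r hr => powKernel_neg_mul s hr)
    (by simp only [h0]; exact integrable_zero _ _ _)
    (integrable_powKernel_mul_one_sub (by linarith) hs1) hψ hψc).2]
  refine mul_nonneg (mul_nonneg (by norm_num) (add_nonneg
    (integral_nonneg fun x => mul_nonneg (powKernel_nonneg _ _) (powKernel_nonneg _ _))
    (integral_nonneg fun x => mul_nonneg (powKernel_nonneg _ _) (powKernel_nonneg _ _))))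
    (powForm_nonneg (by linarith) (by linarith) hψ hψc)

end Kernel

namespace FeynmanKac

/-! ### Plancherel inequality for integrable, square integrable functions. -/

section Plancherel

/-- If the right side is finite, `𝓕 f` lies in `L²`. It represents the same tempered distribution as
the `L²` Fourier transform of `f`, hence equals it, and the latter is isometric. -/
theorem lintegral_enorm_sq_le_fourier {f : ℝ → ℂ} (hf : Integrable f) (hf2 : MemLp f 2) :
    ∫⁻ x, ‖f x‖ₑ ^ 2 ≤ ∫⁻ ξ, ‖𝓕 f ξ‖ₑ ^ 2 := by
  by_cases hfin : ∫⁻ ξ, ‖𝓕 f ξ‖ₑ ^ 2 = ⊤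
  · rw [hfin]
    exact le_top
  have hFc : Continuous (𝓕 f) :=
    VectorFourier.fourierIntegral_continuous (μ := volume) Real.continuous_fourierChar
      (L := innerₗ ℝ) continuous_inner hf
  have hnorm : ∀ g : ℝ → ℂ, eLpNorm g 2 volume = (∫⁻ x, ‖g x‖ₑ ^ 2) ^ (1 / 2 : ℝ) := by
    intro g
    rw [eLpNorm_eq_lintegral_rpow_enorm_toReal (by norm_num) (by norm_num)]
    simp
  have hF2 : MemLp (𝓕 f) 2 := by
    refine ⟨hFc.aestronglyMeasurable, ?_⟩
    rw [hnorm]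
    exact ENNReal.rpow_lt_top_of_nonneg (by norm_num) hfin
  have hdist : (Lp.toTemperedDistribution (𝓕 (hf2.toLp f)) : TemperedDistribution ℝ ℂ) =
      Lp.toTemperedDistribution (hF2.toLp (𝓕 f)) := by
    rw [← Lp.fourier_toTemperedDistribution_eq]
    ext g
    rw [TemperedDistribution.fourier_apply, Lp.toTemperedDistribution_apply,
      Lp.toTemperedDistribution_apply]
    have h1 : ∫ x, (𝓕 g) x • (hf2.toLp f) x = ∫ x, 𝓕 (g : ℝ → ℂ) x • f x := by
      refine integral_congr_ae ?_
      filter_upwards [hf2.coeFn_toLp] with x hx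
      rw [hx, SchwartzMap.fourier_coe]
    have h2 : ∫ x, g x • (hF2.toLp (𝓕 f)) x = ∫ x, g x • 𝓕 f x := by
      refine integral_congr_ae ?_
      filter_upwards [hF2.coeFn_toLp] with x hx
      rw [hx]
    rw [h1, h2]
    have h3 := VectorFourier.integral_fourierIntegral_smul_eq_flip (μ := (volume : Measure ℝ))
      (ν := (volume : Measure ℝ)) (L := innerₗ ℝ) Real.continuous_fourierChar continuous_inner
      g.integrable hf
    simpa using! h3
  have hinj : 𝓕 (hf2.toLp f) = hF2.toLp (𝓕 f) :=
    LinearMap.ker_eq_bot.1 (Lp.ker_toTemperedDistributionCLM_eq_bot (F := ℂ)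
      (μ := (volume : Measure ℝ)) (p := 2)) hdist
  have hn := Lp.norm_fourier_eq (hf2.toLp f)
  rw [hinj, Lp.norm_toLp, Lp.norm_toLp, ENNReal.toReal_eq_toReal_iff' hF2.2.ne hf2.2.ne, hnorm,
    hnorm] at hn
  exact ((ENNReal.rpow_left_injective (by norm_num : (1 / 2 : ℝ) ≠ 0)) hn).ge

end Plancherel

/-! ### Weak derivatives of convolution operators on the interval. -/

section WeakDerivative

variable {a b : ℝ}

theorem L2.inner_eq (u v : L2 a b) : inner ℝ u v = ∫ x in Ioo a b, u x * v x := by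
  rw [MeasureTheory.L2.inner_def]
  simp [mul_comm]

/-- Convolution with a kernel, on the line. -/
noncomputable def kconv (k ψ : ℝ → ℝ) (x : ℝ) : ℝ := ∫ y, k (x - y) * ψ y

/-- The operator with a convolution kernel on `(a, b)`. -/
noncomputable def kernelOp (k : ℝ → ℝ) (u : L2 a b) (x : ℝ) : ℝ := ∫ y in Ioo a b, k (x - y) * u y

theorem kconv_eq_convolution (k ψ : ℝ → ℝ) :
    kconv k ψ = convolution k ψ (ContinuousLinearMap.mul ℝ ℝ) volume := by
  ext x
  rw [kconv, convolution, ← integral_sub_left_eq_self _ volume x]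
  simp

theorem continuous_kconv {k ψ : ℝ → ℝ} (hk : LocallyIntegrable k) (hψ : Continuous ψ)
    (hψc : HasCompactSupport ψ) : Continuous (kconv k ψ) := by
  rw [kconv_eq_convolution]
  exact hψc.continuous_convolution_right _ hk hψ

theorem hasDerivAt_kconv {k φ : ℝ → ℝ} (hk : LocallyIntegrable k) (hφ : ContDiff ℝ ∞ φ)
    (hφc : HasCompactSupport φ) (x : ℝ) : HasDerivAt (kconv k φ) (kconv k (deriv φ) x) x := by
  rw [kconv_eq_convolution, kconv_eq_convolution]
  exact hφc.hasDerivAt_convolution_right _ hk (hφ.of_le (by simp)) x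

theorem memLp_of_continuous {g : ℝ → ℝ} (hg : Continuous g) :
    MemLp g 2 (volume.restrict (Ioo a b)) := by
  obtain ⟨C, hC⟩ := isCompact_Icc.exists_bound_of_continuousOn (hg.continuousOn (s := Icc a b))
  refine MemLp.of_bound hg.aestronglyMeasurable C ?_
  filter_upwards [ae_restrict_mem measurableSet_Ioo] with x hx using hC x (Ioo_subset_Icc_self hx)

/-- A continuous function as an element of `L²(a, b)`. -/
noncomputable def contToL2 (a b : ℝ) (g : ℝ → ℝ) (hg : Continuous g) : L2 a b :=
  (memLp_of_continuous hg).toLp g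

theorem coeFn_contToL2 {g : ℝ → ℝ} (hg : Continuous g) :
    contToL2 a b g hg =ᵐ[volume.restrict (Ioo a b)] g := MemLp.coeFn_toLp _

theorem integral_mul_contToL2 {g : ℝ → ℝ} (hg : Continuous g) (u : L2 a b) :
    ∫ x in Ioo a b, u x * g x = inner ℝ u (contToL2 a b g hg) := by
  rw [L2.inner_eq]
  refine integral_congr_ae ?_
  filter_upwards [coeFn_contToL2 hg] with x hx
  rw [hx]

theorem IsTestFunction.continuous_deriv' {φ : ℝ → ℝ} (h : IsTestFunction a b φ) :
    Continuous (deriv φ) := h.smooth.continuous_deriv (by simp)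

theorem IsTestFunction.eq_zero {φ : ℝ → ℝ} (h : IsTestFunction a b φ) {x : ℝ}
    (hx : x ∉ Ioo a b) : φ x = 0 :=
  image_eq_zero_of_notMem_tsupport fun hx' => hx (h.supp hx')

theorem IsTestFunction.deriv_eq_zero {φ : ℝ → ℝ} (h : IsTestFunction a b φ) {x : ℝ}
    (hx : x ∉ Ioo a b) : deriv φ x = 0 :=
  image_eq_zero_of_notMem_tsupport fun hx' => hx (h.supp (tsupport_deriv_subset hx'))

theorem setIntegral_Ioo_eq {φ : ℝ → ℝ} (h : ∀ x ∉ Ioo a b, φ x = 0) :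
    ∫ x in Ioo a b, φ x = ∫ x, φ x :=
  setIntegral_eq_integral_of_forall_compl_eq_zero h

/-- The operator against a test function is the adjoint operator. -/
theorem integral_kernelOp_mul {k : ℝ → ℝ} (hk : LocallyIntegrable k) (u : L2 a b) {η : ℝ → ℝ}
    (hη : Continuous η) (hηc : HasCompactSupport η) (hη0 : ∀ x ∉ Ioo a b, η x = 0) :
    ∫ x in Ioo a b, kernelOp k u x * η x =
      ∫ y in Ioo a b, u y * kconv (fun z => k (-z)) η y := by
  set μ := (volume : Measure ℝ).restrict (Ioo a b) with hμ
  -- Differences of points of `(a, b)` lie in `[a - b, b - a]`, so the kernel may be truncated there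
  -- and becomes integrable.
  set g : ℝ → ℝ := (Icc (a - b) (b - a)).indicator k with hg
  have hgi : Integrable g :=
    (integrable_indicator_iff measurableSet_Icc).2 (hk.integrableOn_isCompact isCompact_Icc)
  have hu : Integrable (fun x => u x) μ := (Lp.memLp u).integrable (by norm_num)
  have hU : Integrable ((Ioo a b).indicator fun x => u x) :=
    (integrable_indicator_iff measurableSet_Ioo).2 hu
  have h1 := (hU.convolution_integrand (ContinuousLinearMap.mul ℝ ℝ) hgi).restrict
    (s := Ioo a b ×ˢ Ioo a b)
  rw [← Measure.prod_restrict] at h1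
  obtain ⟨C, hC⟩ := hηc.exists_bound_of_continuous hη
  have h2 := h1.bdd_mul (c := C) (f := fun p : ℝ × ℝ => η p.1) (by fun_prop)
    (Filter.Eventually.of_forall fun p => hC p.1)
  have hint : Integrable (Function.uncurry fun x y => k (x - y) * u y * η x) (μ.prod μ) := by
    refine h2.congr ?_
    rw [Measure.prod_restrict]
    filter_upwards [ae_restrict_mem (measurableSet_Ioo.prod measurableSet_Ioo)] with p hp
    obtain ⟨hp1, hp2⟩ := hp
    have hmem : p.1 - p.2 ∈ Icc (a - b) (b - a) :=
      ⟨by linarith [hp1.1, hp2.2], by linarith [hp1.2, hp2.1]⟩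
    simp only [ContinuousLinearMap.mul_apply', Function.uncurry, hg, indicator_of_mem hp2,
      indicator_of_mem hmem]
    ring
  have hswap := integral_integral_swap hint
  have hL : ∀ x, ∫ y, k (x - y) * u y * η x ∂μ = kernelOp k u x * η x := fun x =>
    integral_mul_const _ _
  have hR : ∀ y, ∫ x, k (x - y) * u y * η x ∂μ = u y * kconv (fun z => k (-z)) η y := by
    intro y
    rw [kconv, ← setIntegral_Ioo_eq (a := a) (b := b) (fun x hx => by rw [hη0 x hx, mul_zero]),
      ← integral_const_mul]
    refine integral_congr_ae (Filter.Eventually.of_forall fun x => ?_)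
    simp only [neg_sub]
    ring
  simp_rw [hL, hR] at hswap
  exact hswap

theorem locallyIntegrable_comp_neg {k : ℝ → ℝ} (hk : LocallyIntegrable k) :
    LocallyIntegrable fun z => k (-z) := by
  rw [locallyIntegrable_iff] at hk ⊢
  intro K hK
  have h := hk _ (hK.image continuous_neg)
  have h2 := ((integrable_indicator_iff (hK.image continuous_neg).isClosed.measurableSet).2 h).comp_neg
  refine (integrable_indicator_iff hK.isClosed.measurableSet).1 (h2.congr
    (Filter.Eventually.of_forall fun x => ?_))
  by_cases hx : x ∈ K
  · simp [hx]
  · simp [hx]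

/-- Weak differentiability of `kernelOp k u` as a family of linear conditions on `L²(a, b)`. -/
theorem isWeakDeriv_kernelOp_iff {k : ℝ → ℝ} (hk : LocallyIntegrable k) (u w : L2 a b) :
    IsWeakDeriv (kernelOp k u) w ↔ ∀ (φ : ℝ → ℝ) (h : IsTestFunction a b φ),
      inner ℝ u (contToL2 a b (kconv (fun z => k (-z)) (deriv φ))
        (continuous_kconv (locallyIntegrable_comp_neg hk) h.continuous_deriv' h.compact.deriv)) +
      inner ℝ w (contToL2 a b φ h.smooth.continuous) = 0 := by
  refine forall_congr' fun φ => forall_congr' fun h => ?_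
  rw [← integral_mul_contToL2, ← integral_mul_contToL2,
    integral_kernelOp_mul hk u h.continuous_deriv' h.compact.deriv fun x hx => h.deriv_eq_zero hx]
  exact eq_neg_iff_add_eq_zero

theorem isWeakDeriv_kernelOp_add {k : ℝ → ℝ} (hk : LocallyIntegrable k) {u v w z : L2 a b}
    (hu : IsWeakDeriv (kernelOp k u) w) (hv : IsWeakDeriv (kernelOp k v) z) :
    IsWeakDeriv (kernelOp k (u + v)) (w + z) := by
  rw [isWeakDeriv_kernelOp_iff hk] at *
  intro φ h
  have h1 := hu φ h
  have h2 := hv φ h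
  rw [inner_add_left, inner_add_left]
  linarith

theorem isWeakDeriv_kernelOp_smul {k : ℝ → ℝ} (hk : LocallyIntegrable k) {u w : L2 a b}
    (c : ℝ) (hu : IsWeakDeriv (kernelOp k u) w) :
    IsWeakDeriv (kernelOp k (c • u)) (c • w) := by
  rw [isWeakDeriv_kernelOp_iff hk] at *
  intro φ h
  have h1 := hu φ h
  rw [real_inner_smul_left, real_inner_smul_left, ← mul_add, h1, mul_zero]

/-- The conditions of `isWeakDeriv_kernelOp_iff` are continuous in the pair `(u, w)`: the operator
is closed. -/
theorem isWeakDeriv_kernelOp_of_tendsto {k : ℝ → ℝ} (hk : LocallyIntegrable k) {u w : L2 a b}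
    {us ws : ℕ → L2 a b} (h : ∀ n, IsWeakDeriv (kernelOp k (us n)) (ws n))
    (hu : Filter.Tendsto us Filter.atTop (nhds u)) (hw : Filter.Tendsto ws Filter.atTop (nhds w)) :
    IsWeakDeriv (kernelOp k u) w := by
  rw [isWeakDeriv_kernelOp_iff hk]
  intro φ hφ
  refine tendsto_nhds_unique ((hu.inner tendsto_const_nhds).add (hw.inner tendsto_const_nhds)) ?_
  refine tendsto_const_nhds.congr fun n => ?_
  exact ((isWeakDeriv_kernelOp_iff hk _ _).1 (h n) φ hφ).symm

theorem kernelOp_contToL2 {φ : ℝ → ℝ} (h : IsTestFunction a b φ) (k : ℝ → ℝ) (x : ℝ) :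
    kernelOp k (contToL2 a b φ h.smooth.continuous) x = kconv k φ x := by
  rw [kernelOp, kconv, ← setIntegral_Ioo_eq (a := a) (b := b)
    (fun y hy => by rw [h.eq_zero hy, mul_zero])]
  refine integral_congr_ae ?_
  filter_upwards [coeFn_contToL2 h.smooth.continuous] with y hy
  rw [hy]

/-- For a test function the derivative of the convolution may be moved onto `φ`; what remains is an
integration by parts on the line. -/
theorem isWeakDeriv_kernelOp_test {k : ℝ → ℝ} (hk : LocallyIntegrable k) {φ : ℝ → ℝ}
    (h : IsTestFunction a b φ) :
    IsWeakDeriv (kernelOp k (contToL2 a b φ h.smooth.continuous))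
      (contToL2 a b (kconv k (deriv φ)) (continuous_kconv hk h.continuous_deriv' h.compact.deriv)) := by
  intro η hη
  have hc1 := continuous_kconv hk h.smooth.continuous h.compact
  have hc2 := continuous_kconv hk h.continuous_deriv' h.compact.deriv
  have h1 : ∫ x in Ioo a b, contToL2 a b (kconv k (deriv φ)) hc2 x * η x =
      ∫ x, kconv k (deriv φ) x * η x := by
    rw [← setIntegral_Ioo_eq (a := a) (b := b) (fun y hy => by rw [hη.eq_zero hy, mul_zero])]
    refine integral_congr_ae ?_
    filter_upwards [coeFn_contToL2 hc2] with y hy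
    rw [hy]
  have h2 : ∫ x in Ioo a b, kernelOp k (contToL2 a b φ h.smooth.continuous) x * deriv η x =
      ∫ x, kconv k φ x * deriv η x := by
    simp_rw [kernelOp_contToL2 h]
    exact setIntegral_Ioo_eq (a := a) (b := b) (fun y hy => by rw [hη.deriv_eq_zero hy, mul_zero])
  rw [h1, h2]
  refine integral_mul_deriv_eq_deriv_mul_of_integrable
    (fun x _ => hasDerivAt_kconv hk h.smooth h.compact x)
    (fun x _ => (hη.smooth.differentiable (by simp)).differentiableAt.hasDerivAt) ?_ ?_ ?_
  · exact (hc1.mul hη.continuous_deriv').integrable_of_hasCompactSupport hη.compact.deriv.mul_left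
  · exact (hc2.mul hη.smooth.continuous).integrable_of_hasCompactSupport hη.compact.mul_left
  · exact (hc1.mul hη.smooth.continuous).integrable_of_hasCompactSupport hη.compact.mul_left

theorem IsWeakDeriv.unique {F : ℝ → ℝ} {w z : L2 a b} (hw : IsWeakDeriv F w)
    (hz : IsWeakDeriv F z) : w = z := by
  have hloc : LocallyIntegrableOn (fun x => (w - z : L2 a b) x) (Ioo a b) := by
    have : IntegrableOn (fun x => (w - z : L2 a b) x) (Ioo a b) :=
      (Lp.memLp (w - z)).integrable (by norm_num)
    exact this.locallyIntegrableOn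
  have h := isOpen_Ioo.ae_eq_zero_of_integral_contDiff_smul_eq_zero hloc fun g hg hgc hgs => by
    have ht : IsTestFunction a b g := ⟨hg, hgc, hgs⟩
    have h1 := (hw g ht).symm.trans (hz g ht)
    rw [neg_inj, integral_mul_contToL2 hg.continuous, integral_mul_contToL2 hg.continuous,
      ← sub_eq_zero, ← inner_sub_left, ← integral_mul_contToL2] at h1
    rw [← h1, ← setIntegral_Ioo_eq (a := a) (b := b)
      (fun x hx => by rw [ht.eq_zero hx, zero_smul])]
    simp only [smul_eq_mul, mul_comm]
  rw [← sub_eq_zero, Lp.eq_zero_iff_ae_eq_zero, Filter.EventuallyEq,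
    ae_restrict_iff' measurableSet_Ioo]
  exact h

/-- By uniqueness the arbitrary choice in `weakDeriv` can be replaced by any weak derivative at
hand. -/
theorem IsWeakDeriv.weakDeriv_eq {F : ℝ → ℝ} {w : L2 a b} (hw : IsWeakDeriv F w) :
    weakDeriv a b F = w := by
  have h : ∃ w : L2 a b, IsWeakDeriv F w := ⟨w, hw⟩
  rw [weakDeriv, dif_pos h]
  exact h.choose_spec.unique hw

theorem IsWeakDeriv.congr_const_mul {F G : ℝ → ℝ} {c : ℝ} {w : L2 a b} (hw : IsWeakDeriv F w)
    (h : ∀ x ∈ Ioo a b, G x = c * F x) : IsWeakDeriv G (c • w) := by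
  intro φ hφ
  have h1 : ∫ x in Ioo a b, G x * deriv φ x = c * ∫ x in Ioo a b, F x * deriv φ x := by
    rw [← integral_const_mul]
    refine setIntegral_congr_fun measurableSet_Ioo fun x hx => ?_
    simp only [h x hx]
    ring
  rw [h1, hw φ hφ, integral_mul_contToL2 hφ.smooth.continuous,
    integral_mul_contToL2 hφ.smooth.continuous, real_inner_smul_left]
  ring

theorem leftIntegral_eq_kernelOp (s : ℝ) (u : L2 a b) {x : ℝ} (hx : x ∈ Ioo a b) :
    leftIntegral (1 - s) u x = (Real.Gamma (1 - s))⁻¹ * kernelOp (powKernel s) u x := by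
  have h1 : ∫ y in Ioo a b, powKernel s (x - y) * u y = ∫ y in Ioo a x, powKernel s (x - y) * u y := by
    refine setIntegral_eq_of_subset_of_forall_sdiff_eq_zero measurableSet_Ioo
      (Ioo_subset_Ioo_right hx.2.le) fun y hy => ?_
    have : ¬ 0 < x - y := fun h => hy.2 ⟨hy.1.1, by linarith⟩
    rw [powKernel, if_neg this, zero_mul]
  rw [leftIntegral, kernelOp, intervalIntegral.integral_of_le hx.1.le,
    integral_Ioc_eq_integral_Ioo, h1]
  congr 1
  refine setIntegral_congr_fun measurableSet_Ioo fun y hy => ?_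
  have h2 : 0 < x - y := by linarith [hy.2]
  simp only [powKernel, if_pos h2]
  congr 2
  ring

theorem rightIntegral_eq_kernelOp (s : ℝ) (u : L2 a b) {x : ℝ} (hx : x ∈ Ioo a b) :
    rightIntegral (1 - s) u x =
      (Real.Gamma (1 - s))⁻¹ * kernelOp (fun z => powKernel s (-z)) u x := by
  have h1 : ∫ y in Ioo a b, powKernel s (-(x - y)) * u y = ∫ y in Ioo x b, powKernel s (-(x - y)) * u y := by
    refine setIntegral_eq_of_subset_of_forall_sdiff_eq_zero measurableSet_Ioo
      (Ioo_subset_Ioo_left hx.1.le) fun y hy => ?_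
    have : ¬ 0 < -(x - y) := fun h => hy.2 ⟨by linarith, hy.1.2⟩
    rw [powKernel, if_neg this, zero_mul]
  rw [rightIntegral, kernelOp, intervalIntegral.integral_of_le hx.2.le,
    integral_Ioc_eq_integral_Ioo, h1]
  congr 1
  refine setIntegral_congr_fun measurableSet_Ioo fun y hy => ?_
  have h2 : 0 < -(x - y) := by linarith [hy.1]
  simp only [powKernel, if_pos h2]
  congr 2 <;> ring

theorem leftRL_eq {s : ℝ} {u w : L2 a b} (h : IsWeakDeriv (kernelOp (powKernel s) u) w) :
    leftRL s u = (Real.Gamma (1 - s))⁻¹ • w :=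
  (h.congr_const_mul fun _ hx => leftIntegral_eq_kernelOp s u hx).weakDeriv_eq

theorem rightRL_eq {s : ℝ} {u w : L2 a b}
    (h : IsWeakDeriv (kernelOp (fun z => powKernel s (-z)) u) w) :
    rightRL s u = -((Real.Gamma (1 - s))⁻¹ • w) := by
  rw [rightRL, (h.congr_const_mul fun _ hx => rightIntegral_eq_kernelOp s u hx).weakDeriv_eq]

end WeakDerivative

/-! ### The Riesz form on `H₀^{α/2}`: existence of derivatives, symmetry, nonnegativity. -/

section Energy

variable {a b : ℝ}

theorem ofReal_norm_sq_L2 (u : L2 a b) :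
    ENNReal.ofReal (‖u‖ ^ 2) = ∫⁻ x in Ioo a b, ‖u x‖ₑ ^ 2 := by
  rw [ENNReal.ofReal_pow (norm_nonneg _), ofReal_norm, Lp.enorm_def,
    eLpNorm_eq_lintegral_rpow_enorm_toReal (by norm_num) (by norm_num), ← ENNReal.rpow_natCast,
    ← ENNReal.rpow_mul]
  simp

theorem one_le_sobolev_weight {s : ℝ} (hs : 0 ≤ s) (ξ : ℝ) :
    1 ≤ ENNReal.ofReal ((1 + (2 * Real.pi * ξ) ^ 2) ^ s) := by
  rw [ENNReal.one_le_ofReal]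
  exact Real.one_le_rpow (by nlinarith [sq_nonneg (2 * Real.pi * ξ)]) hs

/-- The Sobolev weight is at least `1`, so by Plancherel approximation in `H^s` implies
approximation in `L²`. -/
theorem norm_sub_contToL2_sq_le {s : ℝ} (hs : 0 ≤ s) (u : L2 a b) {φ : ℝ → ℝ}
    (h : IsTestFunction a b φ) :
    ENNReal.ofReal (‖u - contToL2 a b φ h.smooth.continuous‖ ^ 2) ≤
      sobolevNormSq s fun x => zeroExt u x - ((φ x : ℝ) : ℂ) := by
  have hdiff : ∀ᵐ x, zeroExt u x - ((φ x : ℝ) : ℂ) = (Ioo a b).indicator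
      (fun x => (((u - contToL2 a b φ h.smooth.continuous : L2 a b) x : ℝ) : ℂ)) x := by
    have h1 := Lp.coeFn_sub u (contToL2 a b φ h.smooth.continuous)
    have h2 := coeFn_contToL2 (a := a) (b := b) h.smooth.continuous
    rw [Filter.EventuallyEq, ae_restrict_iff' measurableSet_Ioo] at h1 h2
    filter_upwards [h1, h2] with x hx1 hx2
    by_cases hx : x ∈ Ioo a b
    · rw [indicator_of_mem hx, hx1 hx, Pi.sub_apply, hx2 hx]
      simp [zeroExt, hx]
    · simp [zeroExt, hx, h.eq_zero hx]
  rw [sobolevNormSq_congr_ae hdiff]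
  set v := u - contToL2 a b φ h.smooth.continuous with hv
  have hi : Integrable (zeroExt v) := integrable_zeroExt v
  have h2 : MemLp (zeroExt v) 2 :=
    (memLp_indicator_iff_restrict measurableSet_Ioo).2 (Lp.memLp v).ofReal
  calc ENNReal.ofReal (‖v‖ ^ 2) = ∫⁻ x, ‖zeroExt v x‖ₑ ^ 2 := by
        rw [ofReal_norm_sq_L2, ← lintegral_indicator measurableSet_Ioo]
        refine lintegral_congr fun x => ?_
        by_cases hx : x ∈ Ioo a b
        · simp [zeroExt, hx, ← ofReal_norm]
        · simp [zeroExt, hx]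
    _ ≤ ∫⁻ ξ, ‖𝓕 (zeroExt v) ξ‖ₑ ^ 2 := lintegral_enorm_sq_le_fourier hi h2
    _ ≤ sobolevNormSq s (zeroExt v) := by
        refine lintegral_mono fun ξ => ?_
        calc ‖𝓕 (zeroExt v) ξ‖ₑ ^ 2 = 1 * ‖𝓕 (zeroExt v) ξ‖ₑ ^ 2 := (one_mul _).symm
          _ ≤ _ := mul_le_mul' (one_le_sobolev_weight hs ξ) le_rfl

theorem IsTestFunction.sub {φ ψ : ℝ → ℝ} (hφ : IsTestFunction a b φ) (hψ : IsTestFunction a b ψ) :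
    IsTestFunction a b (φ - ψ) :=
  ⟨hφ.smooth.sub hψ.smooth, hφ.compact.sub hψ.compact,
    (tsupport_sub φ ψ).trans (union_subset hφ.supp hψ.supp)⟩

theorem norm_contToL2_sq_le_integral {g : ℝ → ℝ} (hg : Continuous g)
    (hi : Integrable fun x => g x * g x) :
    ‖contToL2 a b g hg‖ ^ 2 ≤ ∫ x, g x * g x := by
  rw [← real_inner_self_eq_norm_sq, ← integral_mul_contToL2]
  have h1 : ∫ x in Ioo a b, contToL2 a b g hg x * g x = ∫ x in Ioo a b, g x * g x := by
    refine integral_congr_ae ?_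
    filter_upwards [coeFn_contToL2 hg] with y hy
    rw [hy]
  rw [h1]
  exact setIntegral_le_integral hi (Filter.Eventually.of_forall fun x => mul_self_nonneg _)

theorem kconv_sub {k ψ χ : ℝ → ℝ} (hk : LocallyIntegrable k) (hψ : Continuous ψ)
    (hψc : HasCompactSupport ψ) (hχ : Continuous χ) (hχc : HasCompactSupport χ) :
    kconv k (ψ - χ) = kconv k ψ - kconv k χ := by
  have hi : ∀ {ψ : ℝ → ℝ}, Continuous ψ → HasCompactSupport ψ → ∀ x,
      Integrable fun y => k (x - y) * ψ y := by
    intro ψ hψ hψc x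
    have h := (hψc.convolutionExists_right (ContinuousLinearMap.mul ℝ ℝ) hk hψ (μ := volume)) x
    have h2 := h.integrable.comp_sub_left x
    simpa using h2
  ext x
  simp only [kconv, Pi.sub_apply, mul_sub]
  exact integral_sub (hi hψ hψc x) (hi hχ hχc x)

/-- For a kernel with an `L²` bound through `powForm`, the operator is bounded in the norm of
`H^s` along test functions. -/
theorem exists_norm_kconv_sub_sq_le {s : ℝ} (hs : 1 / 2 < s) (hs1 : s < 1) {k : ℝ → ℝ}
    (hk : LocallyIntegrable k) {c : ℝ} (hc : 0 ≤ c)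
    (hkc : ∀ ψ : ℝ → ℝ, Continuous ψ → HasCompactSupport ψ →
      Integrable (fun x => kconv k ψ x * kconv k ψ x) ∧
      ∫ x, kconv k ψ x * kconv k ψ x = c * powForm (2 * s - 1) ψ) :
    ∃ D : ℝ≥0∞, D ≠ ⊤ ∧ ∀ (φ ψ : ℝ → ℝ) (hφ : IsTestFunction a b φ) (hψ : IsTestFunction a b ψ),
      ENNReal.ofReal (‖contToL2 a b (kconv k (deriv φ))
          (continuous_kconv hk hφ.continuous_deriv' hφ.compact.deriv) -
        contToL2 a b (kconv k (deriv ψ))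
          (continuous_kconv hk hψ.continuous_deriv' hψ.compact.deriv)‖ ^ 2) ≤
      D * sobolevNormSq s fun x => (((φ - ψ) x : ℝ) : ℂ) := by
  obtain ⟨C, hC, hCb⟩ := exists_ofReal_powForm_deriv_le hs hs1
  refine ⟨ENNReal.ofReal c * C, by finiteness, fun φ ψ hφ hψ => ?_⟩
  have hsub := hφ.sub hψ
  have hd : deriv (φ - ψ) = deriv φ - deriv ψ := by
    ext x
    exact deriv_sub (hφ.smooth.differentiable (by simp)).differentiableAt
      (hψ.smooth.differentiable (by simp)).differentiableAt
  have hcont := continuous_kconv hk hsub.continuous_deriv' hsub.compact.deriv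
  have heq : contToL2 a b (kconv k (deriv φ))
          (continuous_kconv hk hφ.continuous_deriv' hφ.compact.deriv) -
        contToL2 a b (kconv k (deriv ψ))
          (continuous_kconv hk hψ.continuous_deriv' hψ.compact.deriv) =
        contToL2 a b (kconv k (deriv (φ - ψ))) hcont := by
    rw [contToL2, contToL2, contToL2, ← MemLp.toLp_sub]
    refine MemLp.toLp_congr _ _ (Filter.Eventually.of_forall fun x => ?_)
    rw [hd, kconv_sub hk hφ.continuous_deriv' hφ.compact.deriv hψ.continuous_deriv'
      hψ.compact.deriv]
  have h1 := hkc _ hsub.continuous_deriv' hsub.compact.deriv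
  rw [heq]
  calc _ ≤ ENNReal.ofReal (c * powForm (2 * s - 1) (deriv (φ - ψ))) := by
        rw [← h1.2]
        exact ENNReal.ofReal_le_ofReal (norm_contToL2_sq_le_integral hcont h1.1)
    _ = ENNReal.ofReal c * ENNReal.ofReal (powForm (2 * s - 1) (deriv (φ - ψ))) :=
        ENNReal.ofReal_mul hc
    _ ≤ ENNReal.ofReal c * (C * sobolevNormSq s fun x => (((φ - ψ) x : ℝ) : ℂ)) := by
        gcongr
        exact hCb _ hsub.smooth hsub.compact
    _ = _ := (mul_assoc _ _ _).symm

/-- The left convolution vanishes to the left of `a` and the right one to the right of `b`. Their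
product therefore lives on `(a, b)`, and the integral over the interval is the integral over the
line, whose sign is known. -/
theorem inner_kconv_nonneg {s : ℝ} (hs : 1 / 2 < s) (hs1 : s < 1) {φ : ℝ → ℝ}
    (h : IsTestFunction a b φ) :
    0 ≤ inner ℝ (contToL2 a b (kconv (powKernel s) (deriv φ)) (continuous_kconv
        (locallyIntegrable_powKernel hs1) h.continuous_deriv' h.compact.deriv))
      (contToL2 a b (kconv (fun z => powKernel s (-z)) (deriv φ)) (continuous_kconv
        (locallyIntegrable_powKernel_neg hs1) h.continuous_deriv' h.compact.deriv)) := by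
  have hc := continuous_kconv (locallyIntegrable_powKernel hs1) h.continuous_deriv' h.compact.deriv
  rw [← integral_mul_contToL2]
  have h1 : ∫ x in Ioo a b, contToL2 a b (kconv (powKernel s) (deriv φ)) hc x *
      kconv (fun z => powKernel s (-z)) (deriv φ) x =
      ∫ x, kconv (powKernel s) (deriv φ) x * kconv (fun z => powKernel s (-z)) (deriv φ) x := by
    rw [← setIntegral_Ioo_eq (a := a) (b := b)]
    · refine integral_congr_ae ?_
      filter_upwards [coeFn_contToL2 hc] with y hy
      rw [hy]
    · intro x hx
      rw [mem_Ioo, not_and_or, not_lt, not_lt] at hx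
      rcases hx with hx | hx
      · have : kconv (powKernel s) (deriv φ) x = 0 := by
          refine integral_eq_zero_of_ae (Filter.Eventually.of_forall fun y => ?_)
          simp only [Pi.zero_apply, mul_eq_zero]
          by_cases hy : y ∈ Ioo a b
          · exact Or.inl (if_neg (by linarith [hy.1]))
          · exact Or.inr (h.deriv_eq_zero hy)
        rw [this, zero_mul]
      · have : kconv (fun z => powKernel s (-z)) (deriv φ) x = 0 := by
          refine integral_eq_zero_of_ae (Filter.Eventually.of_forall fun y => ?_)
          simp only [Pi.zero_apply, mul_eq_zero]
          by_cases hy : y ∈ Ioo a b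
          · exact Or.inl (if_neg (by linarith [hy.2]))
          · exact Or.inr (h.deriv_eq_zero hy)
        rw [this, mul_zero]
  rw [h1]
  exact integral_powKernel_mul_powKernel_neg_nonneg hs hs1 h.continuous_deriv' h.compact.deriv

theorem cauchySeq_of_ofReal_norm_sq_le {X : Type*} [NormedAddCommGroup X] {f : ℕ → X} {D : ℝ≥0∞}
    (hD : D ≠ ⊤)
    (h : ∀ n, ENNReal.ofReal (‖f n - f (n + 1)‖ ^ 2) ≤ D * ENNReal.ofReal ((1 / 4) ^ n)) :
    CauchySeq f := by
  refine cauchySeq_of_le_geometric (1 / 2) (√D.toReal) (by norm_num) fun n => ?_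
  have h1 := h n
  rw [← ENNReal.ofReal_toReal hD, ← ENNReal.ofReal_mul ENNReal.toReal_nonneg,
    ENNReal.ofReal_le_ofReal_iff (by positivity)] at h1
  rw [dist_eq_norm]
  refine abs_le_of_sq_le_sq' ?_ (by positivity) |>.2
  rw [mul_pow, Real.sq_sqrt ENNReal.toReal_nonneg, ← pow_mul, mul_comm n 2, pow_mul]
  norm_num at h1 ⊢
  exact h1

/-- The fractional derivatives of an element of `H₀^s` exist, and have the sign that makes the
energy nonnegative. -/
theorem exists_isWeakDeriv_of_mem_sobolevZero {s : ℝ} (hs : 1 / 2 < s) (hs1 : s < 1) {u : L2 a b}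
    (hu : u ∈ sobolevZero a b s) :
    ∃ w z : L2 a b, IsWeakDeriv (kernelOp (powKernel s) u) w ∧
      IsWeakDeriv (kernelOp (fun z => powKernel s (-z)) u) z ∧ 0 ≤ inner ℝ w z := by
  have hk := locallyIntegrable_powKernel hs1
  have hk' := locallyIntegrable_powKernel_neg hs1
  -- The tolerance `(1/4)^n` is for squared norms, so the norms of successive differences decay like
  -- `(1/2)^n`.
  have hpos : ∀ n : ℕ, 0 < ENNReal.ofReal ((1 / 4) ^ n) := fun n =>
    ENNReal.ofReal_pos.2 (by positivity)
  choose φ hφ hφu using fun n : ℕ => hu _ (hpos n)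
  have hsub : ∀ n, sobolevNormSq s (fun x => (((φ n - φ (n + 1)) x : ℝ) : ℂ)) ≤
      4 * ENNReal.ofReal ((1 / 4) ^ n) := by
    intro n
    have h1 : (fun x => (((φ n - φ (n + 1)) x : ℝ) : ℂ)) =
        (fun x => ((-1 : ℝ) : ℂ) * (zeroExt u x - ((φ n x : ℝ) : ℂ))) +
          fun x => zeroExt u x - ((φ (n + 1) x : ℝ) : ℂ) := by
      ext x
      simp only [Pi.sub_apply, Pi.add_apply]
      push_cast
      ring
    have hi : ∀ n, Integrable (fun x => zeroExt u x - ((φ n x : ℝ) : ℂ)) := fun n =>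
      (integrable_zeroExt u).sub (hφ n).integrable_ofReal
    rw [h1]
    refine (sobolevNormSq_add_le ((hi n).const_mul _) (hi (n + 1))).trans ?_
    rw [sobolevNormSq_mul]
    have h2 : ‖(-1 : ℝ)‖ₑ = 1 := by simp
    rw [h2, one_pow, one_mul, show (4 : ℝ≥0∞) = 2 + 2 by norm_num, add_mul]
    gcongr
    · exact (hφu n).le
    · refine (hφu (n + 1)).le.trans (ENNReal.ofReal_le_ofReal ?_)
      exact pow_le_pow_of_le_one (by norm_num) (by norm_num) (Nat.le_succ n)
  have hlim : ∀ {k : ℝ → ℝ} (hk : LocallyIntegrable k) (c : ℝ), 0 ≤ c →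
      (∀ ψ : ℝ → ℝ, Continuous ψ → HasCompactSupport ψ →
      Integrable (fun x => kconv k ψ x * kconv k ψ x) ∧
      ∫ x, kconv k ψ x * kconv k ψ x = c * powForm (2 * s - 1) ψ) →
      ∃ w, Filter.Tendsto (fun n => contToL2 a b (kconv k (deriv (φ n)))
          (continuous_kconv hk (hφ n).continuous_deriv' (hφ n).compact.deriv))
        Filter.atTop (nhds w) := by
    intro k hk c hc hkc
    obtain ⟨D, hD, hDb⟩ := exists_norm_kconv_sub_sq_le (a := a) (b := b) hs hs1 hk hc hkc
    refine cauchySeq_tendsto_of_complete (cauchySeq_of_ofReal_norm_sq_le (D := D * 4)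
      (by finiteness) fun n => ?_)
    refine (hDb _ _ (hφ n) (hφ (n + 1))).trans ?_
    rw [mul_assoc]
    gcongr
    exact hsub n
  obtain ⟨c, hc, hkc⟩ := exists_integral_powKernel_sq hs hs1
  obtain ⟨c', hc', hkc'⟩ := exists_integral_powKernel_neg_sq hs hs1
  obtain ⟨w, hw⟩ := hlim hk c hc hkc
  obtain ⟨z, hz⟩ := hlim hk' c' hc' hkc'
  have hv : Filter.Tendsto (fun n => contToL2 a b (φ n) (hφ n).smooth.continuous)
      Filter.atTop (nhds u) := by
    rw [tendsto_iff_norm_sub_tendsto_zero]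
    refine squeeze_zero (g := fun n => (1 / 2 : ℝ) ^ n) (fun n => norm_nonneg _) (fun n => ?_)
      (tendsto_pow_atTop_nhds_zero_of_lt_one (by norm_num) (by norm_num))
    have h1 := (norm_sub_contToL2_sq_le (by linarith) u (hφ n)).trans (hφu n).le
    rw [ENNReal.ofReal_le_ofReal_iff (by positivity)] at h1
    rw [norm_sub_rev]
    refine abs_le_of_sq_le_sq' ?_ (by positivity) |>.2
    rw [← pow_mul, mul_comm n 2, pow_mul]
    norm_num at h1 ⊢
    exact h1
  refine ⟨w, z, isWeakDeriv_kernelOp_of_tendsto hk (fun n => isWeakDeriv_kernelOp_test hk (hφ n))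
    hv hw, isWeakDeriv_kernelOp_of_tendsto hk' (fun n => isWeakDeriv_kernelOp_test hk' (hφ n))
    hv hz, ?_⟩
  -- Left and right derivatives are limits along the same test functions, so the sign of the inner
  -- product survives.
  exact ge_of_tendsto' (hw.inner hz) fun n => inner_kconv_nonneg hs hs1 (hφ n)

/-- A merely algebraic projection. It extends the form from `H₀^{α/2}` to all of `L²`, where
continuity is neither available nor required. -/
theorem exists_linearMap_eqOn {X : Type*} [AddCommGroup X] [Module ℝ X] (V : Submodule ℝ X) :
    ∃ P : X →ₗ[ℝ] V, ∀ u : V, P u = u := by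
  obtain ⟨P, hP⟩ := LinearMap.exists_leftInverse_of_injective V.subtype V.ker_subtype
  exact ⟨P, fun u => LinearMap.congr_fun hP u⟩

/-- On `H₀^{α/2}` the form `B` agrees with a symmetric nonnegative bilinear form. -/
theorem exists_bilinear_eq_rieszForm {α : ℝ} (hα : 1 < α) (hα2 : α < 2) :
    ∃ B : L2 a b →ₗ[ℝ] L2 a b →ₗ[ℝ] ℝ, (∀ u v, B u v = B v u) ∧ (∀ u, 0 ≤ B u u) ∧
      ∀ u ∈ sobolevZero a b (α / 2), ∀ v ∈ sobolevZero a b (α / 2),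
        rieszForm α u v = B u v := by
  have hs : 1 / 2 < α / 2 := by linarith
  have hs1 : α / 2 < 1 := by linarith
  have hk := locallyIntegrable_powKernel hs1
  have hk' := locallyIntegrable_powKernel_neg hs1
  set V := sobolevZero a b (α / 2) with hV
  have hcos : Real.cos (α * Real.pi / 2) < 0 :=
    Real.cos_neg_of_pi_div_two_lt_of_lt (by nlinarith [Real.pi_pos]) (by nlinarith [Real.pi_pos])
  -- `leftRL` takes the value `0` where no weak derivative exists, so linearity is established only
  -- on `V`, where one always does.
  have hL : ∃ Lm : V →ₗ[ℝ] L2 a b, ∀ u : V, Lm u = leftRL (α / 2) (u : L2 a b) := by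
    refine ⟨{ toFun := fun u => leftRL (α / 2) (u : L2 a b), map_add' := ?_, map_smul' := ?_ },
      fun _ => rfl⟩
    · intro u v
      obtain ⟨w, -, hw, -, -⟩ := exists_isWeakDeriv_of_mem_sobolevZero hs hs1 u.2
      obtain ⟨w', -, hw', -, -⟩ := exists_isWeakDeriv_of_mem_sobolevZero hs hs1 v.2
      rw [leftRL_eq hw, leftRL_eq hw', Submodule.coe_add,
        leftRL_eq (isWeakDeriv_kernelOp_add hk hw hw'), smul_add]
    · intro c u
      obtain ⟨w, -, hw, -, -⟩ := exists_isWeakDeriv_of_mem_sobolevZero hs hs1 u.2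
      rw [leftRL_eq hw, Submodule.coe_smul, leftRL_eq (isWeakDeriv_kernelOp_smul hk c hw),
        RingHom.id_apply, smul_comm]
  have hR : ∃ Rm : V →ₗ[ℝ] L2 a b, ∀ u : V, Rm u = rightRL (α / 2) (u : L2 a b) := by
    refine ⟨{ toFun := fun u => rightRL (α / 2) (u : L2 a b), map_add' := ?_, map_smul' := ?_ },
      fun _ => rfl⟩
    · intro u v
      obtain ⟨-, w, -, hw, -⟩ := exists_isWeakDeriv_of_mem_sobolevZero hs hs1 u.2
      obtain ⟨-, w', -, hw', -⟩ := exists_isWeakDeriv_of_mem_sobolevZero hs hs1 v.2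
      rw [rightRL_eq hw, rightRL_eq hw', Submodule.coe_add,
        rightRL_eq (isWeakDeriv_kernelOp_add hk' hw hw'), smul_add, neg_add]
    · intro c u
      obtain ⟨-, w, -, hw, -⟩ := exists_isWeakDeriv_of_mem_sobolevZero hs hs1 u.2
      rw [rightRL_eq hw, Submodule.coe_smul, rightRL_eq (isWeakDeriv_kernelOp_smul hk' c hw),
        RingHom.id_apply, smul_comm, smul_neg]
  obtain ⟨Lm, hLm⟩ := hL
  obtain ⟨Rm, hRm⟩ := hR
  obtain ⟨P, hP⟩ := exists_linearMap_eqOn V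
  have hpsd : ∀ u : V, 0 ≤ rieszForm α (u : L2 a b) u := by
    intro u
    obtain ⟨w, z, hw, hz, hwz⟩ := exists_isWeakDeriv_of_mem_sobolevZero hs hs1 u.2
    rw [rieszForm, leftRL_eq hw, rightRL_eq hz, inner_neg_right, inner_neg_left,
      real_inner_smul_left, real_inner_smul_right, real_inner_smul_left, real_inner_smul_right,
      real_inner_comm w z]
    -- The numerator is `-2 ⟨w, z⟩ / Γ(1 - α/2)² ≤ 0` because of the sign in `rightRL`; the
    -- denominator is negative since `π/2 < απ/2 < π`.
    refine div_nonneg_of_nonpos ?_ (by linarith)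
    have := mul_nonneg (mul_self_nonneg (Real.Gamma (1 - α / 2))⁻¹) hwz
    linarith
  refine ⟨LinearMap.mk₂ ℝ (fun u v => (inner ℝ (Lm (P u)) (Rm (P v)) +
    inner ℝ (Rm (P u)) (Lm (P v))) / (2 * Real.cos (α * Real.pi / 2))) ?_ ?_ ?_ ?_, ?_, ?_, ?_⟩
  · intro u u' v
    simp only [map_add, inner_add_left]
    ring
  · intro c u v
    simp only [map_smul, real_inner_smul_left, smul_eq_mul]
    ring
  · intro u v v'
    simp only [map_add, inner_add_right]
    ring
  · intro c u v
    simp only [map_smul, real_inner_smul_right, smul_eq_mul]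
    ring
  · intro u v
    simp only [LinearMap.mk₂_apply]
    rw [real_inner_comm (Rm (P v)), real_inner_comm (Lm (P v)), add_comm]
  · intro u
    have := hpsd (P u)
    simpa only [LinearMap.mk₂_apply, hLm, hRm] using! this
  · intro u hu v hv
    have h1 : P u = ⟨u, hu⟩ := hP ⟨u, hu⟩
    have h2 : P v = ⟨v, hv⟩ := hP ⟨v, hv⟩
    simp only [LinearMap.mk₂_apply, hLm, hRm, h1, h2]
    rfl

end Energy

end FeynmanKac

namespace FeynmanKac

/-! ### Sign and summation properties of the FBDF and PI weights. -/

section Weights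

theorem Ring.choose_succ_mul (r : ℝ) (n : ℕ) :
    _root_.Ring.choose r (n + 1) * (n + 1) = _root_.Ring.choose r n * (r - n) := by
  have h1 := _root_.Ring.descPochhammer_eq_factorial_smul_choose r n
  have h2 := _root_.Ring.descPochhammer_eq_factorial_smul_choose r (n + 1)
  rw [descPochhammer_succ_right, Polynomial.smeval_mul, h1, Polynomial.smeval_sub,
    Polynomial.smeval_X, pow_one, Polynomial.smeval_natCast, pow_zero, nsmul_eq_mul, nsmul_eq_mul,
    nsmul_eq_mul, mul_one, Nat.factorial_succ] at h2
  have h3 : (n.factorial : ℝ) ≠ 0 := by positivity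
  push_cast at h2
  refine mul_left_cancel₀ h3 ?_
  linarith

/-- The normalized FBDF weights, the coefficients of `(1 - ξ)^β`. -/
noncomputable def signedChoose (β : ℝ) (j : ℕ) : ℝ := (-1) ^ j * _root_.Ring.choose β j

theorem signedChoose_zero (β : ℝ) : signedChoose β 0 = 1 := by simp [signedChoose]

theorem signedChoose_succ_add (β : ℝ) (n : ℕ) :
    signedChoose (β + 1) (n + 1) = signedChoose β (n + 1) - signedChoose β n := by
  simp only [signedChoose, _root_.Ring.choose_succ_succ, pow_succ]
  ring

/-- Partial sums correspond to division of the generating function by `1 - ξ`, which lowers the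
exponent by one. -/
theorem sum_signedChoose (β : ℝ) (n : ℕ) :
    ∑ k ∈ Finset.range (n + 1), signedChoose (β + 1) k = signedChoose β n := by
  induction n with
  | zero => simp [signedChoose]
  | succ n ih => rw [Finset.sum_range_succ, ih, signedChoose_succ_add]; ring

theorem signedChoose_neg_eq {γ : ℝ} (hγ : 0 < γ) (n : ℕ) :
    signedChoose (-γ) n = Real.Gamma (n + γ) / (Real.Gamma γ * n.factorial) := by
  have hG := Real.Gamma_pos_of_pos hγ
  induction n with
  | zero => simp [signedChoose, hG.ne']
  | succ n ih =>
    have h1 := Ring.choose_succ_mul (-γ) n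
    have h2 : signedChoose (-γ) (n + 1) * (n + 1) = signedChoose (-γ) n * (n + γ) := by
      simp only [signedChoose, pow_succ]
      linear_combination (-1) * (-1) ^ n * h1
    have h3 : Real.Gamma ((n + 1 : ℕ) + γ) = (n + γ) * Real.Gamma (n + γ) := by
      rw [← Real.Gamma_add_one (by positivity)]
      push_cast
      ring_nf
    have h4 : (n.factorial : ℝ) ≠ 0 := by positivity
    rw [h3, Nat.factorial_succ]
    rw [ih] at h2
    push_cast
    rw [eq_div_iff (by positivity)]
    field_simp at h2
    linarith

theorem signedChoose_neg_pos {γ : ℝ} (hγ : 0 < γ) (n : ℕ) : 0 < signedChoose (-γ) n := by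
  rw [signedChoose_neg_eq hγ]
  have := Real.Gamma_pos_of_pos hγ
  have := Real.Gamma_pos_of_pos (show 0 < n + γ by positivity)
  positivity

/-- These weights are successive differences of the coefficients of `(1 - ξ)^{-γ}`, which decrease
because each is obtained from the last by the factor `(n + γ)/(n + 1) < 1`. -/
theorem signedChoose_succ_nonpos {γ : ℝ} (hγ : 0 < γ) (hγ1 : γ < 1) (n : ℕ) :
    signedChoose (1 - γ) (n + 1) ≤ 0 := by
  have h := signedChoose_succ_add (-γ) n
  rw [neg_add_eq_sub] at h
  have h1 := Ring.choose_succ_mul (-γ) n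
  have h2 : signedChoose (-γ) (n + 1) * (n + 1) = signedChoose (-γ) n * (n + γ) := by
    simp only [signedChoose, pow_succ]
    linear_combination (-1) * (-1) ^ n * h1
  have h3 := signedChoose_neg_pos hγ n
  have h4 : signedChoose (1 - γ) (n + 1) * (n + 1) ≤ 0 := by
    rw [h]
    nlinarith
  exact nonpos_of_mul_nonpos_left h4 (by positivity)

/-- Gautschi-type bounds for the partial sums of the FBDF weights. -/
theorem signedChoose_neg_le {γ : ℝ} (hγ : 0 < γ) (hγ1 : γ < 1) (n : ℕ) :
    signedChoose (-γ) (n + 1) ≤ ((n : ℝ) + 1) ^ (γ - 1) / Real.Gamma γ ∧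
      ((n : ℝ) + 1) ^ (γ - 1) / Real.Gamma γ ≤ signedChoose (-γ) n := by
  have hG := Real.Gamma_pos_of_pos hγ
  have hn : (0 : ℝ) < n + 1 := by positivity
  have hGn := Real.Gamma_pos_of_pos hn
  have hGg := Real.Gamma_pos_of_pos (show 0 < n + γ by positivity)
  have hfac : Real.Gamma (n + 1) = n.factorial := Real.Gamma_nat_eq_factorial n
  rw [signedChoose_neg_eq hγ, signedChoose_neg_eq hγ, Nat.factorial_succ]
  constructor
  -- Log-convexity of `Γ` at `n + 1 + γ`, between `n + 1` and `n + 2`.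
  · have h := Real.Gamma_mul_add_mul_le_rpow_Gamma_mul_rpow_Gamma hn
      (show (0 : ℝ) < n + 1 + 1 by positivity) (show 0 < 1 - γ by linarith) hγ (by ring)
    rw [Real.Gamma_add_one hn.ne', Real.mul_rpow hn.le hGn.le,
      show (1 - γ) * ((n : ℝ) + 1) + γ * (n + 1 + 1) = (n + 1 : ℕ) + γ by push_cast; ring] at h
    have h2 : Real.Gamma ((n : ℝ) + 1) ^ (1 - γ) * ((n + 1) ^ γ * Real.Gamma ((n : ℝ) + 1) ^ γ) =
        (n + 1) ^ γ * Real.Gamma (n + 1) := by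
      rw [mul_left_comm, ← Real.rpow_add hGn]
      simp
    rw [h2, hfac] at h
    rw [mul_comm (Real.Gamma γ), ← div_div]
    gcongr
    rw [div_le_iff₀ (by positivity), Real.rpow_sub_one hn.ne']
    refine h.trans (le_of_eq ?_)
    push_cast
    field_simp
  -- Log-convexity of `Γ` at `n + 1`, between `n + γ` and `n + γ + 1`.
  · have h := Real.Gamma_mul_add_mul_le_rpow_Gamma_mul_rpow_Gamma (show 0 < n + γ by positivity)
      (show 0 < n + γ + 1 by positivity) hγ (show 0 < 1 - γ by linarith) (by ring)
    rw [Real.Gamma_add_one (show (n : ℝ) + γ ≠ 0 by positivity),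
      Real.mul_rpow (by positivity) hGg.le,
      show γ * (n + γ) + (1 - γ) * (n + γ + 1) = (n : ℝ) + 1 by ring] at h
    have h2 : Real.Gamma (n + γ) ^ γ * ((n + γ) ^ (1 - γ) * Real.Gamma (n + γ) ^ (1 - γ)) =
        (n + γ) ^ (1 - γ) * Real.Gamma (n + γ) := by
      rw [mul_left_comm, ← Real.rpow_add hGg]
      simp
    rw [h2, hfac] at h
    have h3 : ((n : ℝ) + γ) ^ (1 - γ) ≤ (n + 1) ^ (1 - γ) :=
      Real.rpow_le_rpow (by positivity) (by linarith) (by linarith)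
    have h4 : (n.factorial : ℝ) ≤ (n + 1) ^ (1 - γ) * Real.Gamma (n + γ) :=
      h.trans (mul_le_mul_of_nonneg_right h3 hGg.le)
    rw [mul_comm (Real.Gamma γ), ← div_div]
    gcongr
    rw [le_div_iff₀ (by positivity), ← neg_sub, Real.rpow_neg hn.le,
      inv_mul_le_iff₀ (by positivity)]
    exact h4

/-- Means of `s^{-β}` over the cells of the time grid. -/
noncomputable def cellMean (τ β : ℝ) (i : ℕ) : ℝ := ∫ x in (i * τ)..((i + 1 : ℕ) * τ), x ^ (-β) * τ⁻¹

theorem intervalIntegrable_cell {β : ℝ} (hβ1 : β < 1) (τ x y : ℝ) :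
    IntervalIntegrable (fun x : ℝ => x ^ (-β) * τ⁻¹) volume x y :=
  (intervalIntegral.intervalIntegrable_rpow' (by linarith)).mul_const _

/-- With `cellMean_le` this interlaces means and grid values: mean over cell `i + 1`, then the value
at their common endpoint `t_{i+1}`, then mean over cell `i`, in increasing order. Both sign
conditions on the PI weights follow. -/
theorem cellMean_ge {τ β : ℝ} (hτ : 0 < τ) (hβ : 0 < β) (hβ1 : β < 1) (i : ℕ) :
    (((i + 1 : ℕ) : ℝ) * τ) ^ (-β) ≤ cellMean τ β i := by
  have hle : (i : ℝ) * τ ≤ (i + 1 : ℕ) * τ := by gcongr; simp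
  have h : ∫ _x in (i * τ)..((i + 1 : ℕ) * τ), (((i + 1 : ℕ) : ℝ) * τ) ^ (-β) * τ⁻¹ ≤
      cellMean τ β i := by
    refine intervalIntegral.integral_mono_on_of_le_Ioo hle (by simp)
      (intervalIntegrable_cell hβ1 _ _ _) fun x hx => ?_
    have hx0 : 0 < x := lt_of_le_of_lt (by positivity) hx.1
    refine mul_le_mul_of_nonneg_right ?_ (by positivity)
    exact Real.rpow_le_rpow_of_nonpos hx0 hx.2.le (by linarith)
  rw [intervalIntegral.integral_const] at h
  refine le_trans (le_of_eq ?_) h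
  push_cast
  rw [smul_eq_mul]
  field_simp
  ring

theorem cellMean_le {τ β : ℝ} (hτ : 0 < τ) (hβ : 0 < β) (hβ1 : β < 1) (i : ℕ) :
    cellMean τ β (i + 1) ≤ (((i + 1 : ℕ) : ℝ) * τ) ^ (-β) := by
  have hle : ((i + 1 : ℕ) : ℝ) * τ ≤ (i + 1 + 1 : ℕ) * τ := by gcongr; simp
  have h : cellMean τ β (i + 1) ≤
      ∫ _x in ((i + 1 : ℕ) * τ)..((i + 1 + 1 : ℕ) * τ), (((i + 1 : ℕ) : ℝ) * τ) ^ (-β) * τ⁻¹ := by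
    refine intervalIntegral.integral_mono_on_of_le_Ioo hle
      (intervalIntegrable_cell hβ1 _ _ _) (by simp) fun x hx => ?_
    refine mul_le_mul_of_nonneg_right ?_ (by positivity)
    exact Real.rpow_le_rpow_of_nonpos (by positivity) hx.1.le (by linarith)
  rw [intervalIntegral.integral_const] at h
  refine h.trans (le_of_eq ?_)
  push_cast
  rw [smul_eq_mul]
  field_simp
  ring

theorem cellMean_zero {τ γ : ℝ} (hτ : 0 < τ) (hγ : 0 < γ) :
    cellMean τ (1 - γ) 0 = τ ^ (γ - 1) / γ := by
  rw [cellMean, intervalIntegral.integral_mul_const, integral_rpow (Or.inl (by linarith))]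
  rw [show -(1 - γ) + 1 = γ by ring, Real.rpow_sub_one hτ.ne']
  simp only [CharP.cast_eq_zero, zero_mul, zero_add, Nat.cast_one, one_mul,
    Real.zero_rpow hγ.ne']
  field_simp
  ring

theorem integral_cell_eq (τ β : ℝ) (n j : ℕ) :
    ∫ s in ((n : ℝ) - j - 1) * τ..((n : ℝ) - j) * τ, (n * τ - s) ^ (-β) * τ⁻¹ =
      cellMean τ β j := by
  rw [cellMean, intervalIntegral.integral_comp_sub_left (fun x => x ^ (-β) * τ⁻¹)]
  push_cast
  congr 1 <;> ring

/-- The convolution weights of the PI scheme. -/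
noncomputable def piConv (τ β : ℝ) : ℕ → ℝ
  | 0 => cellMean τ β 0
  | k + 1 => cellMean τ β (k + 1) - cellMean τ β k

theorem sum_piConv (τ β : ℝ) (n : ℕ) :
    ∑ k ∈ Finset.range (n + 1), piConv τ β k = cellMean τ β n := by
  induction n with
  | zero => simp [piConv]
  | succ n ih => rw [Finset.sum_range_succ, ih, piConv]; ring

theorem piWeight_of_lt (τ β : ℝ) {n j : ℕ} (hj : j < n) : piWeight τ β n j = piConv τ β j := by
  rcases j with _ | j
  · have h := integral_cell_eq τ β n 0
    simp only [CharP.cast_eq_zero, sub_zero] at h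
    rw [piWeight, if_pos rfl, piConv, h]
  · have h := integral_cell_eq τ β n (j + 1)
    have h2 := integral_cell_eq τ β n j
    rw [piWeight, if_neg (by omega), if_neg (by omega), piConv, h, ← h2]
    push_cast
    congr 2 <;> ring

/-- The last weight lacks the mean over cell `n` and so differs from `piConv τ β n`; hence the
separate initial weight in `convCoeff`. -/
theorem piWeight_self (τ β : ℝ) {n : ℕ} (hn : 1 ≤ n) :
    piWeight τ β n n = -cellMean τ β (n - 1) := by
  obtain ⟨m, rfl⟩ := Nat.exists_eq_add_of_le' hn
  have h := integral_cell_eq τ β (m + 1) m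
  rw [piWeight, if_neg (by omega), if_pos rfl, Nat.add_sub_cancel, ← h]
  push_cast
  congr 2 <;> ring

end Weights

/-! ### Stability of the two time semi-discrete schemes. -/

section TimeDiscrete

variable {a b : ℝ}

theorem sum_Icc_one_eq (f : ℕ → ℝ) (n : ℕ) :
    ∑ j ∈ Finset.Icc 1 n, f j = ∑ i ∈ Finset.range n, f (i + 1) := by
  induction n with
  | zero => simp
  | succ n ih => rw [Finset.sum_Icc_succ_top (by omega), Finset.sum_range_succ, ih]

/-- Coefficients of a scheme with a separate weight for the initial value. -/
noncomputable def convCoeff (p c₀ : ℕ → ℝ) (n j : ℕ) : ℝ := if j = 0 then c₀ n else p (n - j)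

theorem sum_convCoeff (p c₀ : ℕ → ℝ) (H : ℕ → L2 a b) (n : ℕ) :
    ∑ j ∈ Finset.range (n + 1), convCoeff p c₀ n j • H j =
      ∑ j ∈ Finset.range (n + 1), p (n - j) • H j + (c₀ n - p n) • H 0 := by
  rw [Finset.sum_range_succ', Finset.sum_range_succ']
  simp only [convCoeff, Nat.add_eq_zero_iff, one_ne_zero, and_false, ↓reduceIte, tsub_zero]
  rw [add_assoc, ← add_smul, add_sub_cancel]

/-- The subtracted `G 0` contributes minus the sum of all weights up to `n + 1`. Together with the
last convolution weight this leaves minus the partial sum up to `n`, that is `-signedChoose (-γ) n`.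
-/
theorem exp_smul_fbdfL2 {ρ γ τ : ℝ} (hτ : 0 < τ) (G : ℕ → L2 a b) (n : ℕ) :
    Real.exp (ρ * (n + 1 : ℕ) * τ) • fbdfL2 ρ γ τ G (n + 1) =
      τ ^ (-(1 - γ)) • ∑ j ∈ Finset.range (n + 1 + 1), convCoeff (signedChoose (1 - γ))
        (fun m => (m : ℝ) ^ (γ - 1) / Real.Gamma γ - signedChoose (-γ) (m - 1)) (n + 1) j •
          (Real.exp (ρ * j * τ) • G j) := by
  have hsum := sum_signedChoose (-γ) (n + 1)
  have hlast := signedChoose_succ_add (-γ) n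
  rw [neg_add_eq_sub] at hsum hlast
  rw [sum_convCoeff, fbdfL2, smul_add, smul_smul, ← Real.exp_add, add_neg_cancel, Real.exp_zero,
    one_smul, smul_smul]
  have h1 : Real.exp (ρ * (n + 1 : ℕ) * τ) * (Real.exp (-(ρ * (n + 1 : ℕ) * τ)) /
      (((n + 1 : ℕ) * τ) ^ (1 - γ) * Real.Gamma γ)) =
      τ ^ (-(1 - γ)) * (((n + 1 : ℕ) : ℝ) ^ (γ - 1) / Real.Gamma γ) := by
    rw [← mul_div_assoc, ← Real.exp_add, add_neg_cancel, Real.exp_zero,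
      Real.mul_rpow (by positivity) hτ.le, ← neg_sub 1 γ, Real.rpow_neg hτ.le,
      Real.rpow_neg (by positivity)]
    field_simp
  rw [h1]
  have h2 : ∑ j ∈ Finset.range (n + 1 + 1), fbdfWeight τ (1 - γ) (n + 1 - j) •
      (Real.exp (ρ * j * τ) • G j - G 0) = τ ^ (-(1 - γ)) •
      (∑ j ∈ Finset.range (n + 1 + 1), signedChoose (1 - γ) (n + 1 - j) •
        (Real.exp (ρ * j * τ) • G j) - signedChoose (-γ) (n + 1) • G 0) := by
    rw [← hsum, ← Finset.sum_range_reflect (signedChoose (1 - γ)), Finset.sum_smul,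
      ← Finset.sum_sub_distrib, Finset.smul_sum]
    refine Finset.sum_congr rfl fun j hj => ?_
    rw [Nat.add_sub_cancel, ← smul_sub, smul_smul]
    rfl
  rw [h2]
  simp only [CharP.cast_eq_zero, mul_zero, zero_mul, Real.exp_zero, one_smul, Nat.add_sub_cancel,
    hlast]
  module

theorem exp_smul_piL2 {ρ γ τ : ℝ} (hτ : 0 < τ) (G : ℕ → L2 a b) (n : ℕ) :
    Real.exp (ρ * (n + 1 : ℕ) * τ) • piL2 ρ γ τ G (n + 1) =
      (Real.Gamma γ)⁻¹ • ∑ j ∈ Finset.range (n + 1 + 1), convCoeff (piConv τ (1 - γ))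
        (fun m => ((m : ℝ) * τ) ^ (-(1 - γ)) - cellMean τ (1 - γ) (m - 1)) (n + 1) j •
          (Real.exp (ρ * j * τ) • G j) := by
  rw [piL2, smul_add, smul_comm _ (Real.Gamma γ)⁻¹, Finset.smul_sum, Finset.sum_range_succ',
    Finset.sum_range_succ' (n := n + 1), smul_smul, smul_add (Real.Gamma γ)⁻¹,
    smul_add (Real.Gamma γ)⁻¹]
  have h1 : ∀ j ∈ Finset.range (n + 1), Real.exp (ρ * (n + 1 : ℕ) * τ) •
      (Real.exp (ρ * (((j + 1 : ℕ) : ℝ) - (n + 1 : ℕ)) * τ) *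
        piWeight τ (1 - γ) (n + 1) (n + 1 - (j + 1))) • G (j + 1) =
      convCoeff (piConv τ (1 - γ))
        (fun m => ((m : ℝ) * τ) ^ (-(1 - γ)) - cellMean τ (1 - γ) (m - 1)) (n + 1) (j + 1) •
          (Real.exp (ρ * (j + 1 : ℕ) * τ) • G (j + 1)) := by
    intro j hj
    rw [convCoeff, if_neg (by omega), piWeight_of_lt _ _ (by omega), smul_smul, smul_smul,
      ← mul_assoc, ← Real.exp_add, mul_comm]
    congr 3
    ring
  rw [Finset.sum_congr rfl h1, add_assoc]
  congr 1
  rw [convCoeff, if_pos rfl, Nat.sub_zero, piWeight_self _ _ (by omega), smul_smul, smul_smul,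
    smul_smul, ← add_smul]
  congr 1
  have h2 : Real.exp (ρ * (n + 1 : ℕ) * τ) * Real.exp (ρ * ((0 : ℝ) - (n + 1 : ℕ)) * τ) = 1 := by
    rw [← Real.exp_add, Real.exp_eq_one_iff]
    ring
  have h3 : Real.exp (ρ * (n + 1 : ℕ) * τ) * Real.exp (-(ρ * (n + 1 : ℕ) * τ)) = 1 := by
    rw [← Real.exp_add, add_neg_cancel, Real.exp_zero]
  rw [Real.rpow_neg (by positivity)]
  simp only [CharP.cast_eq_zero, Nat.add_sub_cancel]
  linear_combination (-(Real.Gamma γ)⁻¹ * cellMean τ (1 - γ) n) * h2 +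
    ((((n + 1 : ℕ) : ℝ) * τ) ^ (1 - γ) * Real.Gamma γ)⁻¹ * h3
  simp

theorem fbdfL2_mem {V : Submodule ℝ (L2 a b)} {G : ℕ → L2 a b} {n : ℕ} (h : ∀ j ≤ n, G j ∈ V)
    (ρ γ τ : ℝ) : fbdfL2 ρ γ τ G n ∈ V := by
  refine V.add_mem (V.smul_mem _ (V.sum_mem fun j hj => V.smul_mem _ (V.sub_mem
    (V.smul_mem _ (h j ?_)) (h 0 (Nat.zero_le _))))) (V.smul_mem _ (h 0 (Nat.zero_le _)))
  have := Finset.mem_range.1 hj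
  omega

theorem piL2_mem {V : Submodule ℝ (L2 a b)} {G : ℕ → L2 a b} {n : ℕ} (h : ∀ j ≤ n, G j ∈ V)
    (ρ γ τ : ℝ) : piL2 ρ γ τ G n ∈ V := by
  refine V.add_mem (V.smul_mem _ (V.sum_mem fun j hj => V.smul_mem _ (h j ?_)))
    (V.smul_mem _ (h 0 (Nat.zero_le _)))
  have := Finset.mem_range.1 hj
  omega

theorem exp_smul_sub {ρ τ : ℝ} (G : ℕ → L2 a b) (n : ℕ) :
    Real.exp (ρ * (n + 1 : ℕ) * τ) • (τ⁻¹ • (G (n + 1) - Real.exp (-(ρ * τ)) • G n)) =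
      τ⁻¹ • (Real.exp (ρ * (n + 1 : ℕ) * τ) • G (n + 1) - Real.exp (ρ * n * τ) • G n) := by
  rw [smul_comm, smul_sub, smul_smul, ← Real.exp_add]
  congr 4
  push_cast
  ring

theorem exp_smul_piL1 {ρ τ : ℝ} (G : ℕ → L2 a b) (n : ℕ) :
    Real.exp (ρ * (n + 1 : ℕ) * τ) • piL1 ρ τ G (n + 1) = τ⁻¹ • (if n = 0 then
      Real.exp (ρ * (n + 1 : ℕ) * τ) • G (n + 1) - Real.exp (ρ * n * τ) • G n else
      (3 / 2 : ℝ) • (Real.exp (ρ * (n + 1 : ℕ) * τ) • G (n + 1)) -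
        (2 : ℝ) • (Real.exp (ρ * n * τ) • G n) +
        (1 / 2 : ℝ) • (Real.exp (ρ * (n - 1 : ℕ) * τ) • G (n - 1))) := by
  rcases n with _ | n
  · rw [piL1, if_pos rfl, if_pos rfl]
    exact exp_smul_sub G 0
  · rw [piL1, if_neg (by omega), if_neg (by omega), smul_comm, smul_add, smul_sub]
    simp only [smul_smul, Nat.add_sub_cancel, show n + 1 + 1 - 2 = n by omega]
    have h1 : Real.exp (ρ * (n + 1 + 1 : ℕ) * τ) * (2 * Real.exp (-(ρ * τ))) =
        2 * Real.exp (ρ * (n + 1 : ℕ) * τ) := by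
      rw [mul_left_comm, ← Real.exp_add]
      congr 2
      push_cast
      ring
    have h2 : Real.exp (ρ * (n + 1 + 1 : ℕ) * τ) * (1 / 2 * Real.exp (-(2 * ρ * τ))) =
        1 / 2 * Real.exp (ρ * n * τ) := by
      rw [mul_left_comm, ← Real.exp_add]
      congr 2
      push_cast
      ring
    rw [h1, h2, mul_comm (Real.exp _) (3 / 2)]

/-- A time step of a scheme, tested with the solution. -/
theorem IsTimeSemidiscrete.step {L1 L2' : (ℕ → L2 a b) → ℕ → L2 a b} {α K : ℝ} {N : ℕ}
    {g : L2 a b} {f G : ℕ → L2 a b} (h : IsTimeSemidiscrete L1 L2' α K N g f G)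
    {B : L2 a b →ₗ[ℝ] L2 a b →ₗ[ℝ] ℝ}
    (hB : ∀ u ∈ sobolevZero a b (α / 2), ∀ v ∈ sobolevZero a b (α / 2), rieszForm α u v = B u v)
    {n : ℕ} (hn : n < N) {e τ μ : ℝ} (he : 0 < e) (hτ : 0 < τ) {D S : L2 a b}
    (hD : e • L1 G (n + 1) = τ⁻¹ • D) (hS : e • L2' G (n + 1) = μ • S)
    (hmem : L2' G (n + 1) ∈ sobolevZero a b (α / 2)) :
    inner ℝ D (e • G (n + 1)) + (K * (τ * μ)) * B S (e • G (n + 1)) ≤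
      (τ * (e * ‖f (n + 1)‖)) * ‖e • G (n + 1)‖ := by
  have hG := h.mem (n + 1) hn
  have heq := h.eqn (n + 1) (by omega) hn _ hG
  rw [hB _ hmem _ hG] at heq
  have hD' : D = τ • (e • L1 G (n + 1)) := by rw [hD, smul_inv_smul₀ hτ.ne']
  have h1 : inner ℝ D (e • G (n + 1)) = τ * e * e * inner ℝ (L1 G (n + 1)) (G (n + 1)) := by
    rw [hD', real_inner_smul_left, real_inner_smul_left, real_inner_smul_right]
    ring
  have h2 : μ * B S (e • G (n + 1)) = e * e * B (L2' G (n + 1)) (G (n + 1)) := by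
    rw [← smul_eq_mul, ← LinearMap.smul_apply, ← map_smul, ← hS]
    simp only [map_smul, LinearMap.smul_apply, smul_eq_mul]
    ring
  have h3 := real_inner_le_norm (f (n + 1)) (G (n + 1))
  rw [norm_smul, Real.norm_of_nonneg he.le, h1]
  calc _ = τ * e * e * (inner ℝ (L1 G (n + 1)) (G (n + 1)) +
        K * B (L2' G (n + 1)) (G (n + 1))) := by linear_combination K * τ * h2
    _ ≤ τ * e * e * (‖f (n + 1)‖ * ‖G (n + 1)‖) := by
        rw [heq]
        gcongr
    _ = _ := by ring

/-- As `ρ ≥ 0`, the weights of the forces up to `t_n` are at most `e^{ρ t_n}`, and `A ≤ e^{ρ t_n}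
A`; the common factor cancels. -/
theorem norm_le_of_exp_mul_norm_le {ρ τ A θ : ℝ} (hρ : 0 ≤ ρ) (hτ : 0 < τ) (hA : 0 ≤ A)
    (hθ : 0 ≤ θ) {f G : ℕ → L2 a b} {n : ℕ}
    (h : ‖Real.exp (ρ * n * τ) • G n‖ ≤
      A + θ * ∑ i ∈ Finset.range n, τ * (Real.exp (ρ * (i + 1 : ℕ) * τ) * ‖f (i + 1)‖)) :
    ‖G n‖ ≤ A + θ * τ * ∑ j ∈ Finset.Icc 1 n, ‖f j‖ := by
  rw [norm_smul, Real.norm_of_nonneg (Real.exp_pos _).le] at h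
  have he : 1 ≤ Real.exp (ρ * n * τ) := Real.one_le_exp (by positivity)
  have h1 : ∑ i ∈ Finset.range n, τ * (Real.exp (ρ * (i + 1 : ℕ) * τ) * ‖f (i + 1)‖) ≤
      Real.exp (ρ * n * τ) * (τ * ∑ j ∈ Finset.Icc 1 n, ‖f j‖) := by
    rw [sum_Icc_one_eq, Finset.mul_sum, Finset.mul_sum]
    refine Finset.sum_le_sum fun i hi => ?_
    have hi' : i + 1 ≤ n := Finset.mem_range.1 hi
    rw [mul_left_comm]
    gcongr
  have h2 : Real.exp (ρ * n * τ) * ‖G n‖ ≤ Real.exp (ρ * n * τ) *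
      (A + θ * τ * ∑ j ∈ Finset.Icc 1 n, ‖f j‖) := by
    have h3 := mul_le_mul_of_nonneg_left h1 hθ
    have h4 := mul_le_mul_of_nonneg_right he hA
    linarith
  exact le_of_mul_le_mul_left h2 (Real.exp_pos _)

variable {α γ K ρ τ : ℝ}

/-- Stability of the FBDF scheme. -/
theorem norm_le_of_fbdf (hα : 1 < α) (hα2 : α < 2) (hγ : 0 < γ) (hγ1 : γ < 1) (hK : 0 < K)
    (hρ : 0 ≤ ρ) (hτ : 0 < τ) {N : ℕ} {g : L2 a b} {f G : ℕ → L2 a b}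
    (h : IsTimeSemidiscrete (fbdfL1 ρ τ) (fbdfL2 ρ γ τ) α K N g f G) {n : ℕ} (hn : n ≤ N) :
    ‖G n‖ ≤ ‖g‖ + √K * τ ^ (γ / 2) * energyNorm α g + 2 * τ * ∑ j ∈ Finset.Icc 1 n, ‖f j‖ := by
  obtain ⟨B, hBs, hBp, hB⟩ := exists_bilinear_eq_rieszForm (a := a) (b := b) hα hα2
  have hg : g ∈ sobolevZero a b (α / 2) := h.init ▸ h.mem 0 (Nat.zero_le _)
  have hE : energyNorm α g ^ 2 = B g g := by
    rw [energyNorm, hB g hg g hg, Real.sq_sqrt (hBp g)]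
  have hE0 : 0 ≤ energyNorm α g := Real.sqrt_nonneg _
  set H : ℕ → L2 a b := fun n => Real.exp (ρ * n * τ) • G n with hH
  have hH0 : H 0 = g := by simp [hH, h.init]
  have hpow : τ * τ ^ (-(1 - γ)) = τ ^ (γ / 2) * τ ^ (γ / 2) := by
    rw [← Real.rpow_add hτ, ← Real.rpow_one_add' hτ.le (by linarith)]
    ring_nf
  have hstab := fun m (hm : m ≤ N) => bdf_one_stability hBs hBp (p := signedChoose (1 - γ))
    (signedChoose_succ_nonpos hγ hγ1)
    (fun n => by
      have := sum_signedChoose (-γ) n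
      rw [neg_add_eq_sub] at this
      rw [this]
      exact (signedChoose_neg_pos hγ n).le)
    (c := convCoeff (signedChoose (1 - γ))
      fun m => (m : ℝ) ^ (γ - 1) / Real.Gamma γ - signedChoose (-γ) (m - 1))
    (fun n j hj _ => by rw [convCoeff, if_neg (by omega)])
    -- The Gautschi bounds put the initial weight between `p n` and `0`.
    (fun n hn => by
      obtain ⟨m, rfl⟩ := Nat.exists_eq_add_of_le' hn
      have h1 := signedChoose_neg_le hγ hγ1 m
      have h2 := signedChoose_succ_add (-γ) m
      rw [neg_add_eq_sub] at h2
      rw [convCoeff, if_pos rfl, Nat.add_sub_cancel, h2]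
      push_cast
      constructor <;> linarith [h1.1, h1.2])
    (H := H) (F := fun n => τ * (Real.exp (ρ * n * τ) * ‖f n‖))
    (κ := K * (τ * τ ^ (-(1 - γ)))) (by positivity)
    (fun n hn => h.step hB hn (Real.exp_pos _) hτ (exp_smul_sub G n) (exp_smul_fbdfL2 hτ G n)
      (fbdfL2_mem (fun j hj => h.mem j (by omega)) _ _ _)) hm
  refine norm_le_of_exp_mul_norm_le hρ hτ (by positivity) (by norm_num) ?_
  refine le_of_sq_le_add_sum_mul (h := fun n => ‖H n‖)
    (F := fun n => τ * (Real.exp (ρ * n * τ) * ‖f n‖)) (by positivity) (by norm_num)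
    (fun n => by positivity) (fun n => norm_nonneg _) ?_ (fun m _ hm => ?_) n hn
  · simp only [hH0]
    exact le_add_of_nonneg_right (by positivity)
  · refine (hstab m hm).trans (add_le_add_left ?_ _)
    rw [hH0, signedChoose_zero, ← hE, hpow]
    have h1 : K * (τ ^ (γ / 2) * τ ^ (γ / 2)) * 1 * energyNorm α g ^ 2 =
        (√K * τ ^ (γ / 2) * energyNorm α g) ^ 2 := by
      rw [mul_pow, mul_pow, Real.sq_sqrt hK.le]
      ring
    rw [h1]
    -- The square of the sum of the two initial quantities dominates the sum of their squares.
    have h2 : 0 ≤ ‖g‖ * (√K * τ ^ (γ / 2) * energyNorm α g) := by positivity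
    nlinarith

/-- Stability of the PI scheme. -/
theorem norm_le_of_pi (hα : 1 < α) (hα2 : α < 2) (hγ : 0 < γ) (hγ1 : γ < 1) (hK : 0 < K)
    (hρ : 0 ≤ ρ) (hτ : 0 < τ) {N : ℕ} {g : L2 a b} {f G : ℕ → L2 a b}
    (h : IsTimeSemidiscrete (piL1 ρ τ) (piL2 ρ γ τ) α K N g f G) {n : ℕ} (hn : n ≤ N) :
    ‖G n‖ ≤ 2 * ‖g‖ + 2 * (√K * τ ^ (γ / 2) / √(Real.Gamma (γ + 1)) * energyNorm α g) +
      6 * τ * ∑ j ∈ Finset.Icc 1 n, ‖f j‖ := by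
  obtain ⟨B, hBs, hBp, hB⟩ := exists_bilinear_eq_rieszForm (a := a) (b := b) hα hα2
  have hg : g ∈ sobolevZero a b (α / 2) := h.init ▸ h.mem 0 (Nat.zero_le _)
  have hE : energyNorm α g ^ 2 = B g g := by
    rw [energyNorm, hB g hg g hg, Real.sq_sqrt (hBp g)]
  have hE0 : 0 ≤ energyNorm α g := Real.sqrt_nonneg _
  have hG := Real.Gamma_pos_of_pos hγ
  have hG1 := Real.Gamma_pos_of_pos (show 0 < γ + 1 by linarith)
  set H : ℕ → L2 a b := fun n => Real.exp (ρ * n * τ) • G n with hH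
  have hH0 : H 0 = g := by simp [hH, h.init]
  have hβ : 0 < 1 - γ := by linarith
  have hβ1 : 1 - γ < 1 := by linarith
  have hpos : ∀ i, 0 < cellMean τ (1 - γ) i := fun i =>
    lt_of_lt_of_le (by positivity) (cellMean_ge hτ hβ hβ1 i)
  -- The leading weight is `τ^{γ-1}/γ`, and `γ Γ(γ) = Γ(γ + 1)` produces the Gamma factor of the
  -- bound.
  have hpow : K * (τ * (Real.Gamma γ)⁻¹) * cellMean τ (1 - γ) 0 =
      K * (τ ^ (γ / 2) * τ ^ (γ / 2)) / Real.Gamma (γ + 1) := by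
    rw [← Real.rpow_add hτ, cellMean_zero hτ hγ, Real.Gamma_add_one hγ.ne', add_halves,
      Real.rpow_sub_one hτ.ne']
    field_simp
  have hstab := fun m (hm : m ≤ N) => bdf_two_stability hBs hBp (p := piConv τ (1 - γ))
    (hpos 0).le
    (fun k => by
      have h1 := cellMean_le hτ hβ hβ1 k
      have h2 := cellMean_ge hτ hβ hβ1 k
      rw [piConv]
      linarith)
    (fun n => by
      rw [sum_piConv]
      exact (hpos n).le)
    (c := convCoeff (piConv τ (1 - γ))
      fun m => ((m : ℝ) * τ) ^ (-(1 - γ)) - cellMean τ (1 - γ) (m - 1))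
    (fun n j hj _ => by rw [convCoeff, if_neg (by omega)])
    (fun n hn => by
      obtain ⟨m, rfl⟩ := Nat.exists_eq_add_of_le' hn
      have h1 := cellMean_le hτ hβ hβ1 m
      have h2 := cellMean_ge hτ hβ hβ1 m
      rw [convCoeff, if_pos rfl, Nat.add_sub_cancel, piConv]
      constructor <;> linarith)
    (H := H) (F := fun n => τ * (Real.exp (ρ * n * τ) * ‖f n‖))
    (κ := K * (τ * (Real.Gamma γ)⁻¹)) (by positivity) (fun n => by positivity)
    (fun n hn => h.step hB hn (Real.exp_pos _) hτ (exp_smul_piL1 G n) (exp_smul_piL2 hτ G n)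
      (piL2_mem (fun j hj => h.mem j (by omega)) _ _ _)) hm
  refine norm_le_of_exp_mul_norm_le hρ hτ (by positivity) (by norm_num) ?_
  refine le_of_sq_le_add_sum_mul (h := fun n => ‖H n‖)
    (F := fun n => τ * (Real.exp (ρ * n * τ) * ‖f n‖)) (by positivity) (by norm_num)
    (fun n => by positivity) (fun n => norm_nonneg _) ?_ (fun m _ hm => ?_) n hn
  · simp only [hH0]
    have : 0 ≤ √K * τ ^ (γ / 2) / √(Real.Gamma (γ + 1)) * energyNorm α g := by positivity
    linarith [norm_nonneg g]
  · refine (hstab m hm).trans (add_le_add_left ?_ _)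
    rw [hH0, piConv, ← hE, hpow]
    have h1 : K * (τ ^ (γ / 2) * τ ^ (γ / 2)) / Real.Gamma (γ + 1) * energyNorm α g ^ 2 =
        (√K * τ ^ (γ / 2) / √(Real.Gamma (γ + 1)) * energyNorm α g) ^ 2 := by
      rw [mul_pow, div_pow, mul_pow, Real.sq_sqrt hK.le, Real.sq_sqrt hG1.le]
      ring
    rw [h1]
    have h2 : 0 ≤ ‖g‖ * (√K * τ ^ (γ / 2) / √(Real.Gamma (γ + 1)) * energyNorm α g) := by
      positivity
    -- With `e` the energy quantity, `2‖g‖² + 3e² ≤ (2‖g‖ + 2e)²`.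
    nlinarith [sq_nonneg ‖g‖, sq_nonneg (√K * τ ^ (γ / 2) / √(Real.Gamma (γ + 1)) * energyNorm α g)]

end TimeDiscrete

end FeynmanKac

section

open Filter Topology

/-! ## Absolutely continuous functions and fractional integrals in time -/

theorem AbsolutelyContinuousOnInterval.of_dist_le {X Y : Type*} [PseudoMetricSpace X]
    [PseudoMetricSpace Y] {f : ℝ → X} {g : ℝ → Y} {a b C : ℝ}
    (hf : AbsolutelyContinuousOnInterval f a b)
    (h : ∀ x ∈ uIcc a b, ∀ y ∈ uIcc a b, dist (g x) (g y) ≤ C * dist (f x) (f y)) :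
    AbsolutelyContinuousOnInterval g a b := by
  rw [absolutelyContinuousOnInterval_iff] at hf ⊢
  intro ε hε
  obtain ⟨δ, hδ, H⟩ := hf (ε / (|C| + 1)) (by positivity)
  refine ⟨δ, hδ, fun E hE hl => ?_⟩
  have h1 := H E hE hl
  rw [lt_div_iff₀ (by positivity)] at h1
  refine lt_of_le_of_lt ?_ h1
  rw [Finset.sum_mul]
  refine Finset.sum_le_sum fun i hi => ?_
  have h2 := h _ (hE.1 i hi).1 _ (hE.1 i hi).2
  have h3 : 0 ≤ dist (f (E.2 i).1) (f (E.2 i).2) := dist_nonneg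
  nlinarith [le_abs_self C]

theorem intervalIntegrable_sub_rpow {γ : ℝ} (hγ : 0 < γ) (x c d : ℝ) :
    IntervalIntegrable (fun s => (x - s) ^ (γ - 1)) volume c d := by
  have h := (intervalIntegral.intervalIntegrable_rpow' (a := x - c) (b := x - d)
    (r := γ - 1) (by linarith)).comp_sub_left x
  simpa using h

theorem integral_sub_rpow {γ : ℝ} (hγ : 0 < γ) (x c d : ℝ) :
    ∫ s in c..d, (x - s) ^ (γ - 1) = ((x - c) ^ γ - (x - d) ^ γ) / γ := by
  rw [intervalIntegral.integral_comp_sub_left (fun z => z ^ (γ - 1)) x,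
    integral_rpow (Or.inl (by linarith))]
  simp

/-- After `s = t - z` the integral becomes a superposition of translates of `q` with the integrable
weight `z^{γ-1}`, and all translates share the modulus of absolute continuity of `q`. -/
theorem AbsolutelyContinuousOnInterval.fractionalIntegral {γ T : ℝ} (hγ : 0 < γ) (hT : 0 < T)
    {q : ℝ → ℝ} (hq : AbsolutelyContinuousOnInterval q 0 T) :
    AbsolutelyContinuousOnInterval (fun t => ∫ s in (0 : ℝ)..t, (t - s) ^ (γ - 1) * q s) 0 T := by
  have huI : uIcc 0 T = Icc 0 T := uIcc_of_le hT.le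
  -- `Q` vanishes on negative arguments, so the integral over `[0, t]` can be taken over the fixed
  -- interval `[0, T]`. The constant `q 0` removed here returns as a multiple of `t^γ`.
  set Q : ℝ → ℝ := fun x => q (max x 0) - q 0 with hQ
  have hqc : ContinuousOn q (Icc 0 T) := huI ▸ hq.continuousOn
  have hpow : ∀ c d : ℝ, IntervalIntegrable (fun z : ℝ => z ^ (γ - 1)) volume c d := fun c d =>
    intervalIntegral.intervalIntegrable_rpow' (by linarith)
  have hQc : ∀ t ∈ Icc 0 T, ContinuousOn (fun z => Q (t - z)) (Icc 0 T) := by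
    intro t ht
    refine ContinuousOn.sub (hqc.comp (by fun_prop) ?_) continuousOn_const
    intro z hz
    exact ⟨le_max_right _ _, max_le (by linarith [hz.1, ht.2]) hT.le⟩
  have hint : ∀ t ∈ Icc 0 T,
      IntervalIntegrable (fun z : ℝ => z ^ (γ - 1) * Q (t - z)) volume 0 T := fun t ht =>
    (hpow 0 T).mul_continuousOn (huI ▸ hQc t ht)
  have key : AbsolutelyContinuousOnInterval (fun t => ∫ z in (0 : ℝ)..T, z ^ (γ - 1) * Q (t - z))
      0 T := by
    rw [absolutelyContinuousOnInterval_iff] at hq ⊢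
    intro ε hε
    have hC : ∫ z in (0 : ℝ)..T, z ^ (γ - 1) = T ^ γ / γ := by
      rw [integral_rpow (Or.inl (by linarith))]
      simp [Real.zero_rpow hγ.ne']
    have hC0 : 0 < T ^ γ / γ := by positivity
    set C := T ^ γ / γ
    obtain ⟨δ, hδ, H⟩ := hq (ε / (C + 1)) (by positivity)
    refine ⟨δ, hδ, fun E hE hl => ?_⟩
    have hmem : ∀ i ∈ Finset.range E.1, (E.2 i).1 ∈ Icc 0 T ∧ (E.2 i).2 ∈ Icc 0 T := by
      intro i hi
      have := hE.1 i hi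
      rwa [huI] at this
    have hshift : ∀ z ∈ Icc 0 T,
        ∑ i ∈ Finset.range E.1, |Q ((E.2 i).1 - z) - Q ((E.2 i).2 - z)| ≤ ε / (C + 1) := by
      intro z hz
      -- Translating by `z` and clipping at `0` keeps the intervals disjoint and does not lengthen
      -- them.
      have := H (E.1, fun i => (max ((E.2 i).1 - z) 0, max ((E.2 i).2 - z) 0)) ⟨?_, ?_⟩ ?_
      · refine le_trans (le_of_eq (Finset.sum_congr rfl fun i _ => ?_)) this.le
        simp [hQ, Real.dist_eq]
      · intro i hi
        obtain ⟨h1, h2⟩ := hmem i hi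
        rw [huI]
        exact ⟨⟨le_max_right _ _, max_le (by linarith [hz.1, h1.2]) hT.le⟩,
          ⟨le_max_right _ _, max_le (by linarith [hz.1, h2.2]) hT.le⟩⟩
      · intro i hi j hj hij
        have hd := hE.2 hi hj hij
        simp only [Function.onFun] at hd ⊢
        rw [Set.disjoint_left] at hd ⊢
        intro x hx hx'
        refine hd (a := x + z) ?_ ?_
        · simp only [uIoc, mem_Ioc, min_lt_iff, le_max_iff, max_lt_iff] at hx ⊢
          grind
        · simp only [uIoc, mem_Ioc, min_lt_iff, le_max_iff, max_lt_iff] at hx' ⊢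
          grind
      · refine lt_of_le_of_lt (Finset.sum_le_sum fun i _ => ?_) hl
        simp only [Real.dist_eq]
        refine (abs_max_sub_max_le_abs _ _ _).trans (le_of_eq ?_)
        congr 1
        ring
    have hsum : ∑ i ∈ Finset.range E.1, dist (∫ z in (0 : ℝ)..T, z ^ (γ - 1) * Q ((E.2 i).1 - z))
        (∫ z in (0 : ℝ)..T, z ^ (γ - 1) * Q ((E.2 i).2 - z)) ≤
        ∑ i ∈ Finset.range E.1, ∫ z in (0 : ℝ)..T,
          z ^ (γ - 1) * |Q ((E.2 i).1 - z) - Q ((E.2 i).2 - z)| := by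
      refine Finset.sum_le_sum fun i hi => ?_
      rw [Real.dist_eq, ← intervalIntegral.integral_sub (hint _ (hmem i hi).1)
        (hint _ (hmem i hi).2)]
      refine (intervalIntegral.abs_integral_le_integral_abs hT.le).trans (le_of_eq ?_)
      refine intervalIntegral.integral_congr fun z hz => ?_
      rw [huI] at hz
      rw [← mul_sub, abs_mul, abs_of_nonneg (Real.rpow_nonneg hz.1 _)]
    have hint2 : ∀ i ∈ Finset.range E.1, IntervalIntegrable (fun z : ℝ =>
        z ^ (γ - 1) * |Q ((E.2 i).1 - z) - Q ((E.2 i).2 - z)|) volume 0 T := by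
      intro i hi
      refine (hpow 0 T).mul_continuousOn ?_
      rw [huI]
      exact ((hQc _ (hmem i hi).1).sub (hQc _ (hmem i hi).2)).abs
    refine hsum.trans_lt ?_
    rw [← intervalIntegral.integral_finsetSum hint2]
    have hle : ∫ z in (0 : ℝ)..T, ∑ i ∈ Finset.range E.1,
        z ^ (γ - 1) * |Q ((E.2 i).1 - z) - Q ((E.2 i).2 - z)| ≤
        ∫ z in (0 : ℝ)..T, z ^ (γ - 1) * (ε / (C + 1)) := by
      refine intervalIntegral.integral_mono_on hT.le ?_ ((hpow 0 T).mul_const _) fun z hz => ?_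
      · have := IntervalIntegrable.sum (Finset.range E.1) hint2
        simpa [Finset.sum_fn] using this
      · rw [← Finset.mul_sum]
        exact mul_le_mul_of_nonneg_left (hshift z hz) (Real.rpow_nonneg hz.1 _)
    refine hle.trans_lt ?_
    rw [intervalIntegral.integral_mul_const, hC, ← mul_div_assoc, div_lt_iff₀ (by positivity)]
    nlinarith
  have hsec : AbsolutelyContinuousOnInterval (fun t => q 0 * ∫ z in (0 : ℝ)..t, z ^ (γ - 1)) 0 T :=
    ((hpow 0 T).absolutelyContinuousOnInterval_intervalIntegral (by simp)).const_mul _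
  refine (key.add hsec).of_dist_le (C := 1) fun x hx y hy => ?_
  rw [huI] at hx hy
  have heq : ∀ t ∈ Icc 0 T, ∫ s in (0 : ℝ)..t, (t - s) ^ (γ - 1) * q s =
      (∫ z in (0 : ℝ)..T, z ^ (γ - 1) * Q (t - z)) + q 0 * ∫ z in (0 : ℝ)..t, z ^ (γ - 1) := by
    intro t ht
    have h1 : ∫ s in (0 : ℝ)..t, (t - s) ^ (γ - 1) * q s =
        ∫ z in (0 : ℝ)..t, z ^ (γ - 1) * q (t - z) := by
      have := intervalIntegral.integral_comp_sub_left (a := 0) (b := t)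
        (fun z => z ^ (γ - 1) * q (t - z)) t
      simpa using this
    have hsub : ∀ c d : ℝ, c ∈ Icc 0 T → d ∈ Icc 0 T → uIcc c d ⊆ uIcc 0 T := fun c d hc hd =>
      huI ▸ uIcc_subset_Icc hc hd
    have h0 : (0 : ℝ) ∈ Icc 0 T := ⟨le_rfl, hT.le⟩
    have hTT : T ∈ Icc 0 T := ⟨hT.le, le_rfl⟩
    have h2 := intervalIntegral.integral_add_adjacent_intervals
      ((hint t ht).mono_set (hsub 0 t h0 ht)) ((hint t ht).mono_set (hsub t T ht hTT))
    have h3 : ∫ z in t..T, z ^ (γ - 1) * Q (t - z) = 0 := by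
      rw [intervalIntegral.integral_congr (g := fun _ => (0 : ℝ))]
      · simp
      · intro z hz
        rw [uIcc_of_le ht.2] at hz
        simp [hQ, max_eq_right (show t - z ≤ 0 by linarith [hz.1])]
    rw [h1, ← h2, h3, add_zero, ← intervalIntegral.integral_const_mul,
      ← intervalIntegral.integral_add ((hint t ht).mono_set (hsub 0 t h0 ht))
        ((hpow 0 t).const_mul _)]
    refine intervalIntegral.integral_congr fun z hz => ?_
    rw [uIcc_of_le ht.1] at hz
    simp only [hQ, max_eq_left (show 0 ≤ t - z by linarith [hz.2])]
    ring
  simp only [Pi.add_apply]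
  rw [heq x hx, heq y hy, one_mul]

/-- A maximum principle: at a maximum with quadratic contact the Riemann-Liouville derivative is
nonnegative. With `h = t - σ`, the left difference quotients are at least `-C h^{1+γ}/γ`, which
tends to `0`. -/
theorem fractionalIntegral_deriv_nonneg {γ t M C d : ℝ} (hγ : 0 < γ) (hγ1 : γ < 1) (ht : 0 < t)
    (hM : 0 ≤ M) {m : ℝ → ℝ} (hm : ContinuousOn m (Icc 0 t)) (hmM : ∀ s ∈ Icc 0 t, m s ≤ M)
    (hmC : ∀ᶠ s in 𝓝 t, s ≤ t → M - C * (t - s) ^ 2 ≤ m s)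
    (hd : HasDerivAt (fun τ => ∫ s in (0 : ℝ)..τ, (τ - s) ^ (γ - 1) * m s) d t) : 0 ≤ d := by
  wlog hC : 0 ≤ C generalizing C
  · refine this (C := 0) ?_ le_rfl
    filter_upwards [hmC] with s hs hst
    have := hs hst
    nlinarith [sq_nonneg (t - s)]
  set D : ℝ → ℝ := fun τ => ∫ s in (0 : ℝ)..τ, (τ - s) ^ (γ - 1) * m s with hD
  have hslope : Tendsto (slope D t) (𝓝[<] t) (𝓝 d) :=
    (hasDerivWithinAt_iff_tendsto_slope' (by simp)).1 hd.hasDerivWithinAt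
  have hlow : Tendsto (fun s => -(C * (t - s) ^ (1 + γ) / γ)) (𝓝[<] t) (𝓝 0) := by
    have hc : ContinuousAt (fun s : ℝ => -(C * (t - s) ^ (1 + γ) / γ)) t := by
      refine ((ContinuousAt.const_mul ?_ _).div_const _).neg
      exact ContinuousAt.rpow_const (by fun_prop) (Or.inr (by linarith))
    have := hc.tendsto
    simp only [sub_self, Real.zero_rpow (show 1 + γ ≠ 0 by linarith)] at this
    simp only [mul_zero, zero_div, neg_zero] at this
    exact this.mono_left nhdsWithin_le_nhds
  refine le_of_tendsto_of_tendsto hlow hslope ?_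
  obtain ⟨r, hr, hball⟩ := Metric.eventually_nhds_iff.1 hmC
  have hev : ∀ᶠ σ in 𝓝[<] t, t - r < σ ∧ 0 < σ ∧ σ < t := by
    have h1 : ∀ᶠ σ in 𝓝[<] t, t - r < σ :=
      nhdsWithin_le_nhds (lt_mem_nhds (by linarith))
    have h2 : ∀ᶠ σ in 𝓝[<] t, 0 < σ := nhdsWithin_le_nhds (lt_mem_nhds ht)
    filter_upwards [h1, h2, self_mem_nhdsWithin] with σ a b c using ⟨a, b, c⟩
  filter_upwards [hev] with σ ⟨hσr, hσ0, hσt⟩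
  have hh : 0 < t - σ := by linarith
  have hmσ : ∀ s ∈ Icc σ t, M - C * (t - σ) ^ 2 ≤ m s := by
    intro s hs
    have h1 := hball (y := s) (by rw [Real.dist_eq, abs_lt]; constructor <;> linarith [hs.1, hs.2])
      hs.2
    have h2 : (t - s) ^ 2 ≤ (t - σ) ^ 2 := by
      have := hs.1; have := hs.2
      nlinarith
    nlinarith
  have hint : ∀ x c e, 0 ≤ c → c ≤ e → e ≤ t →
      IntervalIntegrable (fun s => (x - s) ^ (γ - 1) * m s) volume c e := by
    intro x c e hc hce he
    refine (intervalIntegrable_sub_rpow hγ x c e).mul_continuousOn ?_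
    rw [uIcc_of_le hce]
    exact hm.mono (Icc_subset_Icc hc he)
  have hsplit : D t = (∫ s in (0 : ℝ)..σ, (t - s) ^ (γ - 1) * m s)
      + ∫ s in σ..t, (t - s) ^ (γ - 1) * m s :=
    (intervalIntegral.integral_add_adjacent_intervals (hint t 0 σ le_rfl hσ0.le hσt.le)
      (hint t σ t hσ0.le hσt.le le_rfl)).symm
  have h1 : (M - C * (t - σ) ^ 2) * ((t - σ) ^ γ / γ) ≤ ∫ s in σ..t, (t - s) ^ (γ - 1) * m s := by
    have e : (M - C * (t - σ) ^ 2) * ((t - σ) ^ γ / γ) =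
        ∫ s in σ..t, (t - s) ^ (γ - 1) * (M - C * (t - σ) ^ 2) := by
      rw [intervalIntegral.integral_mul_const, integral_sub_rpow hγ]
      simp [Real.zero_rpow hγ.ne', mul_comm]
    rw [e]
    refine intervalIntegral.integral_mono_on hσt.le ((intervalIntegrable_sub_rpow hγ _ _ _).mul_const _)
      (hint t σ t hσ0.le hσt.le le_rfl) fun s hs => ?_
    exact mul_le_mul_of_nonneg_left (hmσ s hs) (Real.rpow_nonneg (by linarith [hs.2]) _)
  -- On the old interval the kernel decreases when `σ` is replaced by `t`, so putting `M` in place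
  -- of `m` can only lower the change. With `h1` the total is `M (t^γ - σ^γ)/γ ≥ 0` up to the
  -- contact error.
  have h2 : M * ((t ^ γ - (t - σ) ^ γ) / γ - σ ^ γ / γ) ≤
      (∫ s in (0 : ℝ)..σ, (t - s) ^ (γ - 1) * m s) - D σ := by
    rw [hD]
    simp only
    rw [← intervalIntegral.integral_sub (hint t 0 σ le_rfl hσ0.le hσt.le)
      (hint σ 0 σ le_rfl hσ0.le hσt.le)]
    have e : M * ((t ^ γ - (t - σ) ^ γ) / γ - σ ^ γ / γ) =
        ∫ s in (0 : ℝ)..σ, ((t - s) ^ (γ - 1) - (σ - s) ^ (γ - 1)) * M := by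
      rw [intervalIntegral.integral_mul_const, intervalIntegral.integral_sub
        (intervalIntegrable_sub_rpow hγ _ _ _) (intervalIntegrable_sub_rpow hγ _ _ _),
        integral_sub_rpow hγ, integral_sub_rpow hγ]
      simp [Real.zero_rpow hγ.ne', mul_comm]
    rw [e]
    refine intervalIntegral.integral_mono_on_of_le_Ioo hσ0.le
      (((intervalIntegrable_sub_rpow hγ _ _ _).sub (intervalIntegrable_sub_rpow hγ _ _ _)).mul_const _)
      ((hint t 0 σ le_rfl hσ0.le hσt.le).sub (hint σ 0 σ le_rfl hσ0.le hσt.le)) fun s hs => ?_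
    have hb : (t - s) ^ (γ - 1) ≤ (σ - s) ^ (γ - 1) :=
      Real.rpow_le_rpow_of_nonpos (by linarith [hs.2]) (by linarith) (by linarith)
    have := hmM s ⟨hs.1.le, by linarith [hs.2]⟩
    nlinarith
  have h3 : 0 ≤ M * ((t ^ γ - σ ^ γ) / γ) := by
    have := Real.rpow_le_rpow hσ0.le hσt.le hγ.le
    have : 0 ≤ t ^ γ - σ ^ γ := by linarith
    positivity
  rw [slope_def_field]
  have e1 : (D σ - D t) / (σ - t) = (D t - D σ) / (t - σ) := by
    rw [← neg_sub, ← neg_sub t σ, neg_div_neg_eq]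
  rw [e1, le_div_iff₀ hh]
  have e2 : (t - σ) ^ (1 + γ) = (t - σ) * (t - σ) ^ γ := by
    rw [Real.rpow_add hh, Real.rpow_one]
  rw [e2, hsplit]
  have e3 : -(C * ((t - σ) * (t - σ) ^ γ) / γ) * (t - σ) =
    (M - C * (t - σ) ^ 2) * ((t - σ) ^ γ / γ) + M * ((t ^ γ - (t - σ) ^ γ) / γ - σ ^ γ / γ)
      - M * ((t ^ γ - σ ^ γ) / γ) := by ring
  linarith

/-! ### Energy estimate in continuous time. -/

section Energy

variable {E : Type*} [NormedAddCommGroup E] [InnerProductSpace ℝ E]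
  {B : E →L[ℝ] E →L[ℝ] ℝ} {γ T κ : ℝ} {H : ℝ → E}

theorem intervalIntegrable_sub_rpow_smul (hγ : 0 < γ) {t : ℝ} (ht : 0 ≤ t)
    (hH : ContinuousOn H (Icc 0 t)) :
    IntervalIntegrable (fun s => (t - s) ^ (γ - 1) • H s) volume 0 t :=
  (intervalIntegrable_sub_rpow hγ t 0 t).smul_continuousOn (by rwa [uIcc_of_le ht])

theorem deriv_fractionalIntegral_form_le [CompleteSpace E] (hs : ∀ x y, B x y = B y x) (hp : ∀ x, 0 ≤ B x x)
    (hγ : 0 < γ) (hγ1 : γ < 1) (hH : ContinuousOn H (Icc 0 T)) {t : ℝ} (ht : t ∈ Ioo 0 T)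
    (hd : DifferentiableAt ℝ H t)
    (hΦ : DifferentiableAt ℝ (fun t => ∫ s in (0 : ℝ)..t, (t - s) ^ (γ - 1) • H s) t)
    (hΨ : DifferentiableAt ℝ
      (fun t => ∫ s in (0 : ℝ)..t, (t - s) ^ (γ - 1) * B (H s) (H s)) t) :
    deriv (fun t => ∫ s in (0 : ℝ)..t, (t - s) ^ (γ - 1) * B (H s) (H s)) t ≤
      2 * B (deriv (fun t => ∫ s in (0 : ℝ)..t, (t - s) ^ (γ - 1) • H s) t) (H t) := by
  set Φ : ℝ → E := fun t => ∫ s in (0 : ℝ)..t, (t - s) ^ (γ - 1) • H s with hΦd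
  set Ψ : ℝ → ℝ := fun t => ∫ s in (0 : ℝ)..t, (t - s) ^ (γ - 1) * B (H s) (H s) with hΨd
  -- With `t` frozen, `m` is `B(H t, H t)` minus the square of `H s - H t`. It is maximal at `s =
  -- t`, with quadratic contact since `H` is differentiable there, and its fractional derivative at
  -- `t` is the difference of the two sides of the claim.
  set m : ℝ → ℝ := fun s => 2 * B (H s) (H t) - B (H s) (H s) with hm
  have hr : ∀ s, m s = B (H t) (H t) - B (H s - H t) (H s - H t) := by
    intro s
    simp only [hm, map_sub, sub_apply]
    rw [hs (H t) (H s)]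
    ring
  have hqc : ContinuousOn (fun s => B (H s) (H s)) (Icc 0 T) :=
    (B.continuous.comp_continuousOn hH).clm_apply hH
  have hbc : ContinuousOn (fun s => B (H s) (H t)) (Icc 0 T) :=
    (B.continuous.comp_continuousOn hH).clm_apply continuousOn_const
  have hD : HasDerivAt (fun τ => ∫ s in (0 : ℝ)..τ, (τ - s) ^ (γ - 1) * m s)
      (2 * B (deriv Φ t) (H t) - deriv Ψ t) t := by
    have h1 : HasDerivAt (fun τ => B (Φ τ) (H t)) (B (deriv Φ t) (H t)) t := by
      have := ((B.flip (H t)).hasFDerivAt (x := Φ t)).comp_hasDerivAt t hΦ.hasDerivAt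
      exact this
    refine ((h1.const_mul 2).sub hΨ.hasDerivAt).congr_of_eventuallyEq ?_
    filter_upwards [Ioo_mem_nhds ht.1 ht.2] with τ hτ
    have hsub : Icc 0 τ ⊆ Icc 0 T := Icc_subset_Icc le_rfl hτ.2.le
    have hu : uIcc 0 τ = Icc 0 τ := uIcc_of_le hτ.1.le
    have e1 : B (Φ τ) (H t) = ∫ s in (0 : ℝ)..τ, (τ - s) ^ (γ - 1) * B (H s) (H t) := by
      have := (B.flip (H t)).intervalIntegral_comp_comm
        (intervalIntegrable_sub_rpow_smul hγ hτ.1.le (hH.mono hsub))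
      rw [hΦd]
      simpa using this.symm
    have i1 : IntervalIntegrable (fun s => (τ - s) ^ (γ - 1) * B (H s) (H t)) volume 0 τ :=
      (intervalIntegrable_sub_rpow hγ τ 0 τ).mul_continuousOn (hu ▸ hbc.mono hsub)
    have i2 : IntervalIntegrable (fun s => (τ - s) ^ (γ - 1) * B (H s) (H s)) volume 0 τ :=
      (intervalIntegrable_sub_rpow hγ τ 0 τ).mul_continuousOn (hu ▸ hqc.mono hsub)
    simp only [Pi.sub_apply, e1, hΨd]
    rw [← intervalIntegral.integral_const_mul, ← intervalIntegral.integral_sub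
      (i1.const_mul 2) i2]
    refine intervalIntegral.integral_congr fun s _ => ?_
    simp only [hm]
    ring
  obtain ⟨c, hc⟩ := hd.hasDerivAt.isBigO_sub.bound
  have hmC : ∀ᶠ s in 𝓝 t, s ≤ t → B (H t) (H t) - ‖B‖ * c ^ 2 * (t - s) ^ 2 ≤ m s := by
    filter_upwards [hc] with s hsc _
    rw [hr]
    have h1 : B (H s - H t) (H s - H t) ≤ ‖B‖ * ‖H s - H t‖ * ‖H s - H t‖ :=
      (le_abs_self _).trans (B.le_opNorm₂ _ _)
    have h2 : ‖H s - H t‖ ^ 2 ≤ (c * ‖s - t‖) ^ 2 := by gcongr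
    have h3 : ‖s - t‖ ^ 2 = (t - s) ^ 2 := by rw [Real.norm_eq_abs, sq_abs]; ring
    have h4 : ‖B‖ * ‖H s - H t‖ ^ 2 ≤ ‖B‖ * (c * ‖s - t‖) ^ 2 := by gcongr
    rw [mul_pow, h3] at h4
    nlinarith
  have := fractionalIntegral_deriv_nonneg hγ hγ1 ht.1 (hp (H t))
    (((continuousOn_const.mul hbc).sub hqc).mono (Icc_subset_Icc le_rfl ht.2.le))
    (fun s _ => (hr s).trans_le (sub_le_self _ (hp _))) hmC hD
  linarith

theorem AbsolutelyContinuousOnInterval.form_self (hs : ∀ x y, B x y = B y x)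
    {a b : ℝ} (hH : AbsolutelyContinuousOnInterval H a b) :
    AbsolutelyContinuousOnInterval (fun s => B (H s) (H s)) a b := by
  obtain ⟨M, hM⟩ := hH.exists_bound
  refine hH.of_dist_le (C := ‖B‖ * (2 * M)) fun x hx y hy => ?_
  have e : B (H x) (H x) - B (H y) (H y) = B (H x + H y) (H x - H y) := by
    simp only [map_add, map_sub, add_apply]
    rw [hs (H y) (H x)]
    ring
  rw [Real.dist_eq, e, dist_eq_norm]
  refine (B.le_opNorm₂ _ _).trans ?_
  gcongr
  exact (norm_add_le _ _).trans (by linarith [hM x hx, hM y hy])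

theorem norm_le_of_fractional_energy [CompleteSpace E] (hs : ∀ x y, B x y = B y x) (hp : ∀ x, 0 ≤ B x x)
    (hγ : 0 < γ) (hγ1 : γ < 1) (hT : 0 < T) (hκ : 0 ≤ κ) {F : ℝ → ℝ}
    (hH : AbsolutelyContinuousOnInterval H 0 T) (hF : IntervalIntegrable F volume 0 T)
    (hF0 : ∀ s, 0 ≤ F s)
    (h : ∀ᵐ t : ℝ, t ∈ Ioo 0 T → DifferentiableAt ℝ H t ∧
      DifferentiableAt ℝ (fun t => ∫ s in (0 : ℝ)..t, (t - s) ^ (γ - 1) • H s) t ∧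
      inner ℝ (deriv H t) (H t) +
        κ * B (deriv (fun t => ∫ s in (0 : ℝ)..t, (t - s) ^ (γ - 1) • H s) t) (H t) ≤
          F t * ‖H t‖) {t : ℝ} (ht : t ∈ Icc 0 T) :
    ‖H t‖ ≤ ‖H 0‖ + 2 * ∫ s in (0 : ℝ)..t, F s := by
  have huI : uIcc 0 T = Icc 0 T := uIcc_of_le hT.le
  have hHc : ContinuousOn H (Icc 0 T) := huI ▸ hH.continuousOn
  set Φ : ℝ → E := fun t => ∫ s in (0 : ℝ)..t, (t - s) ^ (γ - 1) • H s with hΦd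
  set Ψ : ℝ → ℝ := fun t => ∫ s in (0 : ℝ)..t, (t - s) ^ (γ - 1) * B (H s) (H s) with hΨd
  have hΨ : AbsolutelyContinuousOnInterval Ψ 0 T := (hH.form_self hs).fractionalIntegral hγ hT
  have hN : AbsolutelyContinuousOnInterval (fun s => inner ℝ (H s) (H s)) 0 T :=
    hH.form_self (B := innerSL ℝ) (fun x y => real_inner_comm _ _)
  set N : ℝ → ℝ := fun s => inner ℝ (H s) (H s) with hNd
  have hNΨ : AbsolutelyContinuousOnInterval (fun s => N s + κ * Ψ s) 0 T :=
    hN.add (hΨ.const_mul κ)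
  have hder : ∀ᵐ t : ℝ, t ∈ Ioo 0 T → deriv (fun s => N s + κ * Ψ s) t ≤ 2 * (F t * ‖H t‖) := by
    filter_upwards [h, hΨ.ae_differentiableAt] with t h1 h2 htt
    obtain ⟨hd, hΦ, hle⟩ := h1 htt
    have hdΨ : DifferentiableAt ℝ Ψ t := h2 (huI ▸ Ioo_subset_Icc_self htt)
    have h3 : HasDerivAt N (2 * inner ℝ (deriv H t) (H t)) t := by
      have := hd.hasDerivAt.inner ℝ hd.hasDerivAt
      rw [real_inner_comm, ← two_mul] at this
      exact this
    have h5 : HasDerivAt (fun s => N s + κ * Ψ s)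
        (2 * inner ℝ (deriv H t) (H t) + κ * deriv Ψ t) t := h3.add (hdΨ.hasDerivAt.const_mul κ)
    rw [h5.deriv]
    have h4 := mul_le_mul_of_nonneg_left
      (deriv_fractionalIntegral_form_le hs hp hγ hγ1 hHc htt hd hΦ hdΨ) hκ
    linarith
  have hFH : IntervalIntegrable (fun s => F s * ‖H s‖) volume 0 T :=
    hF.mul_continuousOn (huI ▸ hHc.norm)
  have henergy : ∀ t ∈ Icc 0 T, ‖H t‖ ^ 2 ≤ ‖H 0‖ ^ 2 + 2 * ∫ s in (0 : ℝ)..t, F s * ‖H s‖ := by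
    intro t ht
    have hsub : uIcc 0 t ⊆ uIcc 0 T := by
      rw [huI, uIcc_of_le ht.1]
      exact Icc_subset_Icc le_rfl ht.2
    have hac := hNΨ.mono hsub
    have h1 := hac.integral_deriv_eq_sub
    have h2 : ∫ s in (0 : ℝ)..t, deriv (fun s => N s + κ * Ψ s) s ≤
        ∫ s in (0 : ℝ)..t, 2 * (F s * ‖H s‖) := by
      refine intervalIntegral.integral_mono_ae_restrict ht.1 hac.intervalIntegrable_deriv
        ((hFH.mono_set hsub).const_mul 2) ?_
      rw [← restrict_Ioo_eq_restrict_Icc, EventuallyLE, ae_restrict_iff' measurableSet_Ioo]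
      filter_upwards [hder] with s hs' hst using hs' ⟨hst.1, hst.2.trans_le ht.2⟩
    rw [h1, intervalIntegral.integral_const_mul] at h2
    have h3 : Ψ 0 = 0 := by simp [hΨd]
    have h4 : 0 ≤ Ψ t := intervalIntegral.integral_nonneg ht.1 fun s hs' =>
      mul_nonneg (Real.rpow_nonneg (by linarith [hs'.2]) _) (hp _)
    simp only [hNd, real_inner_self_eq_norm_sq, h3] at h2
    nlinarith
  have hsub : Icc 0 t ⊆ Icc 0 T := Icc_subset_Icc le_rfl ht.2
  obtain ⟨t1, ht1, hmax⟩ := isCompact_Icc.exists_isMaxOn ⟨t, right_mem_Icc.2 ht.1⟩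
    (hHc.norm.mono hsub)
  have h1 := henergy t1 (hsub ht1)
  have hI : ∀ x y, 0 ≤ x → x ≤ y → y ≤ T → IntervalIntegrable F volume x y := fun x y hx hxy hy =>
    hF.mono_set (by rw [huI, uIcc_of_le hxy]; exact Icc_subset_Icc hx hy)
  have h2 : ∫ s in (0 : ℝ)..t1, F s * ‖H s‖ ≤ (∫ s in (0 : ℝ)..t, F s) * ‖H t1‖ := by
    calc ∫ s in (0 : ℝ)..t1, F s * ‖H s‖ ≤ ∫ s in (0 : ℝ)..t1, F s * ‖H t1‖ := by
          refine intervalIntegral.integral_mono_on ht1.1 (hFH.mono_set ?_)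
            ((hI 0 t1 le_rfl ht1.1 (hsub ht1).2).mul_const _) fun s hs' => ?_
          · rw [huI, uIcc_of_le ht1.1]
            exact Icc_subset_Icc le_rfl (hsub ht1).2
          · exact mul_le_mul_of_nonneg_left (hmax ⟨hs'.1, hs'.2.trans ht1.2⟩) (hF0 s)
      _ = (∫ s in (0 : ℝ)..t1, F s) * ‖H t1‖ := intervalIntegral.integral_mul_const _ _
      _ ≤ _ := by
          refine mul_le_mul_of_nonneg_right ?_ (norm_nonneg _)
          rw [← intervalIntegral.integral_add_adjacent_intervals
            (hI 0 t1 le_rfl ht1.1 (hsub ht1).2) (hI t1 t ht1.1 ht1.2 ht.2)]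
          exact le_add_of_nonneg_right (intervalIntegral.integral_nonneg ht1.2 fun s _ => hF0 s)
  have h3 : ‖H t‖ ≤ ‖H t1‖ := hmax (right_mem_Icc.2 ht.1)
  have h0 : ‖H 0‖ ≤ ‖H t1‖ := hmax (left_mem_Icc.2 ht.1)
  -- At the maximum point, `‖H 0‖² ≤ ‖H 0‖ ‖H t1‖`; dividing by `‖H t1‖` gives the linear bound.
  rcases (norm_nonneg (H t1)).eq_or_lt with hz | hpos
  · rw [← hz] at h3
    have := intervalIntegral.integral_nonneg (μ := volume) ht.1 fun s _ => hF0 s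
    linarith [norm_nonneg (H 0)]
  · refine h3.trans ?_
    refine le_of_mul_le_mul_right ?_ hpos
    nlinarith [norm_nonneg (H 0)]

end Energy

namespace FeynmanKac

/-! ### The space semi-discrete scheme. -/

section Galerkin

variable {a b : ℝ}

theorem finiteDimensional_splineSpan (d J : ℕ) : FiniteDimensional ℝ (splineSpan a b d J) := by
  refine FiniteDimensional.span_of_finite ℝ (Set.Finite.subset
    ((Finset.Icc 1 (2 ^ J + d - 3)).finite_toSet.biUnion (t := fun k => {u : L2 a b |
      u =ᵐ[volume.restrict (Ioo a b)] fun x => scalingFunction d J k ((x - a) / (b - a))})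
      fun k _ => Set.Subsingleton.finite fun u hu v hv => ?_) ?_)
  · exact Lp.ext (EventuallyEq.trans hu (EventuallyEq.symm hv))
  · rintro u ⟨k, hk, hu⟩
    exact mem_biUnion (Finset.mem_coe.2 hk) hu

/-- On a finite-dimensional space the form is automatically continuous, and orthogonal projection
extends it continuously to `L²`. Continuity is what lets `B` pass through derivatives and integrals
in time. -/
theorem exists_continuous_bilinear_eq_rieszForm {α : ℝ} (hα : 1 < α) (hα2 : α < 2)
    (S : Submodule ℝ (L2 a b)) [FiniteDimensional ℝ S] (hS : S ≤ sobolevZero a b (α / 2)) :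
    ∃ B : L2 a b →L[ℝ] L2 a b →L[ℝ] ℝ, (∀ u v, B u v = B v u) ∧ (∀ u, 0 ≤ B u u) ∧
      ∀ u ∈ S, ∀ v ∈ S, rieszForm α u v = B u v := by
  obtain ⟨B, hs, hp, hB⟩ := exists_bilinear_eq_rieszForm (a := a) (b := b) hα hα2
  refine ⟨(LinearMap.toContinuousBilinearMap (B.domRestrict₁₂ S S)).bilinearComp
    S.orthogonalProjectionOnto S.orthogonalProjectionOnto, fun u v => ?_, fun u => ?_,
    fun u hu v hv => ?_⟩
  · exact hs (S.orthogonalProjectionOnto u) (S.orthogonalProjectionOnto v)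
  · exact hp (S.orthogonalProjectionOnto u)
  · rw [hB u (hS hu) v (hS hv)]
    have hu' := Submodule.starProjection_eq_self_iff.2 hu
    have hv' := Submodule.starProjection_eq_self_iff.2 hv
    rw [Submodule.starProjection_apply] at hu' hv'
    change B u v = B (S.orthogonalProjectionOnto u) (S.orthogonalProjectionOnto v)
    rw [hu', hv']

theorem deriv_mem_of_eventually_mem {E : Type*} [NormedAddCommGroup E] [InnerProductSpace ℝ E]
    (S : Submodule ℝ E) [S.HasOrthogonalProjection] {g : ℝ → E} {t : ℝ}
    (hg : DifferentiableAt ℝ g t) (h : ∀ᶠ s in 𝓝 t, g s ∈ S) : deriv g t ∈ S := by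
  have h1 : HasDerivAt (fun s => S.starProjection (g s)) (S.starProjection (deriv g t)) t :=
    S.starProjection.hasFDerivAt.comp_hasDerivAt t hg.hasDerivAt
  have h2 : HasDerivAt g (S.starProjection (deriv g t)) t := h1.congr_of_eventuallyEq <| by
    filter_upwards [h] with s hs using (Submodule.starProjection_eq_self_iff.2 hs).symm
  exact Submodule.starProjection_eq_self_iff.1 (h2.unique hg.hasDerivAt)

theorem intervalIntegral_mem {E : Type*} [NormedAddCommGroup E] [InnerProductSpace ℝ E]
    [CompleteSpace E] (S : Submodule ℝ E) [S.HasOrthogonalProjection] {g : ℝ → E} {c t : ℝ}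
    (hg : IntervalIntegrable g volume c t) (h : ∀ s ∈ uIcc c t, g s ∈ S) :
    ∫ s in c..t, g s ∈ S := by
  rw [← Submodule.starProjection_eq_self_iff, ← S.starProjection.intervalIntegral_comp_comm hg]
  exact intervalIntegral.integral_congr fun s hs => Submodule.starProjection_eq_self_iff.2 (h s hs)

variable {ρ γ α K T : ℝ} {f G : ℝ → L2 a b} {S : Submodule ℝ (L2 a b)}

theorem IsSpaceSemidiscrete.temperedIntegral_mem [FiniteDimensional ℝ S]
    (h : IsSpaceSemidiscrete ρ γ α K T S f G) (hγ : 0 < γ) {t : ℝ} (ht : t ∈ Icc 0 T) :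
    temperedIntegral ρ γ G t ∈ S := by
  have hsub : Icc 0 t ⊆ Icc 0 T := Icc_subset_Icc le_rfl ht.2
  have hc : ContinuousOn (fun s => Real.exp (ρ * s) • G s) (Icc 0 t) := by
    have := h.absCont.continuousOn
    rw [uIcc_of_le (ht.1.trans ht.2)] at this
    exact ContinuousOn.smul (f := fun s => Real.exp (ρ * s)) (by fun_prop) (this.mono hsub)
  refine S.smul_mem _ (S.smul_mem _ (intervalIntegral_mem S
    (intervalIntegrable_sub_rpow_smul hγ ht.1 hc) fun s hs => ?_))
  rw [uIcc_of_le ht.1] at hs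
  exact S.smul_mem _ (S.smul_mem _ (h.mem s (hsub hs)))

/-- Any finite-dimensional subspace of `H₀^{α/2}` will do; nothing else about splines enters. -/
theorem norm_le_of_spaceSemidiscrete [FiniteDimensional ℝ S] (hS : S ≤ sobolevZero a b (α / 2))
    (hα : 1 < α) (hα2 : α < 2) (hγ : 0 < γ) (hγ1 : γ < 1) (hK : 0 ≤ K) (hρ : 0 ≤ ρ) (hT : 0 < T)
    (hf : IntervalIntegrable f volume 0 T) (h : IsSpaceSemidiscrete ρ γ α K T S f G)
    {t : ℝ} (ht : t ∈ Icc 0 T) : ‖G t‖ ≤ ‖G 0‖ + 2 * ∫ s in (0 : ℝ)..t, ‖f s‖ := by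
  obtain ⟨B, hs, hp, hB⟩ := exists_continuous_bilinear_eq_rieszForm hα hα2 S hS
  have hΓ : 0 < Real.Gamma γ := Real.Gamma_pos_of_pos hγ
  set H : ℝ → L2 a b := fun s => Real.exp (ρ * s) • G s with hH
  have hHac : AbsolutelyContinuousOnInterval H 0 T :=
    (ContDiff.contDiffOn (f := fun s => Real.exp (ρ * s))
      (by fun_prop)).absolutelyContinuousOnInterval.smul h.absCont
  set Φ : ℝ → L2 a b := fun t => ∫ s in (0 : ℝ)..t, (t - s) ^ (γ - 1) • H s with hΦ
  -- The derivative of `Φ` is thus `Γ(γ) e^{ρt}` times the substantial derivative, whence `κ = K /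
  -- Γ(γ)` below.
  have hΦt : Φ = fun t => Real.Gamma γ • Real.exp (ρ * t) • temperedIntegral ρ γ G t := by
    funext t
    rw [temperedIntegral, smul_smul (Real.exp (ρ * t)), ← Real.exp_add, add_neg_cancel,
      Real.exp_zero, one_smul, smul_smul, mul_inv_cancel₀ hΓ.ne', one_smul]
  have hexp : ∀ t, HasDerivAt (fun s => Real.exp (ρ * s)) (ρ * Real.exp (ρ * t)) t := fun t => by
    have := ((hasDerivAt_id t).const_mul ρ).exp
    simpa [mul_comm] using this
  have hFint : IntervalIntegrable (fun s => Real.exp (ρ * s) * ‖f s‖) volume 0 T :=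
    hf.norm.continuousOn_mul (by fun_prop)
  have key := norm_le_of_fractional_energy (B := B) (κ := K / Real.Gamma γ) hs hp hγ hγ1 hT
    (by positivity) (F := fun s => Real.exp (ρ * s) * ‖f s‖) hHac hFint
    (fun s => by positivity) ?_ ht
  · have hft : IntervalIntegrable f volume 0 t := hf.mono_set (by
      rw [uIcc_of_le hT.le, uIcc_of_le ht.1]
      exact Icc_subset_Icc le_rfl ht.2)
    have h1 : ∫ s in (0 : ℝ)..t, Real.exp (ρ * s) * ‖f s‖ ≤
        Real.exp (ρ * t) * ∫ s in (0 : ℝ)..t, ‖f s‖ := by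
      rw [← intervalIntegral.integral_const_mul]
      refine intervalIntegral.integral_mono_on ht.1 (hft.norm.continuousOn_mul (by fun_prop))
        (hft.norm.const_mul _) fun s hs' => ?_
      have := hs'.2
      gcongr
    have h2 : 1 ≤ Real.exp (ρ * t) := Real.one_le_exp (mul_nonneg hρ ht.1)
    simp only [hH, norm_smul, Real.norm_eq_abs, Real.abs_exp, mul_zero, Real.exp_zero,
      abs_one, one_mul] at key
    refine le_of_mul_le_mul_left ?_ (Real.exp_pos (ρ * t))
    nlinarith [norm_nonneg (G 0)]
  · filter_upwards [h.eqn] with t heq htt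
    obtain ⟨hGd, hId, heqn⟩ := heq htt
    have htI : t ∈ Icc 0 T := Ioo_subset_Icc_self htt
    set D := substantialDeriv ρ (1 - γ) G t with hD
    have hDeq : D = deriv (temperedIntegral ρ γ G) t + ρ • temperedIntegral ρ γ G t := by
      rw [hD, substantialDeriv, sub_sub_cancel]
    -- `B` represents `rieszForm` only on `S`; since `S` is closed, it contains the integrals and
    -- derivatives in time of `S`-valued functions.
    have hDmem : D ∈ S := by
      rw [hDeq]
      refine S.add_mem (deriv_mem_of_eventually_mem S hId ?_)
        (S.smul_mem _ (h.temperedIntegral_mem hγ htI))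
      filter_upwards [Ioo_mem_nhds htt.1 htt.2] with s hs' using
        h.temperedIntegral_mem hγ (Ioo_subset_Icc_self hs')
    have hGmem := h.mem t htI
    have hHd : HasDerivAt H (Real.exp (ρ * t) • (deriv G t + ρ • G t)) t := by
      refine ((hexp t).smul hGd.hasDerivAt).congr_deriv ?_
      rw [smul_add, smul_smul, mul_comm ρ (Real.exp _)]
    have hΦd : HasDerivAt Φ (Real.Gamma γ • Real.exp (ρ * t) • D) t := by
      rw [hΦt, hDeq]
      refine (((hexp t).smul hId.hasDerivAt).const_smul (Real.Gamma γ)).congr_deriv ?_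
      simp only [smul_add, smul_smul, mul_comm ρ (Real.exp _)]
    refine ⟨hHd.differentiableAt, hΦd.differentiableAt, ?_⟩
    rw [hHd.deriv, hΦd.deriv]
    have he := heqn (G t) hGmem
    rw [hB D hDmem (G t) hGmem] at he
    have hle : inner ℝ (f t) (G t) ≤ ‖f t‖ * ‖G t‖ := real_inner_le_norm _ _
    simp only [hH, map_smul, smul_apply, smul_eq_mul, real_inner_smul_left,
      real_inner_smul_right, norm_smul, Real.norm_eq_abs, Real.abs_exp]
    have hc : K / Real.Gamma γ * (Real.exp (ρ * t) * (Real.Gamma γ * (Real.exp (ρ * t) *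
        B D (G t)))) = Real.exp (ρ * t) * Real.exp (ρ * t) * (K * B D (G t)) := by
      field_simp
    have hx := mul_le_mul_of_nonneg_left hle
      (mul_pos (Real.exp_pos (ρ * t)) (Real.exp_pos (ρ * t))).le
    rw [← he] at hx
    linarith

end Galerkin

end FeynmanKac

end

theorem mainTheorem3 (a b : ℝ) (hab : a < b) (α γ K pU : ℝ) (hα : 1 < α) (hα2 : α < 2)
    (hγ : 0 < γ) (hγ1 : γ < 1) (hK : 0 < K) (hpU : 0 ≤ pU) :
    (∀ (d J : ℕ), 2 ≤ d → ∀ (T : ℝ), 0 < T → ∀ (f G : ℝ → L2 a b),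
      IntervalIntegrable f volume 0 T →
      IsSpaceSemidiscrete pU γ α K T (galerkinSpace a b α d J) f G →
      ∀ t ∈ Icc 0 T, ‖G t‖ ≤ ‖G 0‖ + 2 * ∫ s in (0 : ℝ)..t, ‖f s‖) ∧
    (∀ (τ : ℝ), 0 < τ → ∀ (N : ℕ) (g : L2 a b) (f G : ℕ → L2 a b),
      IsTimeSemidiscrete (fbdfL1 pU τ) (fbdfL2 pU γ τ) α K N g f G →
      ∀ n, 1 ≤ n → n ≤ N →
        ‖G n‖ ≤ ‖g‖ + 2 * √K * τ ^ (γ / 2) * energyNorm α g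
          + 2 * τ * ∑ j ∈ Finset.Icc 1 n, ‖f j‖) ∧
    (∀ (τ : ℝ), 0 < τ → ∀ (N : ℕ) (g : L2 a b) (f G : ℕ → L2 a b),
      IsTimeSemidiscrete (piL1 pU τ) (piL2 pU γ τ) α K N g f G →
      ∀ n, 1 ≤ n → n ≤ N →
        ‖G n‖ ≤ 4 * ‖g‖ + 5 * √K * τ ^ (γ / 2) / √(Real.Gamma (γ + 1)) * energyNorm α g
          + 18 * τ * ∑ j ∈ Finset.Icc 1 n, ‖f j‖) := by
  refine ⟨fun d J _ T hT f G hf h t ht => ?_, fun τ hτ N g f G h n _ hn => ?_,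
    fun τ hτ N g f G h n _ hn => ?_⟩
  · have : FiniteDimensional ℝ (splineSpan a b d J) := finiteDimensional_splineSpan d J
    have : FiniteDimensional ℝ (galerkinSpace a b α d J) :=
      Submodule.finiteDimensional_of_le inf_le_left
    exact norm_le_of_spaceSemidiscrete inf_le_right hα hα2 hγ hγ1 hK.le hpU hT hf h ht
  -- The bounds obtained have smaller constants, with factor 1 before the energy norm here and 2, 2,
  -- 6 for PI; nonnegativity of the terms gives the stated ones.
  · have h1 := norm_le_of_fbdf hα hα2 hγ hγ1 hK hpU hτ h hn
    have h2 : 0 ≤ √K * τ ^ (γ / 2) * energyNorm α g := by unfold energyNorm; positivity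
    linarith
  · have h1 := norm_le_of_pi hα hα2 hγ hγ1 hK hpU hτ h hn
    have h2 : 0 ≤ √K * τ ^ (γ / 2) / √(Real.Gamma (γ + 1)) * energyNorm α g := by
      unfold energyNorm; positivity
    have h3 : 0 ≤ τ * ∑ j ∈ Finset.Icc 1 n, ‖f j‖ := by positivity
    have h4 : 5 * √K * τ ^ (γ / 2) / √(Real.Gamma (γ + 1)) * energyNorm α g =
      5 * (√K * τ ^ (γ / 2) / √(Real.Gamma (γ + 1)) * energyNorm α g) := by ring
    rw [h4]
    linarith [norm_nonneg g]
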